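/- Let $(M,g)$ be a smooth (Hausdorff, second countable) $2n$-dimensional real manifold with a smooth non-degenerate metric $g$ of arbitrary signature, and let $\nabla$ be its Levi-Civita connection; extend $g$, $\nabla$ and the Lie bracket complex-bilinearly to $\mathbb{C}\otimes TM$. Let $S\to M$ be a spinor bundle, i.e. a smooth complex vector bundle of rank $2^n$ with a smooth Clifford action $v\cdot\hat\varphi$ of $TM$ (extended complex-linearly to $\mathbb{C}\otimes TM$) such that $u\cdot(v\cdot\hat\varphi)+v\cdot(u\cdot\hat\varphi)=2g(u,v)\hat\varphi$ and every fibre is an irreducible representation. Let $\hat\nabla$ be any smooth complex-linear connection on $S$ satisfying the Leibniz rule $\hat\nabla_X(v\cdot\hat\varphi)=(\nabla_Xv)\cdot\hat\varphi+v\cdot\hat\nabla_X\hat\varphi$. Let $I\subset\mathbb{C}\otimes TM$ be a smooth distribution of constant rank $k$ which is isotropic, i.e. $g(X,Y)=0$ for all $X,Y\in I$, and let $\hat L_I\subset S$ consist of the spinors $\hat\varphi$ such that $v\cdot\hat\varphi=0$ for all $v\in I$. Consider the condition $(\ast)$ $\hat\nabla_X\hat\varphi$ takes values in $\hat L_I$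 for every smooth vector field $X$ tangent to $I$ and every smooth spinor field $\hat\varphi$ with values in $\hat L_I$. Then $I$ is integrable with totally geodesic leaves if and only if $(\ast)$ holds. Precisely: (a) $(\ast)$ holds if and only if, for all smooth complex vector fields $X,Y$ tangent to $I$, both $[X,Y]$ and $\nabla_XY$ are tangent to $I$ (this is the meaning of "integrable, with totally geodesic leaves" for a complex distribution). (b) If $I=\mathbb{C}\otimes I'$ is the complexification of a real distribution $I'\subset TM$, then $(\ast)$ holds if and only if $I'$ is integrable, i.e. a leaf (maximal connected integral manifold) of $I'$ passes through every point of $M$, and every leaf $L$ is a totally geodesic submanifold, i.e. every geodesic of $M$ which at some time passes through a point of $L$ and is tangent to $L$ there remains in $L$ for all times at which it is defined. -/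

import Mathlib

open Bundle Set
open scoped Manifold ContDiff Topology TensorProduct

noncomputable section

namespace PureSpinor

universe u v w

/-! ### Complexified tangent spaces -/

/-- Real part of an element of the complexification `ℂ ⊗ E` of a real vector space `E`:
`reC (a ⊗ e) = (Re a) e`. -/
def reC {E : Type*} [AddCommGroup E] [Module ℝ E] : (ℂ ⊗[ℝ] E) →ₗ[ℝ] E :=
  (TensorProduct.lid ℝ E).toLinearMap ∘ₗ LinearMap.rTensor E Complex.reLm

/-- Imaginary part of an element of the complexification `ℂ ⊗ E`: `imC (a ⊗ e) = (Im a) e`. -/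
def imC {E : Type*} [AddCommGroup E] [Module ℝ E] : (ℂ ⊗[ℝ] E) →ₗ[ℝ] E :=
  (TensorProduct.lid ℝ E).toLinearMap ∘ₗ LinearMap.rTensor E Complex.imLm

/-- The element `a + i b` of `ℂ ⊗ E`, for `a b : E`. -/
def mkC {E : Type*} [AddCommGroup E] [Module ℝ E] (a b : E) : ℂ ⊗[ℝ] E :=
  (1 : ℂ) ⊗ₜ[ℝ] a + Complex.I ⊗ₜ[ℝ] b

section Manifold

variable {n : ℕ} {M : Type u} [TopologicalSpace M]
  [ChartedSpace (EuclideanSpace ℝ (Fin (2 * n))) M]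

/-- Real vector fields on the `2n`-dimensional manifold `M`. -/
abbrev RealField (n : ℕ) (M : Type u) [TopologicalSpace M]
    [ChartedSpace (EuclideanSpace ℝ (Fin (2 * n))) M] : Type u :=
  (x : M) → TangentSpace (𝓡 (2 * n)) x

/-- The complexified tangent space `ℂ ⊗ T_x M`. -/
abbrev CTangent (n : ℕ) {M : Type u} [TopologicalSpace M]
    [ChartedSpace (EuclideanSpace ℝ (Fin (2 * n))) M] (x : M) : Type :=
  ℂ ⊗[ℝ] (TangentSpace (𝓡 (2 * n)) x)

/-- Complex vector fields, i.e. sections of `ℂ ⊗ TM`. -/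
abbrev ComplexField (n : ℕ) (M : Type u) [TopologicalSpace M]
    [ChartedSpace (EuclideanSpace ℝ (Fin (2 * n))) M] : Type u :=
  (x : M) → CTangent n x

/-- The real part of a complex vector field. -/
def reField (Z : ComplexField n M) : RealField n M := fun x => reC (Z x)

/-- The imaginary part of a complex vector field. -/
def imField (Z : ComplexField n M) : RealField n M := fun x => imC (Z x)

variable [IsManifold (𝓡 (2 * n)) ∞ M]

/-- The real vector field `X` is smooth at `x`. -/
def SmoothFieldAt (X : RealField n M) (x : M) : Prop :=
  ContMDiffAt (𝓡 (2 * n)) ((𝓡 (2 * n)).prod 𝓘(ℝ, EuclideanSpace ℝ (Fin (2 * n)))) ∞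
    (fun y => TotalSpace.mk' (EuclideanSpace ℝ (Fin (2 * n)))
      (E := (TangentSpace (𝓡 (2 * n)) : M → Type)) y (X y)) x

/-- The complex vector field `Z` is smooth at `x`. -/
def SmoothCFieldAt (Z : ComplexField n M) (x : M) : Prop :=
  SmoothFieldAt (reField Z) x ∧ SmoothFieldAt (imField Z) x

/-! ### Metrics of arbitrary signature and the Levi-Civita connection -/

/-- A smooth non-degenerate metric of arbitrary signature. -/
structure SemiRiemannianMetric (n : ℕ) (M : Type u) [TopologicalSpace M]
    [ChartedSpace (EuclideanSpace ℝ (Fin (2 * n))) M] [IsManifold (𝓡 (2 * n)) ∞ M] where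
  /-- The inner product on each tangent space. -/
  inner (x : M) : TangentSpace (𝓡 (2 * n)) x →L[ℝ] TangentSpace (𝓡 (2 * n)) x →L[ℝ] ℝ
  symm (x : M) (a b : TangentSpace (𝓡 (2 * n)) x) : inner x a b = inner x b a
  nondegenerate (x : M) (a : TangentSpace (𝓡 (2 * n)) x) (h : ∀ b, inner x a b = 0) : a = 0
  contMDiff : ContMDiff (𝓡 (2 * n)) ((𝓡 (2 * n)).prod
      𝓘(ℝ, EuclideanSpace ℝ (Fin (2 * n)) →L[ℝ] EuclideanSpace ℝ (Fin (2 * n)) →L[ℝ] ℝ)) ∞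
    (fun x => TotalSpace.mk'
      (EuclideanSpace ℝ (Fin (2 * n)) →L[ℝ] EuclideanSpace ℝ (Fin (2 * n)) →L[ℝ] ℝ)
      (E := fun x : M =>
        TangentSpace (𝓡 (2 * n)) x →L[ℝ] TangentSpace (𝓡 (2 * n)) x →L[ℝ] ℝ) x (inner x))

/-- The `ℂ`-bilinear extension of the metric to `ℂ ⊗ T_x M`. -/
def SemiRiemannianMetric.innerC (g : SemiRiemannianMetric n M) (x : M) (a b : CTangent n x) : ℂ :=
  ((g.inner x (reC a) (reC b) - g.inner x (imC a) (imC b) : ℝ) : ℂ)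
    + ((g.inner x (reC a) (imC b) + g.inner x (imC a) (reC b) : ℝ) : ℂ) * Complex.I

/-- Connections on the tangent bundle; `D Y x (X x)` is `(∇_X Y)(x)`. -/
abbrev AffineConnection (n : ℕ) (M : Type u) [TopologicalSpace M]
    [ChartedSpace (EuclideanSpace ℝ (Fin (2 * n))) M] [IsManifold (𝓡 (2 * n)) ∞ M] :=
  CovariantDerivative (𝓡 (2 * n)) (EuclideanSpace ℝ (Fin (2 * n)))
    (TangentSpace (𝓡 (2 * n)) : M → Type)

/-- `D` is the Levi-Civita connection of `g`: the smooth connection which is torsion-free and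
compatible with `g`. -/
structure IsLeviCivita (g : SemiRiemannianMetric n M) (D : AffineConnection n M) : Prop where
  smooth : CovariantDerivative.ContMDiffCovariantDerivative D ∞
  torsion_free : D.torsion = 0
  metric (X Y : RealField n M) (x : M) (hX : SmoothFieldAt X x) (hY : SmoothFieldAt Y x)
    (a : TangentSpace (𝓡 (2 * n)) x) :
    mvfderiv (𝓡 (2 * n)) (fun y => g.inner y (X y) (Y y)) x a
      = g.inner x (D X x a) (Y x) + g.inner x (X x) (D Y x a)

/-- The complex-bilinear extension `∇_W Z` of a connection to complex vector fields. -/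
def covC (D : AffineConnection n M) (W Z : ComplexField n M) : ComplexField n M := fun x =>
  mkC (D (reField Z) x (reC (W x)) - D (imField Z) x (imC (W x)))
    (D (imField Z) x (reC (W x)) + D (reField Z) x (imC (W x)))

/-- The complex-bilinear extension of the Lie bracket to complex vector fields. -/
def bracketC (W Z : ComplexField n M) : ComplexField n M := fun x =>
  mkC (VectorField.mlieBracket (𝓡 (2 * n)) (reField W) (reField Z) x
      - VectorField.mlieBracket (𝓡 (2 * n)) (imField W) (imField Z) x)
    (VectorField.mlieBracket (𝓡 (2 * n)) (reField W) (imField Z) x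
      + VectorField.mlieBracket (𝓡 (2 * n)) (imField W) (reField Z) x)

/-! ### Distributions -/

/-- A smooth complex distribution of rank `k`: a subspace of each `ℂ ⊗ T_x M`, locally spanned by
`k` smooth, pointwise linearly independent complex vector fields. -/
structure ComplexDistribution (n : ℕ) (M : Type u) [TopologicalSpace M]
    [ChartedSpace (EuclideanSpace ℝ (Fin (2 * n))) M] [IsManifold (𝓡 (2 * n)) ∞ M]
    (k : ℕ) where
  /-- The subspace at each point. -/
  space (x : M) : Submodule ℂ (CTangent n x)
  exists_frame (x : M) : ∃ U ∈ 𝓝 x, ∃ e : Fin k → ComplexField n M, ∀ y ∈ U,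
    (∀ i, SmoothCFieldAt (e i) y) ∧ LinearIndependent ℂ (fun i => e i y) ∧
      Submodule.span ℂ (range fun i => e i y) = space y

/-- A smooth real distribution of rank `k`. -/
structure RealDistribution (n : ℕ) (M : Type u) [TopologicalSpace M]
    [ChartedSpace (EuclideanSpace ℝ (Fin (2 * n))) M] [IsManifold (𝓡 (2 * n)) ∞ M]
    (k : ℕ) where
  /-- The subspace at each point. -/
  space (x : M) : Submodule ℝ (TangentSpace (𝓡 (2 * n)) x)
  exists_frame (x : M) : ∃ U ∈ 𝓝 x, ∃ e : Fin k → RealField n M, ∀ y ∈ U,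
    (∀ i, SmoothFieldAt (e i) y) ∧ LinearIndependent ℝ (fun i => e i y) ∧
      Submodule.span ℝ (range fun i => e i y) = space y

variable {k : ℕ}

/-- The distribution is isotropic (totally null): any two of its vectors are orthogonal. -/
def ComplexDistribution.IsIsotropic (I : ComplexDistribution n M k) (g : SemiRiemannianMetric n M) :
    Prop :=
  ∀ x, ∀ a ∈ I.space x, ∀ b ∈ I.space x, g.innerC x a b = 0

/-- `I` is the complexification of the real distribution `I'`. -/
def ComplexDistribution.IsComplexificationOf (I : ComplexDistribution n M k)
    (I' : RealDistribution n M k) : Prop :=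
  ∀ x, I.space x = (I'.space x).baseChange ℂ

/-- `X` is a smooth complex vector field tangent to `I`, i.e. `X ∈ Γ(I)`. -/
def ComplexDistribution.IsSection (I : ComplexDistribution n M k) (X : ComplexField n M) :
    Prop :=
  (∀ x, SmoothCFieldAt X x) ∧ ∀ x, X x ∈ I.space x

/-- Integrability of a complex distribution: the Lie bracket of two vector fields tangent to `I`
is tangent to `I`. -/
def ComplexDistribution.IsInvolutive (I : ComplexDistribution n M k) : Prop :=
  ∀ X Y : ComplexField n M, I.IsSection X → I.IsSection Y → ∀ x, bracketC X Y x ∈ I.space x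

/-- The totally geodesic condition on a complex distribution (whose leaves are only formal):
`∇_X Y` is tangent to `I` for all `X`, `Y` tangent to `I`. -/
def ComplexDistribution.IsTotallyGeodesic (I : ComplexDistribution n M k)
    (D : AffineConnection n M) : Prop :=
  ∀ X Y : ComplexField n M, I.IsSection X → I.IsSection Y → ∀ x, covC D X Y x ∈ I.space x

/-! ### Leaves and geodesics -/

/-- A connected integral manifold of a real distribution: an injectively immersed connected
`k`-dimensional manifold whose tangent spaces are the spaces of the distribution. -/
structure IntegralManifold (I : RealDistribution n M k) where
  /-- The underlying abstract manifold. -/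
  carrier : Type u
  [topologicalSpace : TopologicalSpace carrier]
  [chartedSpace : ChartedSpace (EuclideanSpace ℝ (Fin k)) carrier]
  [isManifold : IsManifold (𝓡 k) ∞ carrier]
  [connectedSpace : ConnectedSpace carrier]
  /-- The immersion. -/
  incl : carrier → M
  contMDiff_incl : ContMDiff (𝓡 k) (𝓡 (2 * n)) ∞ incl
  injective_incl : Function.Injective incl
  range_mfderiv (y : carrier) :
    LinearMap.range (mfderiv (𝓡 k) (𝓡 (2 * n)) incl y).toLinearMap = I.space (incl y)

attribute [instance] IntegralManifold.topologicalSpace IntegralManifold.chartedSpace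
  IntegralManifold.isManifold IntegralManifold.connectedSpace

/-- A leaf is a maximal connected integral manifold. -/
def IntegralManifold.IsLeaf {I : RealDistribution n M k} (L : IntegralManifold I) : Prop :=
  ∀ L' : IntegralManifold I, (range L.incl ∩ range L'.incl).Nonempty →
    range L'.incl ⊆ range L.incl

/-- A real distribution is integrable if a leaf passes through every point. -/
def RealDistribution.IsIntegrable (I : RealDistribution n M k) : Prop :=
  ∀ x : M, ∃ L : IntegralManifold I, L.IsLeaf ∧ x ∈ range L.incl

/-- The vector field with constant components `a` in the coordinates given by the preferred chart
at `p`. Its value at `p` is `a`. -/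
def coordField (p : M) (a : EuclideanSpace ℝ (Fin (2 * n))) : RealField n M := fun x =>
  (trivializationAt (EuclideanSpace ℝ (Fin (2 * n)))
    (TangentSpace (𝓡 (2 * n)) : M → Type) p).symm x a

/-- The covariant acceleration of a curve `γ` at time `t`, computed in the preferred chart at the
point `γ t`: `(xᶜ)'' + Γᶜ_{ab} (xᵃ)' (xᵇ)'`. -/
def acceleration (D : AffineConnection n M) (γ : ℝ → M) (t : ℝ) :
    TangentSpace (𝓡 (2 * n)) (γ t) :=
  let x : ℝ → EuclideanSpace ℝ (Fin (2 * n)) := fun s => extChartAt (𝓡 (2 * n)) (γ t) (γ s)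
  let v : TangentSpace (𝓡 (2 * n)) (γ t) := deriv x t
  let a : TangentSpace (𝓡 (2 * n)) (γ t) := deriv (deriv x) t
  a + D (coordField (γ t) (deriv x t)) (γ t) v

/-- `γ` restricted to the open interval `J` is a smooth (affinely parametrized) geodesic. -/
structure IsGeodesicOn (D : AffineConnection n M) (γ : ℝ → M) (J : Set ℝ) : Prop where
  isOpen : IsOpen J
  ordConnected : J.OrdConnected
  contMDiffOn : ContMDiffOn 𝓘(ℝ, ℝ) (𝓡 (2 * n)) ∞ γ J
  geodesic : ∀ t ∈ J, acceleration D γ t = 0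

/-- The velocity of a curve. -/
def velocity (γ : ℝ → M) (t : ℝ) : TangentSpace (𝓡 (2 * n)) (γ t) :=
  mfderiv 𝓘(ℝ, ℝ) (𝓡 (2 * n)) γ t (1 : ℝ)

/-- The immersed submanifold `L` is totally geodesic: every geodesic of `M` which at some time
`t₀` passes through a point of `L` and is tangent to `L` there is, for all times, a curve in `L`. -/
def IntegralManifold.IsTotallyGeodesic {I : RealDistribution n M k} (L : IntegralManifold I)
    (D : AffineConnection n M) : Prop :=
  ∀ (γ : ℝ → M) (J : Set ℝ), IsGeodesicOn D γ J →
    ∀ t₀ ∈ J, ∀ y : L.carrier, L.incl y = γ t₀ →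
      velocity γ t₀ ∈ I.space (γ t₀) →
        ∃ c : ℝ → L.carrier, ContinuousOn c J ∧ ∀ t ∈ J, L.incl (c t) = γ t

/-- All leaves of a real distribution are totally geodesic submanifolds. -/
def RealDistribution.HasTotallyGeodesicLeaves (I : RealDistribution n M k)
    (D : AffineConnection n M) : Prop :=
  ∀ L : IntegralManifold I, L.IsLeaf → L.IsTotallyGeodesic D

/-! ### Spinors -/

section Spinor

variable {F : Type w} [NormedAddCommGroup F] [NormedSpace ℝ F]
  {S : M → Type v} [TopologicalSpace (TotalSpace F S)]
  [∀ x, AddCommGroup (S x)] [∀ x, Module ℂ (S x)] [∀ x, TopologicalSpace (S x)]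
  [∀ x, IsTopologicalAddGroup (S x)] [∀ x, ContinuousSMul ℝ (S x)]
  [FiberBundle F S] [VectorBundle ℝ F S]

/-- The section `φ` of the bundle `S` is smooth at `x`. -/
def SmoothSpinorAt (n : ℕ) {M : Type u} [TopologicalSpace M]
    [ChartedSpace (EuclideanSpace ℝ (Fin (2 * n))) M] (F : Type w) [NormedAddCommGroup F] [NormedSpace ℝ F]
    {S : M → Type v} [TopologicalSpace (TotalSpace F S)] [∀ x, TopologicalSpace (S x)]
    [FiberBundle F S] (φ : (x : M) → S x) (x : M) : Prop :=
  ContMDiffAt (𝓡 (2 * n)) ((𝓡 (2 * n)).prod 𝓘(ℝ, F)) ∞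
    (fun y => TotalSpace.mk' F (E := S) y (φ y)) x

/-- The structure of a spinor bundle of `(M, g)` on a bundle `S` of complex vector spaces: a smooth
Clifford action of `TM` making every fibre an irreducible complex representation of the Clifford
algebra of `(T_x M, g_x)`, of dimension `2 ^ n`. -/
structure SpinorBundle (g : SemiRiemannianMetric n M) (F : Type w) [NormedAddCommGroup F]
    [NormedSpace ℝ F] (S : M → Type v) [TopologicalSpace (TotalSpace F S)]
    [∀ x, AddCommGroup (S x)] [∀ x, Module ℂ (S x)] [∀ x, TopologicalSpace (S x)]
    [FiberBundle F S] where
  /-- The Clifford action of tangent vectors. -/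
  cliff (x : M) : TangentSpace (𝓡 (2 * n)) x →ₗ[ℝ] (S x →ₗ[ℂ] S x)
  clifford (x : M) (a b : TangentSpace (𝓡 (2 * n)) x) (φ : S x) :
    cliff x a (cliff x b φ) + cliff x b (cliff x a φ) = ((2 * g.inner x a b : ℝ) : ℂ) • φ
  finrank_eq (x : M) : Module.finrank ℂ (S x) = 2 ^ n
  irreducible (x : M) (W : Submodule ℂ (S x)) (hW : ∀ a, ∀ φ ∈ W, cliff x a φ ∈ W) :
    W = ⊥ ∨ W = ⊤
  smooth_I (φ : (x : M) → S x) (x : M) (hφ : SmoothSpinorAt n F φ x) :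
    SmoothSpinorAt n F (fun y => Complex.I • φ y) x
  smooth_cliff (X : RealField n M) (φ : (x : M) → S x) (x : M) (hX : SmoothFieldAt X x)
    (hφ : SmoothSpinorAt n F φ x) : SmoothSpinorAt n F (fun y => cliff y (X y) (φ y)) x

/-- The Clifford action of a complexified tangent vector. -/
def SpinorBundle.cliffC {g : SemiRiemannianMetric n M} (σ : SpinorBundle g F S) {x : M}
    (a : CTangent n x) (φ : S x) : S x :=
  σ.cliff x (reC a) φ + Complex.I • σ.cliff x (imC a) φ

/-- The subspace `L_I` at `x`: the spinors annihilated by the Clifford action of all vectors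
of `I`. -/
def SpinorBundle.annihilated {g : SemiRiemannianMetric n M} (σ : SpinorBundle g F S)
    (I : ComplexDistribution n M k) (x : M) : Set (S x) :=
  {φ | ∀ a ∈ I.space x, σ.cliffC a φ = 0}

/-- `φ` is a smooth spinor field with values in `L_I`. -/
def SpinorBundle.IsAnnihilatedSection {g : SemiRiemannianMetric n M} (σ : SpinorBundle g F S)
    (I : ComplexDistribution n M k) (φ : (x : M) → S x) : Prop :=
  (∀ x, SmoothSpinorAt n F φ x) ∧ ∀ x, φ x ∈ σ.annihilated I x

/-- A spinorial connection: a smooth complex-linear connection on the spinor bundle satisfying the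
Leibniz rule with respect to the Clifford action, where vector fields are differentiated with the
connection `D` of `M`. -/
structure IsSpinorialConnection {g : SemiRiemannianMetric n M} (σ : SpinorBundle g F S)
    (D : AffineConnection n M) (N : CovariantDerivative (𝓡 (2 * n)) F S) : Prop where
  smooth : CovariantDerivative.ContMDiffCovariantDerivative N ∞
  complex_linear (φ : (x : M) → S x) (x : M) (hφ : SmoothSpinorAt n F φ x)
    (a : TangentSpace (𝓡 (2 * n)) x) :
    N (fun y => Complex.I • φ y) x a = Complex.I • N φ x a
  leibniz (X : RealField n M) (φ : (x : M) → S x) (x : M) (hX : SmoothFieldAt X x)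
    (hφ : SmoothSpinorAt n F φ x) (a : TangentSpace (𝓡 (2 * n)) x) :
    N (fun y => σ.cliff y (X y) (φ y)) x a
      = σ.cliff x (D X x a) (φ x) + σ.cliff x (X x) (N φ x a)

/-- The covariant derivative of a spinor field along a complex tangent vector. -/
def spinCovC (N : CovariantDerivative (𝓡 (2 * n)) F S) (φ : (x : M) → S x) {x : M}
    (a : CTangent n x) : S x :=
  N φ x (reC a) + Complex.I • N φ x (imC a)

end Spinor

end Manifold

end PureSpinor

end

open PureSpinor

/-! Everything is reduced to one condition: `∇_X Y` is tangent to `I` for all `X`, `Y` tangent to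
`I`.

Spinors. If `φ` takes values in `L_I` and `Y` is tangent to `I`, then `Y · φ = 0` identically, and
the Leibniz rule gives `0 = (∇_X Y) · φ + Y · ∇̂_X φ`. So (∗) says that `∇_X Y` kills `L_I`, and it
remains to see that a vector killing `L_I` lies in `I`. For a local frame `e` of `I` let `P = e₁ ⋯
e_k` in the Clifford action. Isotropy gives `e_i P = 0`, so the image of `P` lies in `L_I`. If `z P
= 0` with `z` outside the span of the `e_i`, nondegeneracy provides `v` orthogonal to all `e_i` with
`g(v, z) ≠ 0`; since `v` commutes with `P` up to sign, `2 g(v, z) P = (v z + z v) P = 0`, whereas `P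
≠ 0` by the same argument and induction (`cliffProd_ne_zero`,
`mem_span_of_cliff_mul_cliffProd_eq_zero`). Involutivity then follows from `[X, Y] = ∇_X Y - ∇_Y X`.
This is (a).

Real distributions. Taking real and imaginary parts, the condition becomes
`RealDistribution.IsParallelAlong` for `I'`. Near a point `I'` is the image of linear maps `K(y)`
which are right inverses of a fixed projection (`AdaptedFrame`, `lift`). The condition is the
vanishing of the transverse part of `∇_{K a} (K b)` (`secondForm`), and involutivity is the symmetry
of `DK(y)(K(y) a) b` in `a`, `b`.

Suppose `secondForm` vanishes. Symmetry of the Christoffel symbols makes `DK` symmetric, so the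
equation `dF = K(F)` has a solution through each point (`exists_totalSolution`), whose image is a
plaque. Declaring plaques open refines the topology of `M`, and the connected components of the
result are the leaves (`LeafSpace.isLeaf_leaf`). Along a geodesic the transverse part `b` of the
velocity satisfies `‖b'‖ ≤ C ‖b‖`, so it vanishes for all times once it vanishes at one. The
geodesic is then tangent to `I'`, hence continuous in the leaf topology, hence contained in one
leaf.

Conversely, integral manifolds through all points make `DK` symmetric, because second derivatives of
their parametrizations are. A geodesic issuing tangentially to a leaf stays in it, and near the
initial time in a plaque, so the transverse velocity is identically zero; its derivative at the
initial time is minus the second form on the diagonal (`PlaqueFrame.secondForm_self_eq_zero`).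
Symmetry and polarization give the vanishing of `secondForm`. -/

open PureSpinor

namespace PureSpinor

/-! ### Clifford modules -/

section CliffordAlgebraic

variable {V W : Type*} [AddCommGroup V] [Module ℂ V] [AddCommGroup W] [Module ℂ W]
  {B : LinearMap.BilinForm ℂ V} {c : V →ₗ[ℂ] Module.End ℂ W}

/-- The product of the Clifford actions of the vectors of a list. -/
noncomputable def cliffProd (c : V →ₗ[ℂ] Module.End ℂ W) (l : List V) : Module.End ℂ W :=
  (l.map c).prod

@[simp] lemma cliffProd_nil : cliffProd c [] = 1 := rfl

@[simp] lemma cliffProd_cons (a : V) (l : List V) :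
    cliffProd c (a :: l) = c a * cliffProd c l := by simp [cliffProd]

lemma cliff_mul_self (hc : ∀ a b, c a * c b + c b * c a = (2 * B a b) • 1) {a : V}
    (ha : B a a = 0) : c a * c a = 0 := by
  have h := hc a a
  rw [ha, mul_zero, zero_smul, ← two_smul ℂ] at h
  exact (smul_eq_zero.1 h).resolve_left two_ne_zero

lemma cliff_mul_anticomm (hc : ∀ a b, c a * c b + c b * c a = (2 * B a b) • 1) {a b : V}
    (hab : B a b = 0) : c a * c b = -(c b * c a) := by
  have h := hc a b
  rw [hab, mul_zero, zero_smul] at h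
  exact eq_neg_of_add_eq_zero_left h

/-- Each factor orthogonal to `a` contributes one sign. This moves a test vector to the right of a
product, where a relation `c z * cliffProd c l = 0` can be used. -/
lemma cliff_mul_cliffProd_comm (hc : ∀ a b, c a * c b + c b * c a = (2 * B a b) • 1) (a : V) :
    ∀ l : List V, (∀ b ∈ l, B a b = 0) →
      c a * cliffProd c l = (-1 : ℂ) ^ l.length • (cliffProd c l * c a)
  | [], _ => by simp
  | b :: l, h => by
    have ih := cliff_mul_cliffProd_comm hc a l fun d hd => h d (List.mem_cons_of_mem _ hd)
    rw [cliffProd_cons, ← mul_assoc, cliff_mul_anticomm hc (h b List.mem_cons_self), neg_mul,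
      mul_assoc, ih, List.length_cons, pow_succ, mul_smul_comm, mul_neg_one, neg_smul, mul_assoc]

lemma cliff_mul_cliffProd_of_mem (hc : ∀ a b, c a * c b + c b * c a = (2 * B a b) • 1) {a : V} :
    ∀ l : List V, (∀ b ∈ l, B a b = 0) → a ∈ l → c a * cliffProd c l = 0
  | [], _, h => by simp at h
  | b :: l, h, ha => by
    rw [cliffProd_cons]
    by_cases hab : a = b
    · subst hab
      rw [← mul_assoc, cliff_mul_self hc (h a List.mem_cons_self), zero_mul]
    · have hal : a ∈ l := (List.mem_cons.1 ha).resolve_left hab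
      rw [← mul_assoc, cliff_mul_anticomm hc (h b List.mem_cons_self), neg_mul, mul_assoc,
        cliff_mul_cliffProd_of_mem hc l (fun d hd => h d (List.mem_cons_of_mem _ hd)) hal,
        mul_zero, neg_zero]

/-- Each `e i` can be anticommuted to its own position in the product, where `c (e i)` squares to
zero; isotropy is what permits both. Consequently the image of the product consists of annihilated
spinors. -/
lemma cliff_mul_cliffProd_of_mem_span (hc : ∀ a b, c a * c b + c b * c a = (2 * B a b) • 1)
    {k : ℕ} {e : Fin k → V} (he : ∀ i j, B (e i) (e j) = 0) {a : V}
    (ha : a ∈ Submodule.span ℂ (range e)) : c a * cliffProd c (List.ofFn e) = 0 := by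
  induction ha using Submodule.span_induction with
  | mem x hx =>
    obtain ⟨i, rfl⟩ := hx
    refine cliff_mul_cliffProd_of_mem hc _ (fun b hb => ?_) (by simp)
    obtain ⟨j, rfl⟩ := List.mem_ofFn.1 hb
    exact he i j
  | zero => simp
  | add x y _ _ hx hy => rw [map_add, add_mul, hx, hy, add_zero]
  | smul t x _ hx => rw [map_smul, smul_mul_assoc, hx, smul_zero]

variable [FiniteDimensional ℂ V]

/-- A vector outside a subspace is detected by the orthogonal of the subspace. -/
lemma exists_orthogonal_ne_zero (hB : B.Nondegenerate) (hs : B.IsRefl) {s : Set V} {a : V}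
    (ha : a ∉ Submodule.span ℂ s) : ∃ v, (∀ b ∈ s, B v b = 0) ∧ B v a ≠ 0 := by
  by_contra! h
  apply ha
  rw [← LinearMap.BilinForm.orthogonal_orthogonal hB hs (Submodule.span ℂ s)]
  rw [LinearMap.BilinForm.mem_orthogonal_iff]
  intro v hv
  rw [LinearMap.BilinForm.mem_orthogonal_iff] at hv
  exact h v fun b hb => hs _ _ (hv b (Submodule.subset_span hb))

/-- Induction on the number of factors: if `e₀ P = 0` for the product `P` of the others, choose `v`
orthogonal to these with `B v e₀ ≠ 0`. Applying `v e₀ + e₀ v = 2 B(v, e₀)` to `P` and moving `v`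
through `P` gives `P = 0`. Isotropy plays no role here. -/
lemma cliffProd_ne_zero [Nontrivial W] (hB : B.Nondegenerate) (hs : B.IsRefl)
    (hc : ∀ a b, c a * c b + c b * c a = (2 * B a b) • 1) :
    ∀ {k : ℕ} {e : Fin k → V}, LinearIndependent ℂ e → cliffProd c (List.ofFn e) ≠ 0
  | 0, e, _ => by simp
  | k + 1, e, he => by
    obtain ⟨ht, h0⟩ := linearIndependent_finSucc.1 he
    obtain ⟨v, hv, hv0⟩ := exists_orthogonal_ne_zero hB hs h0
    have ih := cliffProd_ne_zero hB hs hc ht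
    intro h
    rw [List.ofFn_succ, cliffProd_cons] at h
    change c (e 0) * cliffProd c (List.ofFn (Fin.tail e)) = 0 at h
    have hcomm := cliff_mul_cliffProd_comm hc v (List.ofFn (Fin.tail e)) (fun b hb => by
      obtain ⟨j, rfl⟩ := List.mem_ofFn.1 hb
      exact hv _ ⟨j, rfl⟩)
    have h2 := congrArg (· * cliffProd c (List.ofFn (Fin.tail e))) (hc v (e 0))
    simp only [add_mul, mul_assoc, h, mul_zero, zero_add, hcomm, mul_smul_comm,
      smul_mul_assoc, one_mul] at h2
    rw [← mul_assoc, h, zero_mul, smul_zero] at h2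
    exact ih ((smul_eq_zero.1 h2.symm).resolve_left (mul_ne_zero two_ne_zero hv0))

/-- A vector annihilating all the spinors in the image of the product of a basis of an isotropic
subspace belongs to this subspace. -/
lemma mem_span_of_cliff_mul_cliffProd_eq_zero [Nontrivial W] (hB : B.Nondegenerate)
    (hs : B.IsRefl) (hc : ∀ a b, c a * c b + c b * c a = (2 * B a b) • 1) {k : ℕ} {e : Fin k → V}
    (he : LinearIndependent ℂ e) {z : V} (hz : c z * cliffProd c (List.ofFn e) = 0) :
    z ∈ Submodule.span ℂ (range e) := by
  by_contra hze
  obtain ⟨v, hv, hv0⟩ := exists_orthogonal_ne_zero hB hs hze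
  have hcomm := cliff_mul_cliffProd_comm hc v (List.ofFn e) (fun b hb => by
    obtain ⟨j, rfl⟩ := List.mem_ofFn.1 hb
    exact hv _ ⟨j, rfl⟩)
  -- The Clifford relation for `v`, `z` applied to the product: both terms on the left vanish, the
  -- second after `v` is moved through the product.
  have h2 := congrArg (· * cliffProd c (List.ofFn e)) (hc v z)
  simp only [add_mul, mul_assoc, hz, mul_zero, zero_add, hcomm, mul_smul_comm,
    smul_mul_assoc, one_mul] at h2
  rw [← mul_assoc, hz, zero_mul, smul_zero] at h2
  exact cliffProd_ne_zero hB hs hc he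
    ((smul_eq_zero.1 h2.symm).resolve_left (mul_ne_zero two_ne_zero hv0))

end CliffordAlgebraic

/-! ### Complexification -/

section Complexification

variable {E : Type*} [AddCommGroup E] [Module ℝ E]

@[simp] lemma reC_tmul (a : ℂ) (e : E) : reC (a ⊗ₜ[ℝ] e) = a.re • e := by simp [reC]

@[simp] lemma imC_tmul (a : ℂ) (e : E) : imC (a ⊗ₜ[ℝ] e) = a.im • e := by simp [imC]

@[simp] lemma reC_mkC (a b : E) : reC (mkC a b) = a := by simp [mkC]

@[simp] lemma imC_mkC (a b : E) : imC (mkC a b) = b := by simp [mkC]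

@[simp] lemma mkC_reC_imC (z : ℂ ⊗[ℝ] E) : mkC (reC z) (imC z) = z := by
  induction z using TensorProduct.induction_on with
  | zero => simp [mkC]
  | tmul a e =>
    simp only [mkC, reC_tmul, imC_tmul, TensorProduct.tmul_smul, TensorProduct.smul_tmul',
      ← TensorProduct.add_tmul]
    congr 1
    simp
  | add x y hx hy =>
    conv_rhs => rw [← hx, ← hy]
    simp only [mkC, map_add, TensorProduct.tmul_add]
    abel

lemma ext_reC_imC {z w : ℂ ⊗[ℝ] E} (h₁ : reC z = reC w) (h₂ : imC z = imC w) : z = w := by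
  rw [← mkC_reC_imC z, ← mkC_reC_imC w, h₁, h₂]

lemma reC_smul (c : ℂ) (z : ℂ ⊗[ℝ] E) : reC (c • z) = c.re • reC z - c.im • imC z := by
  induction z using TensorProduct.induction_on with
  | zero => simp
  | tmul a e => simp [TensorProduct.smul_tmul', sub_smul, mul_smul]
  | add x y hx hy => rw [smul_add, map_add, hx, hy]; simp only [map_add, smul_add]; abel

lemma imC_smul (c : ℂ) (z : ℂ ⊗[ℝ] E) : imC (c • z) = c.re • imC z + c.im • reC z := by
  induction z using TensorProduct.induction_on with
  | zero => simp
  | tmul a e => simp [TensorProduct.smul_tmul', add_smul, mul_smul]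
  | add x y hx hy => rw [smul_add, map_add, hx, hy]; simp only [map_add, smul_add]; abel

lemma mem_baseChange_iff (W : Submodule ℝ E) (z : ℂ ⊗[ℝ] E) :
    z ∈ W.baseChange ℂ ↔ reC z ∈ W ∧ imC z ∈ W := by
  constructor
  · intro h
    rw [Submodule.baseChange_eq_span] at h
    induction h using Submodule.span_induction with
    | mem x hx =>
      obtain ⟨w, hw, rfl⟩ := hx
      simp only [TensorProduct.mk_apply, reC_tmul, imC_tmul, Complex.one_re, Complex.one_im]
      exact ⟨W.smul_mem _ hw, W.smul_mem _ hw⟩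
    | zero => simp
    | add x y _ _ hx hy => simp only [map_add]; exact ⟨W.add_mem hx.1 hy.1, W.add_mem hx.2 hy.2⟩
    | smul t x _ hx =>
      rw [reC_smul, imC_smul]
      exact ⟨W.sub_mem (W.smul_mem _ hx.1) (W.smul_mem _ hx.2),
        W.add_mem (W.smul_mem _ hx.2) (W.smul_mem _ hx.1)⟩
  · rintro ⟨h₁, h₂⟩
    rw [← mkC_reC_imC z, mkC]
    exact add_mem (Submodule.tmul_mem_baseChange_of_mem _ h₁)
      (Submodule.tmul_mem_baseChange_of_mem _ h₂)

end Complexification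

/-! ### Smooth sections -/

section Sections

variable {n : ℕ} {M : Type*} [TopologicalSpace M]
  [ChartedSpace (EuclideanSpace ℝ (Fin (2 * n))) M]

lemma exists_smooth_bump [IsManifold (𝓡 (2 * n)) ∞ M] [T2Space M] {x : M} {s : Set M}
    (hs : s ∈ 𝓝 x) :
    ∃ χ : M → ℝ, ContMDiff (𝓡 (2 * n)) 𝓘(ℝ, ℝ) ∞ χ ∧ χ =ᶠ[𝓝 x] 1 ∧ tsupport χ ⊆ s := by
  obtain ⟨f, -, hf⟩ :=
    (SmoothBumpFunction.nhds_basis_tsupport (I := 𝓡 (2 * n)) x).mem_iff.1 hs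
  exact ⟨f, f.contMDiff, f.eventuallyEq_one, hf⟩

variable {F : Type*} [NormedAddCommGroup F] [NormedSpace ℝ F]
  {V : M → Type*} [TopologicalSpace (TotalSpace F V)]
  [∀ x, AddCommGroup (V x)] [∀ x, Module ℝ (V x)] [∀ x, TopologicalSpace (V x)]
  [FiberBundle F V] [VectorBundle ℝ F V]

lemma SmoothSpinorAt.smul_of_tsupport {χ : M → ℝ} (hχ : ContMDiff (𝓡 (2 * n)) 𝓘(ℝ, ℝ) ∞ χ)
    {φ : (x : M) → V x} (h : ∀ x ∈ tsupport χ, SmoothSpinorAt n F φ x) (x : M) :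
    SmoothSpinorAt n F (fun y => χ y • φ y) x := by
  by_cases hx : x ∈ tsupport χ
  · exact (hχ x).smul_section (h x hx)
  · have h0 : ContMDiffAt (𝓡 (2 * n)) ((𝓡 (2 * n)).prod 𝓘(ℝ, F)) ∞
        (fun y => TotalSpace.mk' F (E := V) y 0) x := (contMDiff_zeroSection ℝ V) x
    refine h0.congr_of_eventuallyEq ?_
    filter_upwards [notMem_tsupport_iff_eventuallyEq.1 hx] with y hy
    simp [hy]

/-- Every vector of a smooth bundle is the value of a global smooth section. -/
lemma exists_smooth_section [IsManifold (𝓡 (2 * n)) ∞ M] [T2Space M]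
    [ContMDiffVectorBundle ∞ F V (𝓡 (2 * n))] {x : M} (v : V x) :
    ∃ φ : (x : M) → V x, (∀ y, SmoothSpinorAt n F φ y) ∧ φ x = v := by
  obtain ⟨s, hs, h⟩ := FiberBundle.exists_contMDiffOn_extend (k := ∞) (I := 𝓡 (2 * n)) F v
  obtain ⟨χ, hχ, hχ1, hχs⟩ := exists_smooth_bump (n := n) (interior_mem_nhds.2 hs)
  refine ⟨fun y => χ y • FiberBundle.extend F v y, SmoothSpinorAt.smul_of_tsupport hχ fun y hy =>
    (h y (interior_subset (hχs hy))).contMDiffAt (mem_interior_iff_mem_nhds.1 (hχs hy)), ?_⟩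
  simp [hχ1.eq_of_nhds]

end Sections

section TangentSections

variable {n : ℕ} {M : Type*} [TopologicalSpace M]
  [ChartedSpace (EuclideanSpace ℝ (Fin (2 * n))) M]

@[simp] lemma reField_mkC (X Y : RealField n M) :
    reField (fun x => mkC (X x) (Y x) : ComplexField n M) = X := by
  ext1 x; simp [reField]

@[simp] lemma imField_mkC (X Y : RealField n M) :
    imField (fun x => mkC (X x) (Y x) : ComplexField n M) = Y := by
  ext1 x; simp [imField]

variable [IsManifold (𝓡 (2 * n)) ∞ M]

lemma SmoothFieldAt.smul_of_tsupport {χ : M → ℝ} (hχ : ContMDiff (𝓡 (2 * n)) 𝓘(ℝ, ℝ) ∞ χ)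
    {X : RealField n M} (h : ∀ x ∈ tsupport χ, SmoothFieldAt X x) (x : M) :
    SmoothFieldAt (fun y => χ y • X y : RealField n M) x :=
  SmoothSpinorAt.smul_of_tsupport (V := (TangentSpace (𝓡 (2 * n)) : M → Type)) hχ h x

lemma SmoothFieldAt.mdifferentiableAt {X : RealField n M} {x : M} (h : SmoothFieldAt X x) :
    MDifferentiableAt (𝓡 (2 * n)) ((𝓡 (2 * n)).prod 𝓘(ℝ, EuclideanSpace ℝ (Fin (2 * n))))
      (fun y => TotalSpace.mk' (EuclideanSpace ℝ (Fin (2 * n)))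
      (E := (TangentSpace (𝓡 (2 * n)) : M → Type)) y (X y)) x :=
  ContMDiffAt.mdifferentiableAt h (by simp)

lemma smoothFieldAt_zero (x : M) : SmoothFieldAt (0 : RealField n M) x :=
  contMDiff_zeroSection ℝ (TangentSpace (𝓡 (2 * n)) : M → Type) x

lemma SmoothFieldAt.add {X Y : RealField n M} {x : M} (hX : SmoothFieldAt X x)
    (hY : SmoothFieldAt Y x) : SmoothFieldAt (X + Y) x :=
  ContMDiffAt.add_section hX hY

lemma SmoothFieldAt.const_smul {X : RealField n M} {x : M} (hX : SmoothFieldAt X x) (c : ℝ) :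
    SmoothFieldAt (c • X) x :=
  ContMDiffAt.const_smul_section hX

lemma SmoothFieldAt.sum {ι : Type*} {s : Finset ι} {X : ι → RealField n M} {x : M}
    (hX : ∀ i ∈ s, SmoothFieldAt (X i) x) :
    SmoothFieldAt (fun y => ∑ i ∈ s, X i y : RealField n M) x :=
  ContMDiffAt.sum_section hX

lemma SmoothCFieldAt.smul_of_tsupport {χ : M → ℝ} (hχ : ContMDiff (𝓡 (2 * n)) 𝓘(ℝ, ℝ) ∞ χ)
    {X : ComplexField n M} (h : ∀ x ∈ tsupport χ, SmoothCFieldAt X x) (x : M) :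
    SmoothCFieldAt (fun y => (χ y : ℂ) • X y : ComplexField n M) x := by
  have h₁ : reField (fun y => (χ y : ℂ) • X y : ComplexField n M) =
      fun y => χ y • reField X y := by
    ext1 y
    change reC ((χ y : ℂ) • X y) = _
    rw [reC_smul]
    simp [reField]
  have h₂ : imField (fun y => (χ y : ℂ) • X y : ComplexField n M) =
      fun y => χ y • imField X y := by
    ext1 y
    change imC ((χ y : ℂ) • X y) = _
    rw [imC_smul]
    simp [imField]
  rw [SmoothCFieldAt, h₁, h₂]
  exact ⟨SmoothFieldAt.smul_of_tsupport hχ (fun x hx => (h x hx).1) x,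
    SmoothFieldAt.smul_of_tsupport hχ (fun x hx => (h x hx).2) x⟩

lemma SmoothCFieldAt.const_smul {X : ComplexField n M} {x : M} (hX : SmoothCFieldAt X x) (c : ℂ) :
    SmoothCFieldAt (c • X) x := by
  have h₁ : reField (c • X) = c.re • reField X + (-c.im) • imField X := by
    ext1 y; simp [reField, imField, reC_smul, sub_eq_add_neg]
  have h₂ : imField (c • X) = c.re • imField X + c.im • reField X := by
    ext1 y; simp [reField, imField, imC_smul]
  rw [SmoothCFieldAt, h₁, h₂]
  exact ⟨(hX.1.const_smul _).add (hX.2.const_smul _), (hX.2.const_smul _).add (hX.1.const_smul _)⟩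

lemma SmoothCFieldAt.sum {ι : Type*} {s : Finset ι} {X : ι → ComplexField n M} {x : M}
    (hX : ∀ i ∈ s, SmoothCFieldAt (X i) x) :
    SmoothCFieldAt (fun y => ∑ i ∈ s, X i y : ComplexField n M) x := by
  have h₁ : reField (fun y => ∑ i ∈ s, X i y : ComplexField n M) =
      fun y => ∑ i ∈ s, reField (X i) y := by ext1 y; simp [reField]
  have h₂ : imField (fun y => ∑ i ∈ s, X i y : ComplexField n M) =
      fun y => ∑ i ∈ s, imField (X i) y := by ext1 y; simp [imField]
  rw [SmoothCFieldAt, h₁, h₂]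
  exact ⟨SmoothFieldAt.sum fun i hi => (hX i hi).1, SmoothFieldAt.sum fun i hi => (hX i hi).2⟩

variable {k : ℕ}

/-- Every vector of a complex distribution is the value of a global section. -/
lemma ComplexDistribution.exists_isSection [T2Space M] (I : ComplexDistribution n M k) {x : M}
    {a : CTangent n x} (ha : a ∈ I.space x) : ∃ X, I.IsSection X ∧ X x = a := by
  obtain ⟨U, hU, e, he⟩ := I.exists_frame x
  obtain ⟨χ, hχ, hχ1, hχs⟩ := exists_smooth_bump (n := n) hU
  rw [← (he x (mem_of_mem_nhds hU)).2.2] at ha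
  obtain ⟨c, rfl⟩ := (Submodule.mem_span_range_iff_exists_fun ℂ).1 ha
  refine ⟨fun y => (χ y : ℂ) • ∑ i, (c i • e i) y, ⟨?_, fun y => ?_⟩, ?_⟩
  · exact SmoothCFieldAt.smul_of_tsupport hχ fun y hy =>
      SmoothCFieldAt.sum fun i _ => ((he y (hχs hy)).1 i).const_smul _
  · by_cases hy : y ∈ U
    · rw [← (he y hy).2.2]
      exact Submodule.smul_mem _ _ (Submodule.sum_mem _ fun i _ =>
        Submodule.smul_mem _ _ (Submodule.subset_span ⟨i, rfl⟩))
    · have : χ y = 0 := image_eq_zero_of_notMem_tsupport fun h => hy (hχs h)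
      simp [this]
  · simp [hχ1.eq_of_nhds]

end TangentSections

/-! ### The complexified metric as a nondegenerate bilinear form -/

section ComplexMetric

variable {n : ℕ} {M : Type*} [TopologicalSpace M]
  [ChartedSpace (EuclideanSpace ℝ (Fin (2 * n))) M] [IsManifold (𝓡 (2 * n)) ∞ M]

/-- The complexified metric as a bilinear form. -/
noncomputable def SemiRiemannianMetric.innerForm (g : SemiRiemannianMetric n M) (x : M) :
    LinearMap.BilinForm ℂ (CTangent n x) :=
  LinearMap.mk₂ ℂ (g.innerC x)
    (fun a b c => by
      apply Complex.ext <;> simp [SemiRiemannianMetric.innerC] <;> ring)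
    (fun t a c => by
      apply Complex.ext <;> simp [SemiRiemannianMetric.innerC, reC_smul, imC_smul] <;> ring)
    (fun a b c => by
      apply Complex.ext <;> simp [SemiRiemannianMetric.innerC] <;> ring)
    (fun t a c => by
      apply Complex.ext <;> simp [SemiRiemannianMetric.innerC, reC_smul, imC_smul] <;> ring)

lemma SemiRiemannianMetric.innerForm_apply (g : SemiRiemannianMetric n M) (x : M)
    (a b : CTangent n x) : g.innerForm x a b = g.innerC x a b := rfl

lemma SemiRiemannianMetric.innerForm_isRefl (g : SemiRiemannianMetric n M) (x : M) :
    (g.innerForm x).IsRefl := by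
  intro a b h
  rw [innerForm_apply] at h ⊢
  rw [← h, innerC, innerC, g.symm x (reC b), g.symm x (imC b), g.symm x (reC b),
    g.symm x (imC b) (reC a)]
  congr 2
  norm_cast
  exact add_comm _ _

lemma SemiRiemannianMetric.innerForm_nondegenerate (g : SemiRiemannianMetric n M) (x : M) :
    (g.innerForm x).Nondegenerate := by
  have key : ∀ a, (∀ b, g.innerForm x a b = 0) → a = 0 := by
    intro a h
    have h' : ∀ b : TangentSpace (𝓡 (2 * n)) x,
        g.inner x (reC a) b = 0 ∧ g.inner x (imC a) b = 0 := by
      intro b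
      have hb := h (mkC b 0)
      rw [innerForm_apply, innerC, Complex.ext_iff] at hb
      simpa using hb
    apply ext_reC_imC
    · rw [map_zero]; exact g.nondegenerate x _ fun b => (h' b).1
    · rw [map_zero]; exact g.nondegenerate x _ fun b => (h' b).2
  exact ⟨key, fun b h => key b fun a => g.innerForm_isRefl x _ _ (h a)⟩

instance (x : M) : FiniteDimensional ℂ (CTangent n x) :=
  inferInstanceAs (FiniteDimensional ℂ (ℂ ⊗[ℝ] EuclideanSpace ℝ (Fin (2 * n))))

end ComplexMetric

section

variable {n : ℕ} {M : Type*} [TopologicalSpace M]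
  [ChartedSpace (EuclideanSpace ℝ (Fin (2 * n))) M]
  {F : Type*} [NormedAddCommGroup F] [NormedSpace ℝ F]
  {S : M → Type*} [TopologicalSpace (TotalSpace F S)] [∀ x, TopologicalSpace (S x)]
  [FiberBundle F S]

lemma SmoothSpinorAt.mdifferentiableAt {φ : (x : M) → S x} {x : M} (h : SmoothSpinorAt n F φ x) :
    MDifferentiableAt (𝓡 (2 * n)) ((𝓡 (2 * n)).prod 𝓘(ℝ, F))
      (fun y => TotalSpace.mk' F (E := S) y (φ y)) x :=
  ContMDiffAt.mdifferentiableAt h (by simp)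

end

/-! ### Annihilated spinor fields and the spinorial connection -/

section SpinorBundle

variable {n k : ℕ} {M : Type*} [TopologicalSpace M]
  [ChartedSpace (EuclideanSpace ℝ (Fin (2 * n))) M] [IsManifold (𝓡 (2 * n)) ∞ M]
  {g : SemiRiemannianMetric n M}
  {F : Type*} [NormedAddCommGroup F] [NormedSpace ℝ F]
  {S : M → Type*} [TopologicalSpace (TotalSpace F S)]
  [∀ x, AddCommGroup (S x)] [∀ x, Module ℂ (S x)] [∀ x, TopologicalSpace (S x)]
  [FiberBundle F S]

/-- The complexified Clifford action as a linear map. -/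
noncomputable def SpinorBundle.cliffHom (σ : SpinorBundle g F S) (x : M) :
    CTangent n x →ₗ[ℂ] Module.End ℂ (S x) where
  toFun a := σ.cliff x (reC a) + Complex.I • σ.cliff x (imC a)
  map_add' a b := by simp only [map_add, smul_add]; abel
  map_smul' c a := by
    ext φ
    simp only [reC_smul, imC_smul, map_add, map_sub, map_smul, LinearMap.add_apply,
      LinearMap.sub_apply, LinearMap.smul_apply, RingHom.id_apply, ← Complex.coe_smul,
      smul_add, smul_smul]
    -- The relation `I² = -1` enters through `hI`; once `c` is replaced by its real and imaginary
    -- parts, the identity is formal.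
    have hI : c * Complex.I = c.re * Complex.I - c.im := by
      apply Complex.ext <;> simp
    have hc : c = c.re + c.im * Complex.I := (Complex.re_add_im c).symm
    rw [hI]
    generalize c.re = r at *
    generalize c.im = s at *
    rw [hc]
    module

lemma SpinorBundle.cliffHom_apply (σ : SpinorBundle g F S) (x : M) (a : CTangent n x) (φ : S x) :
    σ.cliffHom x a φ = σ.cliffC a φ := rfl

lemma SpinorBundle.cliffHom_anticomm (σ : SpinorBundle g F S) (x : M) (a b : CTangent n x) :
    σ.cliffHom x a * σ.cliffHom x b + σ.cliffHom x b * σ.cliffHom x a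
      = (2 * g.innerForm x a b) • 1 := by
  ext φ
  have h₁ := σ.clifford x (reC a) (reC b) φ
  have h₂ := σ.clifford x (reC a) (imC b) φ
  have h₃ := σ.clifford x (imC a) (reC b) φ
  have h₄ := σ.clifford x (imC a) (imC b) φ
  simp only [LinearMap.add_apply, Module.End.mul_apply, LinearMap.smul_apply, Module.End.one_apply,
    cliffHom_apply, SpinorBundle.cliffC, map_add, map_smul, smul_add, smul_smul, Complex.I_mul_I,
    g.innerForm_apply, SemiRiemannianMetric.innerC]
  have h : (2 * (((g.inner x (reC a) (reC b) - g.inner x (imC a) (imC b) : ℝ) : ℂ)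
    + ((g.inner x (reC a) (imC b) + g.inner x (imC a) (reC b) : ℝ) : ℂ) * Complex.I)) • φ =
    ((2 * g.inner x (reC a) (reC b) : ℝ) : ℂ) • φ
      + Complex.I • (((2 * g.inner x (reC a) (imC b) : ℝ) : ℂ) • φ)
      + Complex.I • (((2 * g.inner x (imC a) (reC b) : ℝ) : ℂ) • φ)
      - ((2 * g.inner x (imC a) (imC b) : ℝ) : ℂ) • φ := by
    push_cast
    module
  rw [h, ← h₁, ← h₂, ← h₃, ← h₄]
  module

lemma SpinorBundle.nontrivial (σ : SpinorBundle g F S) (x : M) : Nontrivial (S x) := by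
  apply Module.nontrivial_of_finrank_pos (R := ℂ)
  rw [σ.finrank_eq]
  positivity

section Smooth

variable [VectorBundle ℝ F S]

lemma SmoothSpinorAt.cliffC (σ : SpinorBundle g F S) {X : ComplexField n M} {φ : (x : M) → S x}
    {x : M} (hX : SmoothCFieldAt X x) (hφ : SmoothSpinorAt n F φ x) :
    SmoothSpinorAt n F (fun y => σ.cliffC (X y) (φ y)) x :=
  ContMDiffAt.add_section (σ.smooth_cliff _ _ x hX.1 hφ)
    (σ.smooth_I _ x (σ.smooth_cliff _ _ x hX.2 hφ))

/-- The image of a spinor field by the product of the Clifford actions of a list of complex vector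
fields. -/
lemma smoothSpinorAt_cliffProd (σ : SpinorBundle g F S) {φ : (x : M) → S x} {x : M}
    (hφ : SmoothSpinorAt n F φ x) : ∀ {k : ℕ} {e : Fin k → ComplexField n M},
    (∀ i, SmoothCFieldAt (e i) x) →
      SmoothSpinorAt n F (fun y => cliffProd (σ.cliffHom y) (List.ofFn fun i => e i y) (φ y)) x
  | 0, e, _ => by simpa using! hφ
  | k + 1, e, he => by
    have ih := smoothSpinorAt_cliffProd σ hφ (e := fun i => e i.succ) fun i => he _
    simpa [List.ofFn_succ] using! SmoothSpinorAt.cliffC σ (he 0) ih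

variable {I : ComplexDistribution n M k} {σ : SpinorBundle g F S}

/-- Spinor fields annihilated by an isotropic distribution, produced by the product of the elements
of a frame. -/
lemma ComplexDistribution.IsIsotropic.exists_annihilatedSection [T2Space M]
    [ContMDiffVectorBundle ∞ F S (𝓡 (2 * n))] (hI : I.IsIsotropic g) (x : M) :
    ∃ e : Fin k → CTangent n x, LinearIndependent ℂ e ∧ Submodule.span ℂ (range e) = I.space x ∧
      ∀ ψ : S x, ∃ φ, σ.IsAnnihilatedSection I φ ∧
        φ x = cliffProd (σ.cliffHom x) (List.ofFn e) ψ := by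
  obtain ⟨U, hU, e, he⟩ := I.exists_frame x
  obtain ⟨χ, hχ, hχ1, hχs⟩ := exists_smooth_bump (n := n) hU
  refine ⟨fun i => e i x, (he x (mem_of_mem_nhds hU)).2.1, (he x (mem_of_mem_nhds hU)).2.2,
    fun ψ => ?_⟩
  obtain ⟨φ, hφ, rfl⟩ := exists_smooth_section (n := n) (F := F) ψ
  -- The frame spans `I` only over `U`, so the product is cut off; the cutoff equals one at `x` and
  -- vanishes outside `U`.
  refine ⟨fun y => χ y • cliffProd (σ.cliffHom y) (List.ofFn fun i => e i y) (φ y),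
    ⟨SmoothSpinorAt.smul_of_tsupport hχ fun y hy =>
      smoothSpinorAt_cliffProd σ (hφ y) (he y (hχs hy)).1, fun y => ?_⟩, ?_⟩
  · intro a ha
    rw [← SpinorBundle.cliffHom_apply]
    beta_reduce
    by_cases hy : y ∈ U
    · have hspan := (he y hy).2.2
      have hmem : ∀ i, e i y ∈ I.space y := fun i => hspan ▸ Submodule.subset_span ⟨i, rfl⟩
      have h0 := cliff_mul_cliffProd_of_mem_span (σ.cliffHom_anticomm y)
        (e := fun i => e i y) (fun i j => hI y _ (hmem i) _ (hmem j)) (hspan ▸ ha)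
      have h1 := congrArg (fun f => f (φ y)) h0
      rw [← Complex.coe_smul, map_smul]
      rw [show (σ.cliffHom y a) (cliffProd (σ.cliffHom y) (List.ofFn fun i => e i y) (φ y)) = 0
        from h1, smul_zero]
    · have : χ y = 0 := image_eq_zero_of_notMem_tsupport fun h => hy (hχs h)
      rw [this, zero_smul, map_zero]
  · simp [hχ1.eq_of_nhds]

variable [∀ x, IsTopologicalAddGroup (S x)] [∀ x, ContinuousSMul ℝ (S x)]
  {D : AffineConnection n M} {N : CovariantDerivative (𝓡 (2 * n)) F S}

/-- The Leibniz rule for the complexified Clifford action. -/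
lemma IsSpinorialConnection.leibnizC (hN : IsSpinorialConnection σ D N) {X Y : ComplexField n M}
    {φ : (x : M) → S x} {x : M} (hY : SmoothCFieldAt Y x) (hφ : SmoothSpinorAt n F φ x) :
    spinCovC N (fun y => σ.cliffC (Y y) (φ y)) (X x) =
      σ.cliffC (covC D X Y x) (φ x) + σ.cliffC (Y x) (spinCovC N φ (X x)) := by
  have h₁ := σ.smooth_cliff _ _ x hY.1 hφ
  have h₂ := σ.smooth_cliff _ _ x hY.2 hφ
  have key : ∀ a, N (fun y => σ.cliffC (Y y) (φ y)) x a =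
      (σ.cliff x (D (reField Y) x a) (φ x) + σ.cliff x (reC (Y x)) (N φ x a)) +
      Complex.I • (σ.cliff x (D (imField Y) x a) (φ x) + σ.cliff x (imC (Y x)) (N φ x a)) := by
    intro a
    have := congrArg (fun f => f a) (N.isCovariantDerivativeOnUniv.add h₁.mdifferentiableAt
      (σ.smooth_I _ x h₂).mdifferentiableAt)
    refine this.trans ?_
    rw [add_apply, hN.complex_linear _ x h₂, hN.leibniz _ _ x hY.1 hφ,
      hN.leibniz _ _ x hY.2 hφ]
    rfl
  rw [spinCovC, key, key]
  simp only [spinCovC, SpinorBundle.cliffC, covC, reC_mkC, imC_mkC, map_add, map_sub,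
    LinearMap.add_apply, LinearMap.sub_apply, smul_add, map_smul, smul_smul,
    Complex.I_mul_I]
  module

/-- If `∇` preserves an isotropic distribution then the spinorial connection preserves the spinor
fields which it annihilates. -/
lemma ComplexDistribution.IsTotallyGeodesic.spinCovC_mem [T2Space M]
    (hN : IsSpinorialConnection σ D N) (h : I.IsTotallyGeodesic D) {X : ComplexField n M}
    (hX : I.IsSection X) {φ : (x : M) → S x} (hφ : σ.IsAnnihilatedSection I φ) (x : M) :
    spinCovC N φ (X x) ∈ σ.annihilated I x := by
  intro a ha
  obtain ⟨Y, hY, rfl⟩ := I.exists_isSection ha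
  have h₁ := hN.leibnizC (X := X) (hY.1 x) (hφ.1 x)
  -- The spinor field `Y · φ` vanishes identically, so the Leibniz rule leaves `0 = (∇_X Y) · φ + Y
  -- · ∇̂_X φ`, whose first term is zero by hypothesis.
  have h₀ : (fun y => σ.cliffC (Y y) (φ y)) = 0 := funext fun y => hφ.2 y _ (hY.2 y)
  rw [h₀, spinCovC, N.zero, hφ.2 x _ (h X Y hX hY x)] at h₁
  simpa using h₁.symm

/-- If the spinorial connection preserves the spinor fields annihilated by an isotropic
distribution then `∇` preserves this distribution. -/
lemma ComplexDistribution.IsIsotropic.isTotallyGeodesic [T2Space M]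
    [ContMDiffVectorBundle ∞ F S (𝓡 (2 * n))] (hI : I.IsIsotropic g)
    (hN : IsSpinorialConnection σ D N)
    (h : ∀ X : ComplexField n M, I.IsSection X → ∀ φ : (x : M) → S x,
      σ.IsAnnihilatedSection I φ → ∀ x, spinCovC N φ (X x) ∈ σ.annihilated I x) :
    I.IsTotallyGeodesic D := by
  intro X Y hX hY x
  obtain ⟨e, he, hspan, hφ⟩ := hI.exists_annihilatedSection (σ := σ) x
  have := σ.nontrivial x
  rw [← hspan]
  refine mem_span_of_cliff_mul_cliffProd_eq_zero (g.innerForm_nondegenerate x)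
    (g.innerForm_isRefl x) (σ.cliffHom_anticomm x) he ?_
  -- Every value of the frame product extends to an annihilated section `φ`. In the Leibniz rule for
  -- `Y · φ = 0` the term `Y · ∇̂_X φ` is now the one that vanishes.
  ext ψ
  obtain ⟨φ, hφ, hφx⟩ := hφ ψ
  have h₁ := hN.leibnizC (X := X) (hY.1 x) (hφ.1 x)
  have h₀ : (fun y => σ.cliffC (Y y) (φ y)) = 0 := funext fun y => hφ.2 y _ (hY.2 y)
  rw [h₀, spinCovC, N.zero, h X hX φ hφ x _ (hY.2 x)] at h₁
  rw [Module.End.mul_apply, ← hφx, SpinorBundle.cliffHom_apply]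
  simpa using h₁.symm

end Smooth

end SpinorBundle

/-! ### Torsion-freeness, and reduction to real distributions -/

section Torsion

variable {n k : ℕ} {M : Type*} [TopologicalSpace M]
  [ChartedSpace (EuclideanSpace ℝ (Fin (2 * n))) M] [IsManifold (𝓡 (2 * n)) ∞ M]
  {g : SemiRiemannianMetric n M} {D : AffineConnection n M}

lemma IsLeviCivita.mlieBracket_eq (hD : IsLeviCivita g D) {X Y : RealField n M} {x : M}
    (hX : SmoothFieldAt X x) (hY : SmoothFieldAt Y x) :
    VectorField.mlieBracket (𝓡 (2 * n)) X Y x = D Y x (X x) - D X x (Y x) := by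
  have h := D.torsion_apply hX.mdifferentiableAt hY.mdifferentiableAt
  rw [hD.torsion_free] at h
  exact (sub_eq_zero.1 h.symm).symm

lemma IsLeviCivita.bracketC_eq (hD : IsLeviCivita g D) {X Y : ComplexField n M} {x : M}
    (hX : SmoothCFieldAt X x) (hY : SmoothCFieldAt Y x) :
    bracketC X Y x = covC D X Y x - covC D Y X x := by
  apply ext_reC_imC
  · rw [map_sub, bracketC, covC, covC, reC_mkC, reC_mkC, reC_mkC, hD.mlieBracket_eq hX.1 hY.1,
      hD.mlieBracket_eq hX.2 hY.2]
    simp only [reField, imField]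
    abel
  · rw [map_sub, bracketC, covC, covC, imC_mkC, imC_mkC, imC_mkC, hD.mlieBracket_eq hX.1 hY.2,
      hD.mlieBracket_eq hX.2 hY.1]
    simp only [reField, imField]
    abel

/-- For a torsion-free connection the bracket is `∇_X Y - ∇_Y X`. -/
lemma ComplexDistribution.IsTotallyGeodesic.isInvolutive (hD : IsLeviCivita g D)
    {I : ComplexDistribution n M k} (h : I.IsTotallyGeodesic D) : I.IsInvolutive := by
  intro X Y hX hY x
  rw [hD.bracketC_eq (hX.1 x) (hY.1 x)]
  exact sub_mem (h X Y hX hY x) (h Y X hY hX x)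

/-- The total geodesy condition for a real distribution, without reference to leaves. -/
def RealDistribution.IsParallelAlong (I : RealDistribution n M k) (D : AffineConnection n M) :
    Prop :=
  ∀ X Y : RealField n M, (∀ x, SmoothFieldAt X x) → (∀ x, X x ∈ I.space x) →
    (∀ x, SmoothFieldAt Y x) → (∀ x, Y x ∈ I.space x) → ∀ x, D Y x (X x) ∈ I.space x

/-- Real and imaginary parts of sections of the complexification are sections of the real
distribution, and `covC` is built bilinearly from these parts. -/
lemma ComplexDistribution.IsComplexificationOf.isTotallyGeodesic_iff
    {I : ComplexDistribution n M k} {I' : RealDistribution n M k} (h : I.IsComplexificationOf I') :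
    I.IsTotallyGeodesic D ↔ I'.IsParallelAlong D := by
  constructor
  · intro hI X Y hX hX' hY hY' x
    have key : ∀ Z : RealField n M, (∀ x, SmoothFieldAt Z x) → (∀ x, Z x ∈ I'.space x) →
        I.IsSection fun x => mkC (Z x) ((0 : RealField n M) x) := fun Z hZ hZ' =>
      ⟨fun x => ⟨by rw [reField_mkC]; exact hZ x, by rw [imField_mkC]; exact smoothFieldAt_zero x⟩,
        fun x => by rw [h x, mem_baseChange_iff]; simpa using hZ' x⟩
    have := hI _ _ (key X hX hX') (key Y hY hY') x
    rw [h x, mem_baseChange_iff, covC, reC_mkC, imField_mkC, reField_mkC] at this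
    simpa using this.1
  · intro hI X Y hX hY x
    have hX' := fun x => (mem_baseChange_iff _ _).1 (h x ▸ hX.2 x)
    have hY' := fun x => (mem_baseChange_iff _ _).1 (h x ▸ hY.2 x)
    have hr := fun x => (hX.1 x).1
    have hi := fun x => (hX.1 x).2
    have hr' := fun x => (hY.1 x).1
    have hi' := fun x => (hY.1 x).2
    rw [h x, mem_baseChange_iff, covC, reC_mkC, imC_mkC]
    exact ⟨sub_mem (hI _ _ hr (fun x => (hX' x).1) hr' (fun x => (hY' x).1) x)
      (hI _ _ hi (fun x => (hX' x).2) hi' (fun x => (hY' x).2) x),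
      add_mem (hI _ _ hr (fun x => (hX' x).1) hi' (fun x => (hY' x).2) x)
      (hI _ _ hi (fun x => (hX' x).2) hr' (fun x => (hY' x).1) x)⟩

end Torsion

/-! ### Vector fields and connections in a chart -/

/-- The model space of a `2n`-dimensional manifold. -/
abbrev Coord (n : ℕ) : Type := EuclideanSpace ℝ (Fin (2 * n))

section Chart

variable {n : ℕ} {M : Type*} [TopologicalSpace M]
  [ChartedSpace (EuclideanSpace ℝ (Fin (2 * n))) M]

/-- The preferred chart at a point. -/
noncomputable abbrev chart (n : ℕ) {M : Type*} [TopologicalSpace M]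
    [ChartedSpace (EuclideanSpace ℝ (Fin (2 * n))) M] (p : M) : PartialEquiv M (Coord n) :=
  extChartAt (𝓡 (2 * n)) p

variable {p x : M}

lemma source_mem_nhds (hx : x ∈ (chart n p).source) : (chart n p).source ∈ 𝓝 x :=
  (isOpen_extChartAt_source p).mem_nhds hx

lemma target_mem_nhds {y : Coord n} (hy : y ∈ (chart n p).target) : (chart n p).target ∈ 𝓝 y :=
  (isOpen_extChartAt_target p).mem_nhds hy

lemma tendsto_chart (hx : x ∈ (chart n p).source) :
    Filter.Tendsto (chart n p) (𝓝 x) (𝓝 (chart n p x)) :=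
  continuousAt_extChartAt' hx

lemma tendsto_chart_symm {y : Coord n} (hy : y ∈ (chart n p).target) :
    Filter.Tendsto (chart n p).symm (𝓝 y) (𝓝 ((chart n p).symm y)) :=
  continuousAt_extChartAt_symm'' hy

variable [IsManifold (𝓡 (2 * n)) ∞ M]

/-- The components of a tangent vector at `x` in the chart at `p`. -/
noncomputable def toCoord {n : ℕ} {M : Type*} [TopologicalSpace M]
    [ChartedSpace (EuclideanSpace ℝ (Fin (2 * n))) M] [IsManifold (𝓡 (2 * n)) ∞ M]
    (p x : M) : TangentSpace (𝓡 (2 * n)) x →L[ℝ] Coord n :=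
  (trivializationAt (Coord n) (TangentSpace (𝓡 (2 * n)) : M → Type) p).continuousLinearMapAt ℝ x

/-- The tangent vector at `x` with given components in the chart at `p`. -/
noncomputable def fromCoord {n : ℕ} {M : Type*} [TopologicalSpace M]
    [ChartedSpace (EuclideanSpace ℝ (Fin (2 * n))) M] [IsManifold (𝓡 (2 * n)) ∞ M]
    (p x : M) : Coord n →L[ℝ] TangentSpace (𝓡 (2 * n)) x :=
  (trivializationAt (Coord n) (TangentSpace (𝓡 (2 * n)) : M → Type) p).symmL ℝ x

lemma mem_baseSet (hx : x ∈ (chart n p).source) :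
    x ∈ (trivializationAt (Coord n) (TangentSpace (𝓡 (2 * n)) : M → Type) p).baseSet := by
  rwa [extChartAt_source] at hx

@[simp] lemma fromCoord_toCoord (hx : x ∈ (chart n p).source) (v : TangentSpace (𝓡 (2 * n)) x) :
    fromCoord p x (toCoord p x v) = v :=
  Trivialization.symmL_continuousLinearMapAt _ (mem_baseSet hx) v

@[simp] lemma toCoord_fromCoord (hx : x ∈ (chart n p).source) (v : Coord n) :
    toCoord p x (fromCoord p x v) = v :=
  Trivialization.continuousLinearMapAt_symmL _ (mem_baseSet hx) v

lemma toCoord_injective (hx : x ∈ (chart n p).source) :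
    Function.Injective (toCoord (n := n) p x) :=
  Function.LeftInverse.injective (fromCoord_toCoord hx)

lemma toCoord_eq_mfderiv (hx : x ∈ (chart n p).source) :
    toCoord p x = mfderiv (𝓡 (2 * n)) 𝓘(ℝ, Coord n) (chart n p) x := by
  rw [extChartAt_source] at hx
  exact TangentBundle.continuousLinearMapAt_trivializationAt hx

lemma toCoord_self (v : TangentSpace (𝓡 (2 * n)) x) : toCoord x x v = v := by
  rw [toCoord_eq_mfderiv (mem_extChartAt_source x), mfderiv_extChartAt_self]
  rfl

lemma fromCoord_self (v : Coord n) : fromCoord x x v = v := by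
  have h := fromCoord_toCoord (mem_extChartAt_source (I := 𝓡 (2 * n)) x)
    (v : TangentSpace (𝓡 (2 * n)) x)
  exact (congrArg (fromCoord x x) (toCoord_self (v : TangentSpace (𝓡 (2 * n)) x)).symm).trans h

lemma coordField_eq (hx : x ∈ (chart n p).source) (a : Coord n) :
    coordField p a x = fromCoord p x a :=
  (Trivialization.symmL_apply (R := ℝ) _ (mem_baseSet hx) a).symm

/-- The components of a vector field in a chart. -/
noncomputable def fieldRep (p : M) (X : RealField n M) (y : Coord n) : Coord n :=
  toCoord p ((chart n p).symm y) (X ((chart n p).symm y))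

lemma fieldRep_chart (hx : x ∈ (chart n p).source) (X : RealField n M) :
    fieldRep p X (chart n p x) = toCoord p x (X x) := by
  rw [fieldRep, (chart n p).left_inv hx]

/-- The vector field with given components in a chart. -/
noncomputable def repField (p : M) (f : Coord n → Coord n) : RealField n M := fun x =>
  fromCoord p x (f (chart n p x))

lemma fieldRep_repField {y : Coord n} (hy : y ∈ (chart n p).target) (f : Coord n → Coord n) :
    fieldRep p (repField p f) y = f y := by
  rw [fieldRep, repField, toCoord_fromCoord ((chart n p).map_target hy),
    (chart n p).right_inv hy]

lemma contMDiffAt_chart (hx : x ∈ (chart n p).source) :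
    ContMDiffAt (𝓡 (2 * n)) 𝓘(ℝ, Coord n) ∞ (chart n p) x := by
  rw [extChartAt_source] at hx
  exact contMDiffAt_extChartAt' hx

lemma contMDiffAt_chart_symm {y : Coord n} (hy : y ∈ (chart n p).target) :
    ContMDiffAt 𝓘(ℝ, Coord n) (𝓡 (2 * n)) ∞ (chart n p).symm y :=
  (contMDiffOn_extChartAt_symm p).contMDiffAt (target_mem_nhds hy)

lemma contMDiffAt_iff_chart {V : Type*} [NormedAddCommGroup V] [NormedSpace ℝ V] {f : M → V}
    (hx : x ∈ (chart n p).source) :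
    ContMDiffAt (𝓡 (2 * n)) 𝓘(ℝ, V) ∞ f x ↔
      ContDiffAt ℝ ∞ (f ∘ (chart n p).symm) (chart n p x) := by
  rw [extChartAt_source] at hx
  rw [contMDiffAt_iff_source_of_mem_source hx]
  simp [contMDiffWithinAt_univ, contMDiffAt_iff_contDiffAt]

lemma smoothFieldAt_iff (hx : x ∈ (chart n p).source) {X : RealField n M} :
    SmoothFieldAt X x ↔ ContDiffAt ℝ ∞ (fieldRep p X) (chart n p x) := by
  rw [SmoothFieldAt, Trivialization.contMDiffAt_section_iff
    (trivializationAt (Coord n) (TangentSpace (𝓡 (2 * n)) : M → Type) p) (mem_baseSet hx),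
    contMDiffAt_iff_chart hx]
  have h : fieldRep p X =ᶠ[𝓝 (chart n p x)] (fun z => (trivializationAt (Coord n)
      (TangentSpace (𝓡 (2 * n)) : M → Type) p ⟨z, X z⟩).2) ∘ (chart n p).symm := by
    filter_upwards [target_mem_nhds ((chart n p).map_source hx)] with y hy
    exact Trivialization.continuousLinearMapAt_apply_of_mem (R := ℝ) _
      (mem_baseSet ((chart n p).map_target hy)) _
  exact ⟨fun h' => h'.congr_of_eventuallyEq h, fun h' => h'.congr_of_eventuallyEq h.symm⟩

lemma smoothFieldAt_repField (hx : x ∈ (chart n p).source) {f : Coord n → Coord n}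
    (hf : ContDiffAt ℝ ∞ f (chart n p x)) : SmoothFieldAt (repField p f : RealField n M) x := by
  rw [smoothFieldAt_iff hx]
  refine hf.congr_of_eventuallyEq ?_
  filter_upwards [target_mem_nhds ((chart n p).map_source hx)] with y hy
  exact fieldRep_repField hy f

lemma coordField_eventuallyEq (hx : x ∈ (chart n p).source) (a : Coord n) :
    (coordField p a : RealField n M) =ᶠ[𝓝 x] repField p fun _ => a := by
  filter_upwards [source_mem_nhds hx] with y hy
  exact coordField_eq hy a

lemma SmoothFieldAt.congr_of_eventuallyEq {X Y : RealField n M} (hX : SmoothFieldAt X x)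
    (h : Y =ᶠ[𝓝 x] X) : SmoothFieldAt Y x :=
  ContMDiffAt.congr_of_eventuallyEq hX (h.mono fun y hy => by simp [hy])

lemma smoothFieldAt_coordField (hx : x ∈ (chart n p).source) (a : Coord n) :
    SmoothFieldAt (coordField p a : RealField n M) x :=
  (smoothFieldAt_repField hx contDiffAt_const).congr_of_eventuallyEq (coordField_eventuallyEq hx a)

lemma AffineConnection.congr_of_eventuallyEq (D : AffineConnection n M) {X Y : RealField n M}
    (hX : SmoothFieldAt X x) (h : Y =ᶠ[𝓝 x] X) : D Y x = D X x :=
  D.isCovariantDerivativeOnUniv.congr_of_eventuallyEq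
    (hX.congr_of_eventuallyEq h).mdifferentiableAt hX.mdifferentiableAt Filter.univ_mem h

lemma AffineConnection.map_sum (D : AffineConnection n M) {ι : Type*} (s : Finset ι)
    {X : ι → RealField n M} (hX : ∀ i ∈ s, SmoothFieldAt (X i) x) :
    D (fun y => ∑ i ∈ s, X i y) x = ∑ i ∈ s, D (X i) x := by
  classical
  induction s using Finset.induction_on with
  | empty =>
    simp only [Finset.sum_empty]
    exact congrFun D.zero x
  | insert i s hi ih =>
    rw [Finset.sum_insert hi, ← ih fun j hj => hX j (Finset.mem_insert_of_mem hj)]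
    simp only [Finset.sum_insert hi]
    exact D.isCovariantDerivativeOnUniv.add (hX i (Finset.mem_insert_self i s)).mdifferentiableAt
      (SmoothFieldAt.sum fun j hj => hX j (Finset.mem_insert_of_mem hj)).mdifferentiableAt

/-- The Christoffel symbols of a connection in a chart; `christoffel D p y a v` has components
`Γᶜ_{ba} vᵇ aᵃ`. -/
noncomputable def christoffel (D : AffineConnection n M) (p : M) (y : Coord n) :
    Coord n →L[ℝ] Coord n →L[ℝ] Coord n :=
  ∑ i, (EuclideanSpace.proj i : Coord n →L[ℝ] ℝ).smulRight
    (toCoord p ((chart n p).symm y) ∘L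
      D (coordField p (EuclideanSpace.single i 1)) ((chart n p).symm y) ∘L
      fromCoord p ((chart n p).symm y))

lemma christoffel_apply (D : AffineConnection n M) (hx : x ∈ (chart n p).source) (a v : Coord n) :
    christoffel D p (chart n p x) a v =
      ∑ i, a i • toCoord p x (D (coordField p (EuclideanSpace.single i 1)) x
        (fromCoord p x v)) := by
  simp only [christoffel, sum_apply, ContinuousLinearMap.smulRight_apply,
    PiLp.proj_apply, smul_apply, ContinuousLinearMap.comp_apply]
  have h := (chart n p).left_inv hx
  -- The fibres depend on the base point, so the base point is made a variable before it is
  -- identified with `x`.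
  generalize (chart n p).symm (chart n p x) = z at h
  subst h
  rfl

/-- The covariant derivative of a vector field in a chart. -/
lemma toCoord_covariantDerivative (D : AffineConnection n M) (hx : x ∈ (chart n p).source)
    {X : RealField n M} (hX : SmoothFieldAt X x) (v : TangentSpace (𝓡 (2 * n)) x) :
    toCoord p x (D X x v) = fderiv ℝ (fieldRep p X) (chart n p x) (toCoord p x v)
      + christoffel D p (chart n p x) (toCoord p x (X x)) (toCoord p x v) := by
  have hrep := (smoothFieldAt_iff hx).1 hX
  set f : Fin (2 * n) → M → ℝ := fun i z => fieldRep p X (chart n p z) i with hf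
  have hfrep : ∀ i, ContDiffAt ℝ ∞ (fun y => fieldRep p X y i) (chart n p x) := fun i =>
    (EuclideanSpace.proj i : Coord n →L[ℝ] ℝ).contDiff.contDiffAt.comp _ hrep
  have hfm : ∀ i, ContMDiffAt (𝓡 (2 * n)) 𝓘(ℝ, ℝ) ∞ (f i) x := fun i =>
    (hfrep i).contMDiffAt.comp x (contMDiffAt_chart hx)
  -- Expansion in the coordinate fields, valid near `x`. The Leibniz rule then produces the ordinary
  -- derivative of the components and the Christoffel term.
  have hXe : X =ᶠ[𝓝 x] fun z =>
      ∑ i, (f i • (coordField p (EuclideanSpace.single i 1) : RealField n M)) z := by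
    filter_upwards [source_mem_nhds hx] with z hz
    simp only [hf, Pi.smul_apply', coordField_eq hz, fieldRep_chart hz]
    conv_lhs => rw [← fromCoord_toCoord hz (X z),
      ← (EuclideanSpace.basisFun (Fin (2 * n)) ℝ).sum_repr (toCoord p z (X z))]
    simp only [map_sum, map_smul, EuclideanSpace.basisFun_repr, EuclideanSpace.basisFun_apply]
    rfl
  have hs : ∀ i, SmoothFieldAt
      (f i • (coordField p (EuclideanSpace.single i 1) : RealField n M)) x := fun i =>
    ContMDiffAt.smul_section (hfm i) (smoothFieldAt_coordField hx _)
  have hd : ∀ i, mvfderiv (𝓡 (2 * n)) (f i) x v =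
      fderiv ℝ (fieldRep p X) (chart n p x) (toCoord p x v) i := by
    intro i
    have h1 := mvfderiv_comp_apply (I' := 𝓘(ℝ, Coord n)) (I := 𝓡 (2 * n))
      (g := fun y => fieldRep p X y i) (f := chart n p) x
      ((hfrep i).contMDiffAt.mdifferentiableAt (by simp))
      ((contMDiffAt_chart hx).mdifferentiableAt (by simp)) v
    refine h1.trans ?_
    rw [← toCoord_eq_mfderiv hx]
    have h2 : fderiv ℝ (fun y => fieldRep p X y i) (chart n p x) =
        (EuclideanSpace.proj i : Coord n →L[ℝ] ℝ) ∘L fderiv ℝ (fieldRep p X) (chart n p x) :=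
      ((EuclideanSpace.proj i : Coord n →L[ℝ] ℝ).hasFDerivAt.comp _
        (hrep.differentiableAt (by simp)).hasFDerivAt).fderiv
    change mfderiv 𝓘(ℝ, Coord n) 𝓘(ℝ, ℝ) (fun y => fieldRep p X y i) (chart n p x)
      (toCoord p x v) = _
    rw [mfderiv_eq_fderiv, h2]
    rfl
  rw [AffineConnection.congr_of_eventuallyEq D (SmoothFieldAt.sum fun i _ => hs i) hXe,
    D.map_sum _ fun i _ => hs i]
  have hterm : ∀ i, D (f i • (coordField p (EuclideanSpace.single i 1) : RealField n M)) x v =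
      (toCoord p x (X x)) i • D (coordField p (EuclideanSpace.single i 1)) x v +
      fderiv ℝ (fieldRep p X) (chart n p x) (toCoord p x v) i •
        fromCoord p x (EuclideanSpace.single i 1) := by
    intro i
    rw [D.isCovariantDerivativeOnUniv.leibniz (smoothFieldAt_coordField hx _).mdifferentiableAt
      ((hfm i).mdifferentiableAt (by simp))]
    rw [add_apply, smul_apply, ContinuousLinearMap.smulRight_apply, hd, coordField_eq hx]
    simp only [hf, fieldRep_chart hx]
  rw [sum_apply]
  simp only [hterm, Finset.sum_add_distrib, map_add, map_sum, map_smul, toCoord_fromCoord hx]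
  rw [christoffel_apply D hx, fromCoord_toCoord hx, add_comm]
  congr 1
  conv_rhs => rw [← (EuclideanSpace.basisFun (Fin (2 * n)) ℝ).sum_repr
    (fderiv ℝ (fieldRep p X) (chart n p x) (toCoord p x v))]
  simp

/-- A vector field smooth near a point can be cut off to a global smooth one. -/
lemma exists_cutoff [T2Space M] {X : RealField n M} {s : Set M} (hs : s ∈ 𝓝 x)
    (hX : ∀ y ∈ s, SmoothFieldAt X y) :
    ∃ χ : M → ℝ, (∀ y, SmoothFieldAt (fun y => χ y • X y : RealField n M) y) ∧ χ =ᶠ[𝓝 x] 1 ∧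
      ∀ y ∉ s, χ y = 0 := by
  obtain ⟨χ, hχ, hχ1, hχs⟩ := exists_smooth_bump (n := n) hs
  exact ⟨χ, SmoothFieldAt.smul_of_tsupport hχ fun y hy => hX y (hχs hy), hχ1,
    fun y hy => image_eq_zero_of_notMem_tsupport fun h => hy (hχs h)⟩

/-- Smoothness of the connection is applied to globally smooth sections, so the coordinate fields
are first cut off; locality of `D` removes the cutoff near `x`. -/
lemma contDiffAt_christoffel [T2Space M] {D : AffineConnection n M}
    (hD : CovariantDerivative.ContMDiffCovariantDerivative D ∞) (hx : x ∈ (chart n p).source) :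
    ContDiffAt ℝ ∞ (christoffel D p) (chart n p x) := by
  refine ContDiffAt.sum fun i _ => ?_
  refine ContDiffAt.smulRight contDiffAt_const ?_
  obtain ⟨χ, hχ, hχ1, -⟩ := exists_cutoff (n := n) (source_mem_nhds hx)
    fun y hy => smoothFieldAt_coordField (p := p) hy (EuclideanSpace.single i 1)
  have h1 := hD.contMDiff.contMDiff (σ := fun y => χ y • coordField p (EuclideanSpace.single i 1) y)
    (fun y _ => (hχ y).contMDiffWithinAt)
  have h2 := (h1 x (mem_univ x)).contMDiffAt Filter.univ_mem
  rw [Trivialization.contMDiffAt_section_iff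
    (trivializationAt (Coord n →L[ℝ] Coord n)
      (fun x : M => TangentSpace (𝓡 (2 * n)) x →L[ℝ] TangentSpace (𝓡 (2 * n)) x) p)
    (by
      rw [hom_trivializationAt_baseSet]
      exact ⟨mem_baseSet hx, mem_baseSet hx⟩), contMDiffAt_iff_chart hx] at h2
  refine h2.congr_of_eventuallyEq ?_
  have hev := (hχ1.eventually_nhds.and (source_mem_nhds hx))
  have hev' : ∀ᶠ y in 𝓝 (chart n p x), (∀ᶠ z in 𝓝 ((chart n p).symm y), χ z = (1 : M → ℝ) z) ∧
      (chart n p).symm y ∈ (chart n p).source := by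
    have := tendsto_chart_symm ((chart n p).map_source hx)
    rw [(chart n p).left_inv hx] at this
    exact this.eventually hev
  filter_upwards [hev'] with y hy
  rw [Function.comp_apply, hom_trivializationAt_apply]
  have : D (fun y => χ y • coordField p (EuclideanSpace.single i 1) y) ((chart n p).symm y) =
      D (coordField p (EuclideanSpace.single i 1)) ((chart n p).symm y) :=
    D.congr_of_eventuallyEq (smoothFieldAt_coordField hy.2 _)
      (hy.1.mono fun z hz => by simp [hz]; rfl)
  rw [this]
  rfl

/-- Coordinate fields are pullbacks of constant fields under the chart, and the bracket is natural
under pullback. -/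
lemma mlieBracket_coordField (hx : x ∈ (chart n p).source) (a b : Coord n) :
    VectorField.mlieBracket (𝓡 (2 * n)) (coordField p a) (coordField p b) x = 0 := by
  have : IsManifold (𝓡 (2 * n)) (minSmoothness ℝ 2) M := by
    rw [minSmoothness_of_isRCLikeNormedField]
    exact IsManifold.of_le (n := ∞) (WithTop.coe_le_coe.2 (le_top : (2 : ℕ∞) ≤ ⊤))
  let const : Coord n → (y : Coord n) → TangentSpace 𝓘(ℝ, Coord n) y := fun c _ => c
  have hconst : ∀ c y, MDifferentiableAt 𝓘(ℝ, Coord n) (𝓘(ℝ, Coord n).prod 𝓘(ℝ, Coord n))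
      (fun y => TotalSpace.mk' (Coord n) y (const c y)) y := fun c y =>
    (contMDiffAt_vectorSpace_iff_contDiffAt.2
      (contDiffAt_const (c := c))).mdifferentiableAt (n := ∞) (by simp)
  have hpull : ∀ c : Coord n, (coordField p c : RealField n M) =ᶠ[𝓝 x]
      VectorField.mpullback (𝓡 (2 * n)) 𝓘(ℝ, Coord n) (chart n p) (const c) := by
    intro c
    filter_upwards [source_mem_nhds hx] with y hy
    have h1 : (mfderiv (𝓡 (2 * n)) 𝓘(ℝ, Coord n) (chart n p) y).inverse = fromCoord p y := by
      rw [← toCoord_eq_mfderiv hy]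
      refine ContinuousLinearMap.inverse_eq ?_ ?_
      · ext1 v; exact toCoord_fromCoord hy v
      · ext1 v; exact fromCoord_toCoord hy v
    exact (coordField_eq hy c).trans (congrArg (fun f => f c) h1).symm
  rw [Filter.EventuallyEq.mlieBracket_vectorField_eq (hpull a) (hpull b)]
  have h2 := VectorField.mpullback_mlieBracket (n := ∞) (hconst a (chart n p x))
    (hconst b (chart n p x)) (contMDiffAt_chart hx)
    (by
      rw [minSmoothness_of_isRCLikeNormedField]
      exact WithTop.coe_le_coe.2 (le_top : (2 : ℕ∞) ≤ ⊤))
  refine h2.symm.trans ?_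
  have h3 : VectorField.mlieBracket 𝓘(ℝ, Coord n) (const a) (const b) = 0 := by
    rw [← VectorField.mlieBracketWithin_univ, VectorField.mlieBracketWithin_eq_lieBracketWithin]
    ext1 y
    change VectorField.lieBracketWithin ℝ (fun _ => a) (fun _ => b) univ y = 0
    simp [VectorField.lieBracketWithin]
  rw [h3, VectorField.mpullback_zero]
  rfl

/-- The Christoffel symbols of a torsion-free connection are symmetric. -/
lemma christoffel_symm {g : SemiRiemannianMetric n M} {D : AffineConnection n M}
    (hD : IsLeviCivita g D) (hx : x ∈ (chart n p).source) (a b : Coord n) :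
    christoffel D p (chart n p x) a b = christoffel D p (chart n p x) b a := by
  have key : ∀ a b : Coord n, toCoord p x (D (coordField p a) x (coordField p b x)) =
      christoffel D p (chart n p x) a b := by
    intro a b
    rw [toCoord_covariantDerivative D hx (smoothFieldAt_coordField hx a), coordField_eq hx,
      coordField_eq hx, toCoord_fromCoord hx, toCoord_fromCoord hx]
    have h : fieldRep p (coordField p a : RealField n M) =ᶠ[𝓝 (chart n p x)] fun _ => a := by
      filter_upwards [target_mem_nhds ((chart n p).map_source hx)] with y hy
      rw [fieldRep, coordField_eq ((chart n p).map_target hy),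
        toCoord_fromCoord ((chart n p).map_target hy)]
    rw [h.fderiv_eq]
    simp
  rw [← key, ← key, ← sub_eq_zero, ← map_sub, ← hD.mlieBracket_eq (smoothFieldAt_coordField hx b)
    (smoothFieldAt_coordField hx a), mlieBracket_coordField hx, map_zero]

/-! ### Curves in a chart -/

lemma hasDerivAt_chart_comp {γ : ℝ → M} {t : ℝ}
    (hγ : ContMDiffAt 𝓘(ℝ, ℝ) (𝓡 (2 * n)) ∞ γ t) (hx : γ t ∈ (chart n p).source) :
    HasDerivAt (fun s => chart n p (γ s)) (toCoord p (γ t) (velocity γ t)) t := by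
  have h1 := ((contMDiffAt_chart hx).mdifferentiableAt (by simp)).hasMFDerivAt.comp t
    (hγ.mdifferentiableAt (by simp)).hasMFDerivAt
  rw [← toCoord_eq_mfderiv hx] at h1
  have h2 : HasFDerivAt (fun s => chart n p (γ s)) ((toCoord p (γ t) ∘L
      (mfderiv 𝓘(ℝ, ℝ) (𝓡 (2 * n)) γ t : ℝ →L[ℝ] TangentSpace (𝓡 (2 * n)) (γ t)) :
      ℝ →L[ℝ] Coord n)) t := hasMFDerivAt_iff_hasFDerivAt.1 h1
  exact h2.hasDerivAt

lemma contDiffAt_chart_comp {γ : ℝ → M} {t : ℝ}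
    (hγ : ContMDiffAt 𝓘(ℝ, ℝ) (𝓡 (2 * n)) ∞ γ t) (hx : γ t ∈ (chart n p).source) :
    ContDiffAt ℝ ∞ (fun s => chart n p (γ s)) t :=
  ((contMDiffAt_chart hx).comp t hγ).contDiffAt

lemma hasFDerivAt_coordChange {q : M} (hx : x ∈ (chart n p).source) (hx' : x ∈ (chart n q).source) :
    HasFDerivAt (chart n q ∘ (chart n p).symm) (toCoord q x ∘L fromCoord p x) (chart n p x) := by
  have h := hasFDerivWithinAt_tangentCoordChange (I := 𝓡 (2 * n)) ⟨hx, hx'⟩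
  rw [modelWithCornersSelf_coe, range_id, hasFDerivWithinAt_univ] at h
  refine h.congr_fderiv ?_
  ext1 v
  have hp := hx
  have hq := hx'
  rw [extChartAt_source] at hp hq
  have h1 : toCoord (n := n) q x = tangentCoordChange (𝓡 (2 * n)) x q x :=
    TangentBundle.continuousLinearMapAt_trivializationAt_eq_core hq
  have h2 : fromCoord (n := n) p x = tangentCoordChange (𝓡 (2 * n)) p x x :=
    TangentBundle.symmL_trivializationAt_eq_core hp
  refine (tangentCoordChange_comp (w := p) (x := x) (y := q) (z := x)
    ⟨⟨hx, mem_extChartAt_source x⟩, hx'⟩).symm.trans ?_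
  rw [← h2, ← h1]
  rfl

lemma contDiffAt_coordChange {q : M} (hx : x ∈ (chart n p).source)
    (hx' : x ∈ (chart n q).source) :
    ContDiffAt ℝ ∞ (chart n q ∘ (chart n p).symm) (chart n p x) := by
  have h := contMDiffAt_chart_symm ((chart n p).map_source hx)
  have h' := contMDiffAt_chart hx'
  rw [← (chart n p).left_inv hx] at h'
  exact (h'.comp _ h).contDiffAt

/-- The acceleration of a curve can be computed in any chart. -/
lemma toCoord_acceleration (D : AffineConnection n M) {γ : ℝ → M} {t : ℝ}
    (hγ : ContMDiffAt 𝓘(ℝ, ℝ) (𝓡 (2 * n)) ∞ γ t) (hx : γ t ∈ (chart n p).source) :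
    toCoord p (γ t) (acceleration D γ t) = deriv (deriv fun s => chart n p (γ s)) t +
      christoffel D p (chart n p (γ t)) (deriv (fun s => chart n p (γ s)) t)
        (deriv (fun s => chart n p (γ s)) t) := by
  set x : ℝ → Coord n := fun s => chart n p (γ s) with hxdef
  set z : ℝ → Coord n := fun s => chart n (γ t) (γ s) with hzdef
  set τ := chart n (γ t) ∘ (chart n p).symm with hτ
  have hq := mem_extChartAt_source (I := 𝓡 (2 * n)) (γ t)
  have hxs : ContDiffAt ℝ ∞ x t := contDiffAt_chart_comp hγ hx
  have hτs : ContDiffAt ℝ ∞ τ (x t) := contDiffAt_coordChange hx hq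
  have hvel : toCoord p (γ t) (velocity γ t) = deriv x t := (hasDerivAt_chart_comp hγ hx).deriv.symm
  have hvel' : velocity γ t = deriv z t := by
    rw [(hasDerivAt_chart_comp hγ hq).deriv, toCoord_self]
  have hzτ : z =ᶠ[𝓝 t] fun s => τ (x s) := by
    filter_upwards [hγ.continuousAt.preimage_mem_nhds (source_mem_nhds hx)] with s hs
    simp only [hzdef, hτ, hxdef, Function.comp_apply, (chart n p).left_inv hs]
  have hdx : ∀ᶠ s in 𝓝 t, DifferentiableAt ℝ x s :=
    ((hxs.of_le (m := 1) (by simp)).eventually (by simp)).mono fun s hs =>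
      hs.differentiableAt (by simp)
  have hdτ : ∀ᶠ y in 𝓝 (x t), DifferentiableAt ℝ τ y :=
    ((hτs.of_le (m := 1) (by simp)).eventually (by simp)).mono fun s hs =>
      hs.differentiableAt (by simp)
  have hdz : deriv z =ᶠ[𝓝 t] fun s => fderiv ℝ τ (x s) (deriv x s) := by
    filter_upwards [hzτ.eventually_nhds, hdx, hxs.continuousAt.eventually hdτ] with s hs h1 h2
    rw [Filter.EventuallyEq.deriv_eq hs]
    exact (h2.hasFDerivAt.comp_hasDerivAt s h1.hasDerivAt).deriv
  have hT : HasFDerivAt (fderiv ℝ τ) (fderiv ℝ (fderiv ℝ τ) (x t)) (x t) :=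
    ((hτs.fderiv_right (m := ∞) (by simp)).differentiableAt (by simp)).hasFDerivAt
  have hx2 : HasDerivAt (deriv x) (deriv (deriv x) t) t := by
    refine DifferentiableAt.hasDerivAt ?_
    have h := (hxs.fderiv_right (m := ∞) (by simp)).differentiableAt (by simp)
    exact (h.clm_apply (differentiableAt_const (1 : ℝ)))
  have hz2 : deriv (deriv z) t = fderiv ℝ (fderiv ℝ τ) (x t) (deriv x t) (deriv x t) +
      fderiv ℝ τ (x t) (deriv (deriv x) t) := by
    rw [hdz.deriv_eq]
    exact ((hT.comp_hasDerivAt t (hdx.self_of_nhds).hasDerivAt).clm_apply hx2).deriv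
  -- The field whose covariant derivative enters the definition of `acceleration`: it is constant in
  -- the chart at `γ t`, but its components `r` in the chart at `p` vary.
  set X : RealField n M := coordField (γ t) (deriv z t) with hX
  have hXs : SmoothFieldAt X (γ t) := smoothFieldAt_coordField hq _
  set r := fieldRep p X with hr
  have hrs : ContDiffAt ℝ ∞ r (x t) := (smoothFieldAt_iff hx).1 hXs
  have hXt : X (γ t) = deriv z t := by
    rw [hX, coordField_eq hq, fromCoord_self]
  have hrt : r (x t) = deriv x t := by
    rw [hr, hxdef]
    beta_reduce
    rw [fieldRep_chart hx, hXt, ← hvel, hvel']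
  have hTr : (fun y => fderiv ℝ τ y (r y)) =ᶠ[𝓝 (x t)] fun _ => deriv z t := by
    have h1 : ∀ᶠ y in 𝓝 (x t), (chart n p).symm y ∈ (chart n (γ t)).source := by
      have h := tendsto_chart_symm ((chart n p).map_source hx)
      rw [(chart n p).left_inv hx] at h
      exact h (source_mem_nhds hq)
    filter_upwards [h1, target_mem_nhds ((chart n p).map_source hx)] with y hy hyt
    have h2 := hasFDerivAt_coordChange ((chart n p).map_target hyt) hy
    rw [(chart n p).right_inv hyt] at h2
    rw [h2.fderiv, ContinuousLinearMap.comp_apply, hr, fieldRep,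
      fromCoord_toCoord ((chart n p).map_target hyt), hX, coordField_eq hy, toCoord_fromCoord hy]
  -- Differentiating the constancy of `Dτ(r)` expresses the second derivative of the coordinate
  -- change by the derivative of `r`. The latter cancels against the derivative term of `D X`
  -- computed in the chart at `p`.
  have hTr' : fderiv ℝ (fderiv ℝ τ) (x t) (deriv x t) (deriv x t) +
      fderiv ℝ τ (x t) (fderiv ℝ r (x t) (deriv x t)) = 0 := by
    have h1 := hT.clm_apply (hrs.differentiableAt (by simp)).hasFDerivAt
    have h2 := h1.unique ((hasFDerivAt_const (deriv z t) (x t)).congr_of_eventuallyEq hTr)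
    have h3 := congrArg (fun f => f (deriv x t)) h2
    simp only [hrt] at h3
    simpa [add_comm] using h3
  have hz2' : deriv (deriv z) t =
      fderiv ℝ τ (x t) (deriv (deriv x) t - fderiv ℝ r (x t) (deriv x t)) := by
    rw [hz2, map_sub, eq_neg_of_add_eq_zero_left hTr']
    abel
  have hτt : ∀ v, fderiv ℝ τ (x t) v = fromCoord p (γ t) v := by
    intro v
    rw [hτ, hxdef]
    beta_reduce
    rw [(hasFDerivAt_coordChange hx hq).fderiv, ContinuousLinearMap.comp_apply, toCoord_self]
  have hacc : acceleration D γ t = fromCoord p (γ t) (deriv (deriv x) t -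
      fderiv ℝ r (x t) (deriv x t)) + D X (γ t) (velocity γ t) := by
    rw [← hτt, ← hz2', hvel']
    rfl
  rw [hacc, map_add, toCoord_fromCoord hx, toCoord_covariantDerivative D hx hXs, hvel, hXt,
    ← hvel', hvel]
  abel

end Chart

/-! ### The Frobenius theorem for total differential equations -/

section Frobenius

open Metric
open scoped NNReal

variable {E V : Type*} [NormedAddCommGroup E] [NormedSpace ℝ E] [NormedAddCommGroup V]
  [NormedSpace ℝ V]

/-- Second order Taylor estimate for a map whose derivative is Lipschitz. -/
lemma norm_sub_sub_fderiv_le {G : Type*} [NormedAddCommGroup G] [NormedSpace ℝ G] {K : E → G}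
    {B : Set E} (hB : Convex ℝ B) (hK : ∀ y ∈ B, DifferentiableAt ℝ K y) {C : ℝ≥0}
    (hL : LipschitzOnWith C (fderiv ℝ K) B) {y w : E} (hy : y ∈ B) (hw : y + w ∈ B) :
    ‖K (y + w) - K y - fderiv ℝ K y w‖ ≤ C * ‖w‖ * ‖w‖ := by
  have hs : segment ℝ y (y + w) ⊆ B := hB.segment_subset hy hw
  have h := (convex_segment y (y + w)).norm_image_sub_le_of_norm_fderiv_le' (𝕜 := ℝ) (f := K)
    (φ := fderiv ℝ K y) (C := C * ‖w‖) (fun z hz => hK z (hs hz)) (fun z hz => ?_)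
    (left_mem_segment ℝ _ _) (right_mem_segment ℝ _ _)
  · simpa using h
  · refine (hL.norm_sub_le (hs hz) hy).trans ?_
    gcongr
    have := norm_sub_le_of_mem_segment hz
    simpa using this

/-- Existence of solutions of a total differential equation along rays. -/
lemma exists_ray_solution [CompleteSpace E] {K : E → V →L[ℝ] E} {x₀ : E} {a C L : ℝ≥0}
    (hL : LipschitzOnWith L K (closedBall x₀ a)) (hC : ∀ y ∈ closedBall x₀ a, ‖K y‖ ≤ C) {u : V}
    (hu : C * ‖u‖ ≤ a) :
    ∃ φ : ℝ → E, φ 0 = x₀ ∧ ∀ t ∈ Icc (0 : ℝ) 1,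
      HasDerivWithinAt φ (K (φ t) u) (Icc 0 1) t ∧ φ t ∈ closedBall x₀ a := by
  have hpl : IsPicardLindelof (fun _ y => K y u) (tmin := 0) (tmax := 1) ⟨0, by simp⟩ x₀ a 0
      (C * ‖u‖₊) (L * ‖u‖₊) :=
    { lipschitzOnWith := fun t _ => LipschitzOnWith.of_dist_le_mul fun y hy z hz => by
        rw [dist_eq_norm, dist_eq_norm, ← sub_apply]
        refine ((K y - K z).le_opNorm u).trans ?_
        have := hL.norm_sub_le hy hz
        push_cast
        calc ‖K y - K z‖ * ‖u‖ ≤ L * ‖y - z‖ * ‖u‖ := by gcongr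
          _ = _ := by ring
      continuousOn := fun _ _ => continuousOn_const
      norm_le := fun _ _ y hy => by
        refine ((K y).le_opNorm u).trans ?_
        push_cast
        gcongr
        exact hC y hy
      mul_max_le := by simpa using hu }
  -- The fixed point of the Picard iteration is used directly, since its values are known to stay in
  -- the closed ball.
  obtain ⟨α, hα⟩ := ODE.FunSpace.exists_isFixedPt_next hpl (mem_closedBall_self le_rfl)
  have hmem : ∀ t, α.compProj t ∈ closedBall x₀ a := fun t =>
    α.compProj_mem_closedBall hpl.mul_max_le
  refine ⟨α.compProj, ?_, fun t ht => ⟨?_, hmem t⟩⟩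
  · have h : α.compProj ((⟨0, by simp⟩ : Icc (0 : ℝ) 1) : ℝ) = x₀ := by
      rw [ODE.FunSpace.compProj_val, ← hα, ODE.FunSpace.next_apply₀]
    exact h
  · apply ODE.hasDerivWithinAt_picard_Icc (f := fun _ y => K y u)
      (t₀ := ((⟨0, by simp⟩ : Icc (0 : ℝ) 1) : ℝ)) (by simp)
      hpl.continuousOn_uncurry α.continuous_compProj.continuousOn (fun _ _ => hmem _)
      x₀ ht |>.congr_of_mem _ ht
    intro t' ht'
    nth_rw 1 [← hα]
    rw [ODE.FunSpace.compProj_of_mem ht', ODE.FunSpace.next_apply]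

/-- With zero initial error Grönwall's bound is linear in the defect, so a defect of order `‖h‖ ^ 2`
yields an error of the same order. -/
lemma gronwallBound_zero_mul (L ε t : ℝ) :
    gronwallBound 0 L ε t = ε * gronwallBound 0 L 1 t := by
  by_cases hL : L = 0
  · simp [hL, gronwallBound_K0]
  · simp only [gronwallBound_of_K_ne_0 hL]
    ring

set_option synthInstance.maxHeartbeats 100000 in
lemma exists_uniform_bound {K : E → V →L[ℝ] E} {x₀ : E} (hK : ContDiffAt ℝ ∞ K x₀) {Ω : Set E}
    (hΩ : Ω ∈ 𝓝 x₀) :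
    ∃ r C : ℝ≥0, 0 < r ∧ closedBall x₀ r ⊆ Ω ∧ LipschitzOnWith C K (closedBall x₀ r) ∧
      LipschitzOnWith C (fderiv ℝ K) (closedBall x₀ r) ∧ ∀ y ∈ closedBall x₀ r,
        DifferentiableAt ℝ K y ∧ ‖K y‖ ≤ C ∧ ‖fderiv ℝ K y‖ ≤ C := by
  have hK' : ContDiffAt ℝ 1 (fderiv ℝ K) x₀ :=
    hK.fderiv_right (m := 1) (WithTop.coe_le_coe.2 (le_top : (2 : ℕ∞) ≤ ⊤))
  obtain ⟨C₁, s₁, hs₁, h₁⟩ := (hK.of_le (m := 1) (by simp)).exists_lipschitzOnWith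
  obtain ⟨C₂, s₂, hs₂, h₂⟩ := hK'.exists_lipschitzOnWith
  have h₃ : ∀ᶠ y in 𝓝 x₀, DifferentiableAt ℝ K y :=
    ((hK.of_le (m := 1) (by simp)).eventually (by simp)).mono fun y hy =>
      hy.differentiableAt (by simp)
  have h₄ : ∀ᶠ y in 𝓝 x₀, ‖K y‖ < ‖K x₀‖ + 1 :=
    hK.continuousAt.norm.eventually (gt_mem_nhds (by linarith))
  have h₅ : ∀ᶠ y in 𝓝 x₀, ‖fderiv ℝ K y‖ < ‖fderiv ℝ K x₀‖ + 1 :=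
    (hK'.continuousAt.norm (E := E →L[ℝ] V →L[ℝ] E)).eventually
      (gt_mem_nhds (lt_add_one (‖fderiv ℝ K x₀‖)))
  have hall : ∀ᶠ y in 𝓝 x₀, y ∈ Ω ∧ y ∈ s₁ ∧ y ∈ s₂ ∧ DifferentiableAt ℝ K y ∧
      ‖K y‖ < ‖K x₀‖ + 1 ∧ ‖fderiv ℝ K y‖ < ‖fderiv ℝ K x₀‖ + 1 := by
    filter_upwards [hΩ, hs₁, hs₂, h₃, h₄, h₅] with y a b c d e f
    exact ⟨a, b, c, d, e, f⟩
  obtain ⟨r, hr, hr'⟩ := Metric.nhds_basis_closedBall.mem_iff.1 hall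
  refine ⟨⟨r, hr.le⟩, max (max C₁ C₂) (max (‖K x₀‖₊ + 1) (‖fderiv ℝ K x₀‖₊ + 1)), hr,
    fun y hy => (hr' hy).1, ?_, ?_, fun y hy => ⟨(hr' hy).2.2.2.1, ?_, ?_⟩⟩
  · exact (h₁.mono fun y hy => (hr' hy).2.1).weaken ((le_max_left _ _).trans (le_max_left _ _))
  · exact (h₂.mono fun y hy => (hr' hy).2.2.1).weaken
      ((le_max_right _ _).trans (le_max_left _ _))
  · refine (hr' hy).2.2.2.2.1.le.trans ?_
    push_cast
    exact (le_max_left _ _).trans (le_max_right _ _)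
  · refine (hr' hy).2.2.2.2.2.le.trans ?_
    push_cast
    exact (le_max_right _ _).trans (le_max_right _ _)

/-- The curve `φ t + t K(φ t) h` solves the equation of the ray in direction `u + h` up to a defect
of order `‖h‖ ^ 2`: its derivative contains `t DK(K u) h`, while the expansion of `K` at the
displaced point contains `t DK(K h) u`, and integrability `hF` identifies the two. Grönwall compares
it with `ψ`; at time one this says that `u ↦ φ_u(1)` has derivative `K`. -/
lemma norm_ray_variation_le {K : E → V →L[ℝ] E} {x₀ : E} {r C : ℝ≥0}
    (hL : LipschitzOnWith C K (closedBall x₀ r))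
    (hL' : LipschitzOnWith C (fderiv ℝ K) (closedBall x₀ r))
    (hC : ∀ y ∈ closedBall x₀ r, DifferentiableAt ℝ K y ∧ ‖K y‖ ≤ C ∧ ‖fderiv ℝ K y‖ ≤ C)
    (hF : ∀ y ∈ closedBall x₀ r, ∀ a b, fderiv ℝ K y (K y a) b = fderiv ℝ K y (K y b) a)
    {R : ℝ} (hR : C * R ≤ r / 4) {u h : V} (hu : ‖u‖ < R) (huh : ‖u + h‖ < R)
    {φ ψ : ℝ → E} (h0 : φ 0 = ψ 0)
    (hφ : ∀ t ∈ Icc (0 : ℝ) 1, HasDerivWithinAt φ (K (φ t) u) (Icc 0 1) t ∧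
      φ t ∈ closedBall x₀ (r / 2))
    (hψ : ∀ t ∈ Icc (0 : ℝ) 1, HasDerivWithinAt ψ (K (ψ t) (u + h)) (Icc 0 1) t ∧
      ψ t ∈ closedBall x₀ (r / 2)) :
    ‖ψ 1 - φ 1 - K (φ 1) h‖ ≤
      (C * C ^ 2 * R + C * C) * gronwallBound 0 (C * R) 1 1 * ‖h‖ ^ 2 := by
  have hR0 : 0 ≤ R := (norm_nonneg u).trans hu.le
  have hC0 : (0 : ℝ) ≤ C := C.2
  have hhR : ‖h‖ ≤ 2 * R := by
    calc ‖h‖ = ‖(u + h) - u‖ := by simp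
      _ ≤ ‖u + h‖ + ‖u‖ := norm_sub_le _ _
      _ ≤ 2 * R := by linarith
  have hr0 : (0 : ℝ) ≤ r := r.2
  have hsub : closedBall x₀ ((r : ℝ) / 2) ⊆ closedBall x₀ r :=
    closedBall_subset_closedBall (by linarith)
  have hφr : ∀ t ∈ Icc (0 : ℝ) 1, φ t ∈ closedBall x₀ r := fun t ht => hsub (hφ t ht).2
  have hw : ∀ t ∈ Icc (0 : ℝ) 1, ‖t • K (φ t) h‖ ≤ C * ‖h‖ := fun t ht => by
    rw [norm_smul, Real.norm_of_nonneg ht.1]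
    calc t * ‖K (φ t) h‖ ≤ 1 * (‖K (φ t)‖ * ‖h‖) := by
          gcongr
          exacts [ht.2, (K (φ t)).le_opNorm h]
      _ ≤ C * ‖h‖ := by
          rw [one_mul]
          gcongr
          exact (hC _ (hφr t ht)).2.1
  -- The ray stays within `r / 2` and the displacement is at most `C * (2 * R) ≤ r / 2`; this is why
  -- `C * R ≤ r / 4` is required.
  have hφw : ∀ t ∈ Icc (0 : ℝ) 1, φ t + t • K (φ t) h ∈ closedBall x₀ r := fun t ht => by
    have h₁ := (hφ t ht).2
    rw [mem_closedBall, dist_eq_norm] at h₁ ⊢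
    calc ‖φ t + t • K (φ t) h - x₀‖ = ‖(φ t - x₀) + t • K (φ t) h‖ := by congr 1; abel
      _ ≤ ‖φ t - x₀‖ + ‖t • K (φ t) h‖ := norm_add_le _ _
      _ ≤ r / 2 + C * (2 * R) := by
        gcongr
        exact (hw t ht).trans (by gcongr)
      _ ≤ r := by linarith
  have hderiv : ∀ t ∈ Icc (0 : ℝ) 1, HasDerivWithinAt (fun t => φ t + t • K (φ t) h)
      (K (φ t) u + (K (φ t) h + t • fderiv ℝ K (φ t) (K (φ t) u) h)) (Icc 0 1) t := by
    intro t ht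
    have h₁ : HasDerivWithinAt (fun t => K (φ t)) (fderiv ℝ K (φ t) (K (φ t) u)) (Icc 0 1) t :=
      (hC _ (hφr t ht)).1.hasFDerivAt.comp_hasDerivWithinAt t (hφ t ht).1
    have h₂ : HasDerivWithinAt (fun t => K (φ t) h) (fderiv ℝ K (φ t) (K (φ t) u) h)
        (Icc 0 1) t :=
      (ContinuousLinearMap.apply ℝ E h).hasFDerivAt.comp_hasDerivWithinAt t h₁
    convert! (hφ t ht).1.add ((hasDerivWithinAt_id t _).smul h₂) using 1
    simp [add_comm]
  have hIci : ∀ {f : ℝ → E} {f' : E} {t : ℝ}, t ∈ Ico (0 : ℝ) 1 →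
      HasDerivWithinAt f f' (Icc 0 1) t → HasDerivWithinAt f f' (Ici t) t := by
    intro f f' t ht hf
    exact (hf.mono (Icc_subset_Icc_left ht.1)).mono_of_mem_nhdsWithin (Icc_mem_nhdsGE ht.2)
  have key := dist_le_of_approx_trajectories_ODE_of_mem (K := C * R.toNNReal) (a := 0) (b := 1)
    (v := fun _ y => K y (u + h)) (s := fun _ => closedBall x₀ (r : ℝ)) (f := ψ)
    (f' := fun t => K (ψ t) (u + h))
    (g := fun t => φ t + t • K (φ t) h) (εf := 0) (εg := (C * C ^ 2 * R + C * C) * ‖h‖ ^ 2) (δ := 0)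
    (fun t _ => LipschitzOnWith.of_dist_le_mul fun y hy z hz => ?_)
    (fun t ht => (hψ t ht).1.continuousWithinAt)
    (fun t ht => hIci ht (hψ t (Ico_subset_Icc_self ht)).1)
    (fun t _ => by simp) (fun t ht => hsub (hψ t (Ico_subset_Icc_self ht)).2)
    (fun t ht => (hderiv t ht).continuousWithinAt)
    (fun t ht => hIci ht (hderiv t (Ico_subset_Icc_self ht))) (fun t ht => ?_)
    (fun t ht => hφw t (Ico_subset_Icc_self ht)) (by simp [h0]) 1 (by simp)
  · rw [dist_eq_norm, zero_add, sub_zero, gronwallBound_zero_mul, one_smul] at key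
    push_cast at key
    rw [Real.coe_toNNReal _ hR0] at key
    calc ‖ψ 1 - φ 1 - K (φ 1) h‖ = ‖ψ 1 - (φ 1 + K (φ 1) h)‖ := by rw [sub_sub]
      _ ≤ _ := key
      _ = _ := by ring
  · rw [dist_eq_norm, dist_eq_norm, ← sub_apply]
    refine ((K y - K z).le_opNorm _).trans ?_
    have := hL.norm_sub_le hy hz
    push_cast
    rw [Real.coe_toNNReal _ hR0]
    calc ‖K y - K z‖ * ‖u + h‖ ≤ C * ‖y - z‖ * R := by gcongr
      _ = _ := by ring
  · have ht' := Ico_subset_Icc_self ht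
    have hy := hφr t ht'
    set w := t • K (φ t) h with hwdef
    -- The use of the integrability condition: the first-order terms in `h` cancel, leaving a Taylor
    -- remainder, of order `‖w‖ ^ 2`, and `DK(w) h`.
    have hFw : t • fderiv ℝ K (φ t) (K (φ t) u) h = fderiv ℝ K (φ t) w u := by
      rw [hF _ hy, hwdef, map_smul, smul_apply]
    have hT := norm_sub_sub_fderiv_le (convex_closedBall x₀ (r : ℝ)) (fun y hy => (hC y hy).1) hL'
      hy (hφw t ht')
    have hww := hw t ht'
    rw [dist_eq_norm, hFw]
    have heq : K (φ t) u + (K (φ t) h + fderiv ℝ K (φ t) w u) - K (φ t + w) (u + h)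
        = -((K (φ t + w) - K (φ t) - fderiv ℝ K (φ t) w) (u + h)) - fderiv ℝ K (φ t) w h := by
      simp only [sub_apply, map_add]
      abel
    rw [heq]
    calc _ ≤ ‖(K (φ t + w) - K (φ t) - fderiv ℝ K (φ t) w) (u + h)‖ + ‖fderiv ℝ K (φ t) w h‖ := by
          refine (norm_sub_le _ _).trans ?_
          rw [norm_neg]
      _ ≤ C * ‖w‖ * ‖w‖ * R + C * ‖w‖ * ‖h‖ := by
          gcongr
          · exact (ContinuousLinearMap.le_opNorm _ _).trans (by gcongr)
          · refine (ContinuousLinearMap.le_opNorm _ _).trans ?_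
            gcongr
            refine (ContinuousLinearMap.le_opNorm _ _).trans ?_
            gcongr
            exact (hC _ hy).2.2
      _ ≤ C * (C * ‖h‖) * (C * ‖h‖) * R + C * (C * ‖h‖) * ‖h‖ := by gcongr
      _ = _ := by ring

/-- The Frobenius theorem: the total differential equation `dF = K(F)` is solvable near the origin
with arbitrary initial value, if the integrability condition holds. -/
theorem exists_totalSolution [CompleteSpace E] {K : E → V →L[ℝ] E} {Ω : Set E} (hΩ : IsOpen Ω)
    (hK : ContDiffOn ℝ ∞ K Ω)
    (hF : ∀ y ∈ Ω, ∀ a b, fderiv ℝ K y (K y a) b = fderiv ℝ K y (K y b) a) {x₀ : E}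
    (hx₀ : x₀ ∈ Ω) :
    ∃ R > 0, ∃ F : V → E, F 0 = x₀ ∧ ∀ u ∈ ball (0 : V) R,
      F u ∈ Ω ∧ HasFDerivAt F (K (F u)) u := by
  obtain ⟨r, C, hr, hrΩ, hL, hL', hC⟩ :=
    exists_uniform_bound (hK.contDiffAt (hΩ.mem_nhds hx₀)) (hΩ.mem_nhds hx₀)
  have hr' : (0 : ℝ) < r := hr
  have hC0 : (0 : ℝ) ≤ C := C.2
  have hC1 : (0 : ℝ) < C + 1 := by linarith
  -- The denominator is `C + 1` rather than `C` because `C` may vanish.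
  set R : ℝ := r / 4 / (C + 1) with hRdef
  have hR0 : 0 < R := by positivity
  have hR : C * R ≤ r / 4 := by
    have : (C + 1) * R = r / 4 := by rw [hRdef]; field_simp
    nlinarith
  have hsub : closedBall x₀ ((r / 2 : ℝ≥0) : ℝ) ⊆ closedBall x₀ r :=
    closedBall_subset_closedBall (by push_cast; linarith)
  have hex : ∀ u : V, ∃ φ : ℝ → E, φ 0 = x₀ ∧ (‖u‖ < R → ∀ t ∈ Icc (0 : ℝ) 1,
      HasDerivWithinAt φ (K (φ t) u) (Icc 0 1) t ∧ φ t ∈ closedBall x₀ ((r : ℝ) / 2)) := by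
    intro u
    by_cases hu : ‖u‖ < R
    · obtain ⟨φ, h0, h⟩ := exists_ray_solution (a := r / 2) (hL.mono hsub)
        (fun y hy => (hC y (hsub hy)).2.1) (u := u) (by
          push_cast
          nlinarith)
      exact ⟨φ, h0, fun _ t ht => by simpa using h t ht⟩
    · exact ⟨fun _ => x₀, rfl, fun h => (hu h).elim⟩
  choose φ h0 hφ using hex
  -- The solution is `F u = φ_u(1)`, the endpoint of the ray in direction `u`.
  have hmain : ∀ u ∈ ball (0 : V) R, HasFDerivAt (fun u => φ u 1) (K (φ u 1)) u := by
    intro u hu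
    rw [mem_ball_zero_iff] at hu
    rw [hasFDerivAt_iff_isLittleO_nhds_zero]
    refine Asymptotics.IsBigO.trans_isLittleO (g := fun h : V => ‖h‖ ^ 2) ?_
      (Asymptotics.isLittleO_norm_pow_id one_lt_two)
    refine Asymptotics.IsBigO.of_bound
      ((C * C ^ 2 * R + C * C) * gronwallBound 0 (C * R) 1 1) ?_
    have hnear : ∀ᶠ h in 𝓝 (0 : V), ‖u + h‖ < R := by
      refine ContinuousAt.eventually_lt (by fun_prop) (by fun_prop) (by simpa using hu)
    filter_upwards [hnear] with h hh
    rw [Real.norm_of_nonneg (by positivity : 0 ≤ ‖h‖ ^ 2)]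
    exact norm_ray_variation_le hL hL' hC (fun y hy => hF y (hrΩ hy)) hR hu hh
      ((h0 _).trans (h0 _).symm) (hφ u hu) (hφ (u + h) hh)
  refine ⟨R, hR0, fun u => φ u 1, ?_, fun u hu => ⟨?_, hmain u hu⟩⟩
  · have h := hφ 0 (by simpa using hR0)
    -- The ray in direction zero has zero derivative, hence is constant.
    have := (convex_Icc (0 : ℝ) 1).is_const_of_fderivWithin_eq_zero (𝕜 := ℝ) (f := φ 0)
      (fun t ht => (h t ht).1.differentiableWithinAt) (fun t ht => ?_)
      (x := 1) (y := 0) (by simp) (by simp)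
    · exact this.trans (h0 0)
    · ext
      rw [fderivWithin_derivWithin,
        (h t ht).1.derivWithin (uniqueDiffOn_Icc zero_lt_one t ht)]
      simp
  · exact hrΩ (closedBall_subset_closedBall (by linarith)
      (hφ u (mem_ball_zero_iff.1 hu) 1 (by simp)).2)

/-- Solutions of a smooth total differential equation are smooth. -/
lemma contDiffOn_of_hasFDerivAt_comp {K : E → V →L[ℝ] E} {Ω : Set E} (hK : ContDiffOn ℝ ∞ K Ω)
    {U : Set V} (hU : IsOpen U) {F : V → E} (hF : ∀ u ∈ U, F u ∈ Ω ∧ HasFDerivAt F (K (F u)) u) :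
    ContDiffOn ℝ ∞ F U := by
  rw [contDiffOn_infty]
  intro m
  induction m with
  | zero => exact contDiffOn_zero.2 fun u hu => (hF u hu).2.continuousAt.continuousWithinAt
  | succ m ih =>
    have : ((m + 1 : ℕ) : WithTop ℕ∞) = m + 1 := by norm_cast
    rw [this, contDiffOn_succ_iff_fderiv_of_isOpen hU]
    refine ⟨fun u hu => (hF u hu).2.differentiableAt.differentiableWithinAt,
      fun h => by simp at h, ?_⟩
    -- Bootstrapping: the derivative is `K ∘ F`, of the regularity already established for `F`.
    refine ((hK.of_le (by exact_mod_cast le_top)).comp ih fun u hu => (hF u hu).1).congr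
      fun u hu => (hF u hu).2.fderiv

/-- The derivative of `pr ∘ F` is `pr ∘ K(F)`, the identity. Thus `pr` inverts a solution and
provides coordinates on its image. -/
lemma proj_totalSolution {K : E → V →L[ℝ] E} {Ω : Set E} {pr : E →L[ℝ] V}
    (hp : ∀ y ∈ Ω, ∀ a, pr (K y a) = a) {R : ℝ} {F : V → E}
    (hF : ∀ u ∈ ball (0 : V) R, F u ∈ Ω ∧ HasFDerivAt F (K (F u)) u) :
    ∀ u ∈ ball (0 : V) R, pr (F u - F 0) = u := by
  intro u hu
  have hd : ∀ u ∈ ball (0 : V) R, HasFDerivAt (fun u => pr (F u - F 0) - u) (0 : V →L[ℝ] V) u := by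
    intro u hu
    have := (pr.hasFDerivAt.comp u ((hF u hu).2.sub_const (F 0))).sub (hasFDerivAt_id u)
    convert! this using 1
    ext a
    simp [hp _ (hF u hu).1]
  have := isOpen_ball.is_const_of_fderiv_eq_zero (𝕜 := ℝ) (convex_ball (0 : V) R).isPreconnected
    (fun u hu => (hd u hu).differentiableAt.differentiableWithinAt)
    (fun u hu => (hd u hu).fderiv) hu
    (mem_ball_self (pos_of_mem_ball hu))
  simpa [sub_eq_zero] using this

/-- Uniqueness for total differential equations: a map tangent to the image of `K` locally factors
through a solution. -/
lemma eventually_eq_totalSolution {K : E → V →L[ℝ] E} {Ω : Set E} (hΩ : IsOpen Ω)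
    (hK : ContDiffOn ℝ ∞ K Ω) {pr : E →L[ℝ] V} {R : ℝ} {F : V → E}
    (hF : ∀ u ∈ ball (0 : V) R, F u ∈ Ω ∧ HasFDerivAt F (K (F u)) u)
    (hpF : ∀ u ∈ ball (0 : V) R, pr (F u - F 0) = u)
    {W : Type*} [NormedAddCommGroup W] [NormedSpace ℝ W] {f : W → E} {w₀ : W}
    (hf : ContDiffAt ℝ 1 f w₀)
    (hfK : ∀ᶠ w in 𝓝 w₀, ∀ h, fderiv ℝ f w h = K (f w) (pr (fderiv ℝ f w h)))
    {u₀ : V} (hu₀ : u₀ ∈ ball (0 : V) R) (h₀ : f w₀ = F u₀) :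
    ∀ᶠ w in 𝓝 w₀, pr (f w - F 0) ∈ ball (0 : V) R ∧ f w = F (pr (f w - F 0)) := by
  set g : W → V := fun w => pr (f w - F 0) with hg
  have hg₀ : g w₀ = u₀ := by rw [hg]; simp only [h₀, hpF u₀ hu₀]
  have hy₀ : f w₀ ∈ Ω := h₀ ▸ (hF u₀ hu₀).1
  obtain ⟨L, s, hs, hL⟩ := ((hK.contDiffAt (hΩ.mem_nhds hy₀)).of_le
    (m := 1) (by simp)).exists_lipschitzOnWith
  have hgc : ContinuousAt g w₀ := by
    have := hf.continuousAt
    fun_prop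
  have hFc : ContinuousAt (F ∘ g) w₀ :=
    ContinuousAt.comp (by rw [hg₀]; exact (hF u₀ hu₀).2.continuousAt) hgc
  have h₁ : ∀ᶠ w in 𝓝 w₀, f w ∈ s := hf.continuousAt hs
  have h₂ : ∀ᶠ w in 𝓝 w₀, F (g w) ∈ s := hFc (by rwa [Function.comp, hg₀, ← h₀])
  have h₃ : ∀ᶠ w in 𝓝 w₀, g w ∈ ball (0 : V) R := hgc (by rw [hg₀]; exact isOpen_ball.mem_nhds hu₀)
  have h₄ : ∀ᶠ w in 𝓝 w₀, DifferentiableAt ℝ f w :=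
    (hf.eventually (by simp)).mono fun w hw => hw.differentiableAt (by simp)
  have h₅ : ∀ᶠ w in 𝓝 w₀, ‖fderiv ℝ f w‖ < ‖fderiv ℝ f w₀‖ + 1 :=
    (hf.fderiv_right (m := 0) (by simp)).continuousAt.norm.eventually (gt_mem_nhds (by linarith))
  obtain ⟨ρ, hρ, hρ'⟩ := Metric.nhds_basis_ball.mem_iff.1
    (h₁.and (h₂.and (h₃.and (h₄.and (h₅.and hfK)))))
  filter_upwards [ball_mem_nhds w₀ hρ] with w hw
  refine ⟨(hρ' hw).2.2.1, ?_⟩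
  -- Along the segment from `w₀` to `w`, both `f` and `F ∘ g` solve `y' = K(y) c(t)` with the same
  -- initial value, so uniqueness for ordinary differential equations applies.
  set ℓ : ℝ → W := fun t => w₀ + t • (w - w₀) with hℓ
  have hℓmem : ∀ t ∈ Icc (0 : ℝ) 1, ℓ t ∈ ball w₀ ρ := fun t ht =>
    (convex_ball w₀ ρ).add_smul_sub_mem (mem_ball_self hρ) hw ht
  have hℓd : ∀ t, HasDerivAt ℓ (w - w₀) t := fun t => by
    exact (one_smul ℝ (w - w₀)) ▸ ((hasDerivAt_id t).smul_const (w - w₀)).const_add w₀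
  set c : ℝ → V := fun t => pr (fderiv ℝ f (ℓ t) (w - w₀)) with hc
  have hcb : ∀ t ∈ Icc (0 : ℝ) 1, ‖c t‖ ≤ ‖pr‖ * ((‖fderiv ℝ f w₀‖ + 1) * ‖w - w₀‖) := by
    intro t ht
    refine (pr.le_opNorm _).trans ?_
    gcongr
    refine (ContinuousLinearMap.le_opNorm _ _).trans ?_
    gcongr
    exact (hρ' (hℓmem t ht)).2.2.2.2.1.le
  have hfd : ∀ t ∈ Icc (0 : ℝ) 1, HasDerivAt (f ∘ ℓ) (K (f (ℓ t)) (c t)) t := by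
    intro t ht
    have h := hρ' (hℓmem t ht)
    have := h.2.2.2.1.hasFDerivAt.comp_hasDerivAt t (hℓd t)
    rwa [h.2.2.2.2.2] at this
  have hgd : ∀ t ∈ Icc (0 : ℝ) 1, HasDerivAt (g ∘ ℓ) (c t) t := by
    intro t ht
    have h := hρ' (hℓmem t ht)
    exact pr.hasFDerivAt.comp_hasDerivAt t
      ((h.2.2.2.1.hasFDerivAt.comp_hasDerivAt t (hℓd t)).sub_const (F 0))
  have hFd : ∀ t ∈ Icc (0 : ℝ) 1, HasDerivAt (F ∘ (g ∘ ℓ)) (K (F (g (ℓ t))) (c t)) t := by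
    intro t ht
    have h := hρ' (hℓmem t ht)
    exact (hF _ h.2.2.1).2.comp_hasDerivAt t (hgd t ht)
  have key := ODE_solution_unique_of_mem_Icc_right
    (K := L * (‖pr‖ * ((‖fderiv ℝ f w₀‖ + 1) * ‖w - w₀‖)).toNNReal) (a := 0) (b := 1)
    (v := fun t y => K y (c t)) (s := fun _ => s) (f := f ∘ ℓ) (g := F ∘ (g ∘ ℓ))
    (fun t ht => LipschitzOnWith.of_dist_le_mul fun y hy z hz => by
      rw [dist_eq_norm, dist_eq_norm, ← sub_apply]
      refine ((K y - K z).le_opNorm _).trans ?_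
      have := hL.norm_sub_le hy hz
      push_cast
      rw [Real.coe_toNNReal _ (by positivity)]
      calc ‖K y - K z‖ * ‖c t‖ ≤ L * ‖y - z‖ * (‖pr‖ * ((‖fderiv ℝ f w₀‖ + 1) * ‖w - w₀‖)) := by
            gcongr
            exact hcb t (Ico_subset_Icc_self ht)
        _ = _ := by ring)
    (fun t ht => (hfd t ht).continuousAt.continuousWithinAt)
    (fun t ht => (hfd t (Ico_subset_Icc_self ht)).hasDerivWithinAt)
    (fun t ht => (hρ' (hℓmem t (Ico_subset_Icc_self ht))).1)
    (fun t ht => (hFd t ht).continuousAt.continuousWithinAt)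
    (fun t ht => (hFd t (Ico_subset_Icc_self ht)).hasDerivWithinAt)
    (fun t ht => (hρ' (hℓmem t (Ico_subset_Icc_self ht))).2.1)
    (by simp [hℓ, hg₀, h₀]) (show (1 : ℝ) ∈ Icc (0 : ℝ) 1 by simp)
  have hℓ₁ : ℓ 1 = w := by simp [hℓ]
  rw [Function.comp_apply, Function.comp_apply, Function.comp_apply, hℓ₁] at key
  exact key

end Frobenius

/-! ### Adapted frames of a real distribution -/

section AdaptedFrame

variable {n k : ℕ} {M : Type*} [TopologicalSpace M]
  [ChartedSpace (EuclideanSpace ℝ (Fin (2 * n))) M] [IsManifold (𝓡 (2 * n)) ∞ M]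

/-- A description of a distribution near `p` in the preferred chart at `p`, as the image of a
family `lift y` of right inverses of a fixed projection `proj`. -/
structure AdaptedFrame (I : RealDistribution n M k) (p : M) where
  /-- The domain, in the chart at `p`. -/
  dom : Set (Coord n)
  isOpen_dom : IsOpen dom
  mem_dom : chart n p p ∈ dom
  dom_subset : dom ⊆ (chart n p).target
  /-- The projection. -/
  proj : Coord n →L[ℝ] EuclideanSpace ℝ (Fin k)
  /-- The parametrizations of the spaces of the distribution. -/
  lift : Coord n → EuclideanSpace ℝ (Fin k) →L[ℝ] Coord n
  contDiffOn_lift : ContDiffOn ℝ ∞ lift dom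
  proj_lift (y : Coord n) (hy : y ∈ dom) (a : EuclideanSpace ℝ (Fin k)) : proj (lift y a) = a
  mem_iff (x : M) (hx : x ∈ (chart n p).source) (hy : chart n p x ∈ dom)
    (v : TangentSpace (𝓡 (2 * n)) x) :
    v ∈ I.space x ↔ lift (chart n p x) (proj (toCoord p x v)) = toCoord p x v

variable {I : RealDistribution n M k} {p : M}

/-- A local frame gives injective parametrizations `P y`. Composing a fixed left inverse of `P y₀`
with `P y` gives an endomorphism `A y`, invertible near `y₀`; then `P y ∘ (A y)⁻¹` has the same
image as `P y` and is a right inverse of the fixed projection. -/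
lemma exists_adaptedFrame (I : RealDistribution n M k) (p : M) : Nonempty (AdaptedFrame I p) := by
  obtain ⟨U, hU, e, he⟩ := I.exists_frame p
  let P : Coord n → EuclideanSpace ℝ (Fin k) →L[ℝ] Coord n := fun y =>
    ∑ i, (EuclideanSpace.proj i : EuclideanSpace ℝ (Fin k) →L[ℝ] ℝ).smulRight (fieldRep p (e i) y)
  have hP : ∀ y c, P y c = ∑ i, c i • fieldRep p (e i) y := fun y c => by
    simp [P]
  have hPx : ∀ x ∈ (chart n p).source, ∀ c, P (chart n p x) c = toCoord p x (∑ i, c i • e i x) := by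
    intro x hx c
    rw [hP, map_sum]
    exact Finset.sum_congr rfl fun i _ => by rw [fieldRep_chart hx, map_smul]
  set Ω₀ : Set (Coord n) := (chart n p).target ∩ (chart n p).symm ⁻¹' (interior U) with hΩ₀
  have hΩ₀o : IsOpen Ω₀ :=
    (continuousOn_extChartAt_symm p).isOpen_inter_preimage (isOpen_extChartAt_target p)
      isOpen_interior
  have hPs : ContDiffOn ℝ ∞ P Ω₀ := by
    refine ContDiffOn.sum fun i _ => ?_
    refine (ContinuousLinearMap.smulRightL ℝ (EuclideanSpace ℝ (Fin k)) (Coord n)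
      (EuclideanSpace.proj i)).contDiff.comp_contDiffOn ?_
    intro y hy
    have hx := (chart n p).map_target hy.1
    have := (smoothFieldAt_iff hx).1 ((he _ (interior_subset hy.2)).1 i)
    rw [(chart n p).right_inv hy.1] at this
    exact this.contDiffWithinAt
  set y₀ := chart n p p with hy₀
  have hp : p ∈ (chart n p).source := mem_extChartAt_source p
  have hy₀Ω : y₀ ∈ Ω₀ := by
    refine ⟨(chart n p).map_source hp, ?_⟩
    rw [mem_preimage, (chart n p).left_inv hp]
    exact mem_interior_iff_mem_nhds.2 hU
  have hinj : LinearMap.ker (P y₀).toLinearMap = ⊥ := by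
    rw [LinearMap.ker_eq_bot']
    intro c hc
    have h₁ : toCoord p p (∑ i, c i • e i p) = 0 := (hPx p hp c).symm.trans hc
    have h₂ := toCoord_injective hp (h₁.trans (map_zero _).symm)
    ext i
    exact Fintype.linearIndependent_iff.1 (he p (mem_of_mem_nhds hU)).2.1 _ h₂ i
  obtain ⟨q, hq⟩ := LinearMap.exists_leftInverse_of_injective _ hinj
  let pr : Coord n →L[ℝ] EuclideanSpace ℝ (Fin k) := LinearMap.toContinuousLinearMap q
  let A : Coord n → EuclideanSpace ℝ (Fin k) →L[ℝ] EuclideanSpace ℝ (Fin k) :=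
    fun y => pr ∘L P y
  have hA₀ : A y₀ = 1 := by
    ext1 c
    exact LinearMap.congr_fun hq c
  have hAs : ContDiffOn ℝ ∞ A Ω₀ := contDiffOn_const.clm_comp hPs
  have hdom : IsOpen (Ω₀ ∩ A ⁻¹' {a | IsUnit a}) :=
    hAs.continuousOn.isOpen_inter_preimage hΩ₀o Units.isOpen
  have hinv : ∀ y, IsUnit (A y) → ∀ c, Ring.inverse (A y) (A y c) = c := fun y hy c => by
    have := congrArg (fun f => f c) (Ring.inverse_mul_cancel (A y) hy)
    exact this
  have hinv' : ∀ y, IsUnit (A y) → ∀ c, A y (Ring.inverse (A y) c) = c := fun y hy c => by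
    have := congrArg (fun f => f c) (Ring.mul_inverse_cancel (A y) hy)
    exact this
  refine ⟨⟨Ω₀ ∩ A ⁻¹' {a | IsUnit a}, hdom, ⟨hy₀Ω, ?_⟩, fun y hy => hy.1.1, pr,
    fun y => P y ∘L Ring.inverse (A y), ?_, fun y hy a => hinv' y hy.2 a, ?_⟩⟩
  · change IsUnit (A y₀)
    rw [hA₀]
    exact isUnit_one
  · refine (hPs.mono inter_subset_left).clm_comp ?_
    intro y hy
    obtain ⟨a, ha⟩ := hy.2
    have h₁ : ContDiffAt ℝ ∞ Ring.inverse (A y) := ha ▸ contDiffAt_ringInverse ℝ a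
    exact h₁.comp_contDiffWithinAt y ((hAs y hy.1).mono inter_subset_left)
  · intro x hx hy v
    have hxU : x ∈ U := by
      have := hy.1.2
      rw [mem_preimage, (chart n p).left_inv hx] at this
      exact interior_subset this
    rw [← (he x hxU).2.2, Submodule.mem_span_range_iff_exists_fun]
    constructor
    · rintro ⟨c, rfl⟩
      have := hPx x hx (WithLp.toLp 2 c)
      simp only at this
      rw [← this]
      exact congrArg (P _) (hinv _ hy.2 _)
    · intro h
      refine ⟨Ring.inverse (A (chart n p x)) (pr (toCoord p x v)), toCoord_injective hx ?_⟩
      rw [← hPx x hx]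
      exact h

namespace AdaptedFrame

variable (A : AdaptedFrame I p)

lemma contDiffAt_lift {y : Coord n} (hy : y ∈ A.dom) : ContDiffAt ℝ ∞ A.lift y :=
  A.contDiffOn_lift.contDiffAt (A.isOpen_dom.mem_nhds hy)

lemma hasFDerivAt_lift {y : Coord n} (hy : y ∈ A.dom) :
    HasFDerivAt A.lift (fderiv ℝ A.lift y) y :=
  ((A.contDiffAt_lift hy).differentiableAt (by simp)).hasFDerivAt

/-- Differentiation of `proj (lift y b) = b`. -/
lemma proj_fderiv_lift {y : Coord n} (hy : y ∈ A.dom) (v : Coord n)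
    (b : EuclideanSpace ℝ (Fin k)) : A.proj (fderiv ℝ A.lift y v b) = 0 := by
  have h₁ : HasFDerivAt (fun y => A.proj (A.lift y b))
      (A.proj ∘L (ContinuousLinearMap.apply ℝ _ b) ∘L fderiv ℝ A.lift y) y :=
    A.proj.hasFDerivAt.comp y
      ((ContinuousLinearMap.apply ℝ (Coord n) b).hasFDerivAt.comp y (A.hasFDerivAt_lift hy))
  have h₂ : HasFDerivAt (fun y => A.proj (A.lift y b))
      (0 : Coord n →L[ℝ] EuclideanSpace ℝ (Fin k)) y := by
    refine (hasFDerivAt_const b y).congr_of_eventuallyEq ?_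
    filter_upwards [A.isOpen_dom.mem_nhds hy] with z hz using A.proj_lift z hz b
  exact congrArg (fun f => f v) (h₁.unique h₂)

lemma mem_space_iff {x : M} (hx : x ∈ (chart n p).source) (hy : chart n p x ∈ A.dom)
    (v : TangentSpace (𝓡 (2 * n)) x) :
    v ∈ I.space x ↔ ∃ a, toCoord p x v = A.lift (chart n p x) a := by
  rw [A.mem_iff x hx hy]
  constructor
  · exact fun h => ⟨_, h.symm⟩
  · rintro ⟨a, ha⟩
    rw [ha, A.proj_lift _ hy]

lemma fromCoord_lift_mem {x : M} (hx : x ∈ (chart n p).source) (hy : chart n p x ∈ A.dom)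
    (a : EuclideanSpace ℝ (Fin k)) : fromCoord p x (A.lift (chart n p x) a) ∈ I.space x :=
  (A.mem_space_iff hx hy _).2 ⟨a, toCoord_fromCoord hx _⟩

/-- The component of `∇_{K a} (K b)` transverse to the distribution, where `K` is the
parametrization of the distribution. -/
noncomputable def secondForm (D : AffineConnection n M) (y : Coord n)
    (a b : EuclideanSpace ℝ (Fin k)) : Coord n :=
  fderiv ℝ A.lift y (A.lift y a) b + (christoffel D p y (A.lift y b) (A.lift y a)
    - A.lift y (A.proj (christoffel D p y (A.lift y b) (A.lift y a))))

/-- Vector fields given by constant components in an adapted frame, cut off to a global section. -/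
lemma exists_section_lift [T2Space M] {x : M} (hx : x ∈ (chart n p).source)
    (hy : chart n p x ∈ A.dom) (b : EuclideanSpace ℝ (Fin k)) :
    ∃ Y : RealField n M, (∀ z, SmoothFieldAt Y z) ∧ (∀ z, Y z ∈ I.space z) ∧
      fieldRep p Y =ᶠ[𝓝 (chart n p x)] fun y => A.lift y b := by
  set s : Set M := (chart n p).source ∩ chart n p ⁻¹' A.dom with hs
  have hso : IsOpen s := (continuousOn_extChartAt p).isOpen_inter_preimage
    (isOpen_extChartAt_source p) A.isOpen_dom
  have hsx : s ∈ 𝓝 x := hso.mem_nhds ⟨hx, hy⟩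
  set X : RealField n M := repField p fun y => A.lift y b with hX
  have hXs : ∀ z ∈ s, SmoothFieldAt X z := fun z hz =>
    smoothFieldAt_repField hz.1 ((A.contDiffAt_lift hz.2).clm_apply contDiffAt_const)
  obtain ⟨χ, hχ, hχ1, hχ0⟩ := exists_cutoff hsx hXs
  refine ⟨fun z => χ z • X z, hχ, fun z => ?_, ?_⟩
  · by_cases hz : z ∈ s
    · exact Submodule.smul_mem _ _ (A.fromCoord_lift_mem hz.1 hz.2 b)
    · change χ z • X z ∈ I.space z
      rw [hχ0 z hz, zero_smul]
      exact Submodule.zero_mem _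
  · have hyt := (chart n p).map_source hx
    have ht := tendsto_chart_symm hyt
    rw [(chart n p).left_inv hx] at ht
    filter_upwards [ht hχ1, target_mem_nhds hyt] with y h₁ h₂
    have h₁' : χ ((chart n p).symm y) = 1 := h₁
    have : fieldRep p (fun z => χ z • X z) y = χ ((chart n p).symm y) • fieldRep p X y := by
      simp only [fieldRep, map_smul]
    rw [this, h₁', one_smul, hX, fieldRep_repField h₂]

/-- The parallel condition is applied to global sections that agree near the point with `K a` and `K
b`. The transverse part of the covariant derivative is the second form, because `DK` already takes
values in the kernel of `proj`. -/
lemma secondForm_eq_zero [T2Space M] {D : AffineConnection n M} (h : I.IsParallelAlong D)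
    {y : Coord n} (hy : y ∈ A.dom) (a b : EuclideanSpace ℝ (Fin k)) : A.secondForm D y a b = 0 := by
  obtain ⟨x, hx, rfl⟩ : ∃ x ∈ (chart n p).source, chart n p x = y :=
    ⟨_, (chart n p).map_target (A.dom_subset hy), (chart n p).right_inv (A.dom_subset hy)⟩
  obtain ⟨X, hXs, hXt, hX⟩ := A.exists_section_lift hx hy a
  obtain ⟨Y, hYs, hYt, hY⟩ := A.exists_section_lift hx hy b
  have hXx : toCoord p x (X x) = A.lift (chart n p x) a := by
    rw [← fieldRep_chart hx, hX.self_of_nhds]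
  have hYx : toCoord p x (Y x) = A.lift (chart n p x) b := by
    rw [← fieldRep_chart hx, hY.self_of_nhds]
  have hfd : fderiv ℝ (fieldRep p Y) (chart n p x) (A.lift (chart n p x) a)
      = fderiv ℝ A.lift (chart n p x) (A.lift (chart n p x) a) b := by
    have : HasFDerivAt (fun y => A.lift y b)
        ((ContinuousLinearMap.apply ℝ _ b) ∘L fderiv ℝ A.lift (chart n p x)) (chart n p x) :=
      (ContinuousLinearMap.apply ℝ (Coord n) b).hasFDerivAt.comp _ (A.hasFDerivAt_lift hy)
    rw [hY.fderiv_eq, this.fderiv]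
    rfl
  have key := (A.mem_iff x hx hy _).1 (h X Y hXs hXt hYs hYt x)
  rw [toCoord_covariantDerivative D hx (hYs x), hXx, hYx, hfd, map_add, A.proj_fderiv_lift hy,
    zero_add] at key
  rw [secondForm, key]
  abel

/-- A section has components `f = K(proj f)`. Differentiating this, the derivative of `f` is
tangential up to `DK`, which the second form combines with the transverse part of the Christoffel
term. Only the vanishing of the form at the one point `x` is needed. -/
lemma lift_proj_covariantDerivative {D : AffineConnection n M} {x : M}
    (hx : x ∈ (chart n p).source) (hy : chart n p x ∈ A.dom)
    (h : ∀ a b, A.secondForm D (chart n p x) a b = 0) {X Y : RealField n M}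
    (hX : ∀ z, X z ∈ I.space z) (hYs : SmoothFieldAt Y x) (hY : ∀ z, Y z ∈ I.space z) :
    D Y x (X x) ∈ I.space x := by
  set y := chart n p x with hydef
  set f := fieldRep p Y with hf
  obtain ⟨a, ha⟩ := (A.mem_space_iff hx hy _).1 (hX x)
  have hfK : f =ᶠ[𝓝 y] fun z => A.lift z (A.proj (f z)) := by
    filter_upwards [A.isOpen_dom.mem_nhds hy] with z hz
    have hzt := A.dom_subset hz
    have hzs := (chart n p).map_target hzt
    have := (A.mem_iff _ hzs (by rwa [(chart n p).right_inv hzt]) _).1 (hY ((chart n p).symm z))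
    rw [(chart n p).right_inv hzt] at this
    exact this.symm
  have hfd : HasFDerivAt f (fderiv ℝ f y) y :=
    (((smoothFieldAt_iff hx).1 hYs).differentiableAt (by simp)).hasFDerivAt
  have hfx : toCoord p x (Y x) = A.lift y (A.proj (f y)) := by
    rw [← fieldRep_chart hx, ← hydef, ← hf]
    exact hfK.self_of_nhds
  have hder : fderiv ℝ f y (A.lift y a) = A.lift y (A.proj (fderiv ℝ f y (A.lift y a)))
      + fderiv ℝ A.lift y (A.lift y a) (A.proj (f y)) := by
    have := (A.hasFDerivAt_lift hy).clm_apply (A.proj.hasFDerivAt.comp y hfd)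
    exact congrArg (fun g => g (A.lift y a)) (hfd.unique (this.congr_of_eventuallyEq hfK))
  refine (A.mem_space_iff hx hy _).2 ⟨A.proj (fderiv ℝ f y (A.lift y a)) +
    A.proj (christoffel D p y (A.lift y (A.proj (f y))) (A.lift y a)), ?_⟩
  have h₀ := h a (A.proj (f y))
  rw [secondForm] at h₀
  rw [toCoord_covariantDerivative D hx hYs, ha, hfx, ← hydef, ← hf, map_add, ← sub_eq_zero, ← h₀]
  nth_rewrite 1 [hder]
  abel

end AdaptedFrame

lemma RealDistribution.isParallelAlong_of_secondForm_eq_zero {D : AffineConnection n M}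
    (A : ∀ p, AdaptedFrame I p) (h : ∀ p a b, (A p).secondForm D (chart n p p) a b = 0) :
    I.IsParallelAlong D := fun _ _ _ hXt hYs hYt x =>
  (A x).lift_proj_covariantDerivative (mem_extChartAt_source x) (A x).mem_dom (h x) hXt (hYs x) hYt

/-- The Christoffel part of the second form is symmetric for a torsion-free connection, so the `DK`
part must be symmetric too. This is the integrability condition for `dF = K(F)`. -/
lemma AdaptedFrame.fderiv_lift_symm_of_secondForm_eq_zero {g : SemiRiemannianMetric n M}
    {D : AffineConnection n M} (hD : IsLeviCivita g D) (A : AdaptedFrame I p) {y : Coord n}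
    (hy : y ∈ A.dom) (h : ∀ a b, A.secondForm D y a b = 0) (a b : EuclideanSpace ℝ (Fin k)) :
    fderiv ℝ A.lift y (A.lift y a) b = fderiv ℝ A.lift y (A.lift y b) a := by
  have h₁ := h a b
  have h₂ := h b a
  have hs : christoffel D p y (A.lift y b) (A.lift y a)
      = christoffel D p y (A.lift y a) (A.lift y b) := by
    have := christoffel_symm hD ((chart n p).map_target (A.dom_subset hy)) (A.lift y b) (A.lift y a)
    rwa [(chart n p).right_inv (A.dom_subset hy)] at this
  rw [secondForm, hs] at h₁
  rw [secondForm] at h₂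
  exact add_right_cancel (h₁.trans h₂.symm)

end AdaptedFrame

/-! ### Maps tangent to a distribution -/

section Tangent

variable {n k : ℕ} {M : Type*} [TopologicalSpace M]
  [ChartedSpace (EuclideanSpace ℝ (Fin (2 * n))) M] [IsManifold (𝓡 (2 * n)) ∞ M]
  {I : RealDistribution n M k} {p : M}
  {W : Type*} [NormedAddCommGroup W] [NormedSpace ℝ W]

/-- A map from a vector space to the manifold is, near `w₀`, smooth and tangent to the
distribution. -/
def RealDistribution.IsTangentAt (I : RealDistribution n M k) (f : W → M) (w₀ : W) : Prop :=
  ∀ᶠ w in 𝓝 w₀, ContMDiffAt 𝓘(ℝ, W) (𝓡 (2 * n)) ∞ f w ∧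
    ∀ h : W, mfderiv 𝓘(ℝ, W) (𝓡 (2 * n)) f w h ∈ I.space (f w)

lemma hasFDerivAt_chart_comp {f : W → M} {w : W} (hf : ContMDiffAt 𝓘(ℝ, W) (𝓡 (2 * n)) ∞ f w)
    (hx : f w ∈ (chart n p).source) :
    HasFDerivAt (chart n p ∘ f) ((toCoord p (f w) ∘L
      (mfderiv 𝓘(ℝ, W) (𝓡 (2 * n)) f w : W →L[ℝ] TangentSpace (𝓡 (2 * n)) (f w)) :
      W →L[ℝ] Coord n)) w := by
  have h1 := ((contMDiffAt_chart hx).mdifferentiableAt (by simp)).hasMFDerivAt.comp w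
    (hf.mdifferentiableAt (by simp)).hasMFDerivAt
  rw [← toCoord_eq_mfderiv hx] at h1
  exact hasMFDerivAt_iff_hasFDerivAt.1 h1

lemma RealDistribution.IsTangentAt.eventually_chart (A : AdaptedFrame I p) {f : W → M} {w₀ : W}
    (hf : I.IsTangentAt f w₀) (hx : f w₀ ∈ (chart n p).source) (hy : chart n p (f w₀) ∈ A.dom) :
    ∀ᶠ w in 𝓝 w₀, f w ∈ (chart n p).source ∧ chart n p (f w) ∈ A.dom ∧
      ContDiffAt ℝ ∞ (chart n p ∘ f) w ∧ ∀ h, fderiv ℝ (chart n p ∘ f) w h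
        = A.lift (chart n p (f w)) (A.proj (fderiv ℝ (chart n p ∘ f) w h)) := by
  have hc := hf.self_of_nhds.1.continuousAt
  have h₁ : ∀ᶠ w in 𝓝 w₀, f w ∈ (chart n p).source := hc (source_mem_nhds hx)
  have h₂ : ∀ᶠ w in 𝓝 w₀, chart n p (f w) ∈ A.dom :=
    ((tendsto_chart hx).comp hc) (A.isOpen_dom.mem_nhds hy)
  filter_upwards [h₁, h₂, hf] with w hw₁ hw₂ hw
  refine ⟨hw₁, hw₂, ((contMDiffAt_chart hw₁).comp w hw.1).contDiffAt, fun h => ?_⟩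
  rw [(hasFDerivAt_chart_comp hw.1 hw₁).fderiv]
  exact ((A.mem_iff _ hw₁ hw₂ _).1 (hw.2 h)).symm

namespace IntegralManifold

variable (L : IntegralManifold I) (c : L.carrier)

/-- The parametrization of an integral manifold near `c` by the preferred chart at `c`. -/
noncomputable def param : EuclideanSpace ℝ (Fin k) → M := L.incl ∘ (extChartAt (𝓡 k) c).symm

lemma param_extChartAt_self : L.param c (extChartAt (𝓡 k) c c) = L.incl c := by
  rw [param, Function.comp_apply, (extChartAt (𝓡 k) c).left_inv (mem_extChartAt_source c)]

lemma contMDiffAt_param {w : EuclideanSpace ℝ (Fin k)} (hw : w ∈ (extChartAt (𝓡 k) c).target) :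
    ContMDiffAt (𝓡 k) (𝓡 (2 * n)) ∞ (L.param c) w :=
  L.contMDiff_incl.contMDiffAt.comp w
    ((contMDiffOn_extChartAt_symm c).contMDiffAt ((isOpen_extChartAt_target c).mem_nhds hw))

lemma isTangentAt_param : I.IsTangentAt (L.param c) (extChartAt (𝓡 k) c c) := by
  filter_upwards [extChartAt_target_mem_nhds (I := 𝓡 k) c] with w hw
  refine ⟨L.contMDiffAt_param c hw, fun h => ?_⟩
  have h₁ : MDifferentiableAt (𝓡 k) (𝓡 k) (extChartAt (𝓡 k) c).symm w :=
    ((contMDiffOn_extChartAt_symm (n := ∞) c).contMDiffAt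
      ((isOpen_extChartAt_target c).mem_nhds hw)).mdifferentiableAt (by simp)
  have h₂ := mfderiv_comp w (L.contMDiff_incl.contMDiffAt.mdifferentiableAt (by simp)) h₁
  change mfderiv (𝓡 k) (𝓡 (2 * n)) (L.incl ∘ (extChartAt (𝓡 k) c).symm) w h ∈ _
  rw [h₂]
  have := L.range_mfderiv ((extChartAt (𝓡 k) c).symm w)
  exact this.le ⟨_, rfl⟩

lemma exists_mfderiv_param_eq {v : TangentSpace (𝓡 (2 * n)) (L.incl c)}
    (hv : v ∈ I.space (L.incl c)) : ∃ h : EuclideanSpace ℝ (Fin k),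
      (mfderiv (𝓡 k) (𝓡 (2 * n)) (L.param c) (extChartAt (𝓡 k) c c) h : Coord n) = v := by
  rw [← L.range_mfderiv c] at hv
  obtain ⟨h, rfl⟩ := hv
  refine ⟨h, ?_⟩
  have h₁ : L.incl =ᶠ[𝓝 c] L.param c ∘ extChartAt (𝓡 k) c := by
    filter_upwards [extChartAt_source_mem_nhds (I := 𝓡 k) c] with z hz
    rw [Function.comp_apply, param, Function.comp_apply, (extChartAt (𝓡 k) c).left_inv hz]
  have h₂ := h₁.mfderiv_eq (I := 𝓡 k) (I' := 𝓡 (2 * n))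
  have h₃ := mfderiv_comp c ((L.contMDiffAt_param c
    (mem_extChartAt_target c)).mdifferentiableAt (by simp))
    ((contMDiffAt_extChartAt (I := 𝓡 k) (n := ∞) (x := c)).mdifferentiableAt (by simp))
  rw [mfderiv_extChartAt_self] at h₃
  exact (congrArg (fun g => (g h : Coord n)) (h₂.trans h₃)).symm

lemma exists_fderiv_chart_param_eq (A : AdaptedFrame I p)
    (hx : L.incl c ∈ (chart n p).source) (hy : chart n p (L.incl c) ∈ A.dom)
    (a : EuclideanSpace ℝ (Fin k)) :
    ∃ h, fderiv ℝ (chart n p ∘ L.param c) (extChartAt (𝓡 k) c c) h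
      = A.lift (chart n p (L.incl c)) a := by
  have hp := L.param_extChartAt_self c
  obtain ⟨h, hh⟩ := L.exists_mfderiv_param_eq c (A.fromCoord_lift_mem hx hy a)
  refine ⟨h, ?_⟩
  have hx' : L.param c (extChartAt (𝓡 k) c c) ∈ (chart n p).source := hp.symm ▸ hx
  rw [(hasFDerivAt_chart_comp (L.contMDiffAt_param c (mem_extChartAt_target c)) hx').fderiv]
  -- The two base points agree only propositionally while the tangent spaces depend on them, so the
  -- statement is generalized over the base point.
  have key : ∀ (q : M), q = L.incl c → ∀ v : Coord n,
      v = fromCoord p (L.incl c) (A.lift (chart n p (L.incl c)) a) →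
      toCoord p q v = A.lift (chart n p (L.incl c)) a := by
    rintro q rfl v rfl
    exact toCoord_fromCoord hx _
  exact key _ hp _ hh

end IntegralManifold

/-- The Frobenius condition holds at the points of an integral manifold. -/
lemma IntegralManifold.fderiv_lift_symm (L : IntegralManifold I) (c : L.carrier)
    (A : AdaptedFrame I p) (hx : L.incl c ∈ (chart n p).source)
    (hy : chart n p (L.incl c) ∈ A.dom) (a b : EuclideanSpace ℝ (Fin k)) :
    fderiv ℝ A.lift (chart n p (L.incl c)) (A.lift (chart n p (L.incl c)) a) b
      = fderiv ℝ A.lift (chart n p (L.incl c)) (A.lift (chart n p (L.incl c)) b) a := by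
  set w₀ := extChartAt (𝓡 k) c c with hw₀
  have hp : L.param c w₀ = L.incl c := L.param_extChartAt_self c
  set f : EuclideanSpace ℝ (Fin k) → Coord n := chart n p ∘ L.param c with hf
  have hfw : f w₀ = chart n p (L.incl c) := by rw [hf, Function.comp_apply, hp]
  have hev := (L.isTangentAt_param c).eventually_chart A (hp.symm ▸ hx) (hp.symm ▸ hy)
  rw [← hfw] at hy ⊢
  obtain ⟨u, hu⟩ := L.exists_fderiv_chart_param_eq c A hx (hfw ▸ hy) a
  obtain ⟨v, hv⟩ := L.exists_fderiv_chart_param_eq c A hx (hfw ▸ hy) b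
  have hd : ContDiffAt ℝ ∞ f w₀ := hev.self_of_nhds.2.2.1
  have hd₁ : HasFDerivAt f (fderiv ℝ f w₀) w₀ := (hd.differentiableAt (by simp)).hasFDerivAt
  have hd₂ : HasFDerivAt (fderiv ℝ f) (fderiv ℝ (fderiv ℝ f) w₀) w₀ :=
    ((hd.fderiv_right (m := ∞) (by simp)).differentiableAt (by simp)).hasFDerivAt
  have hsym : ∀ h h', fderiv ℝ (fderiv ℝ f) w₀ h h' = fderiv ℝ (fderiv ℝ f) w₀ h' h :=
    fun h h' => hd.isSymmSndFDerivAt (by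
      rw [minSmoothness_of_isRCLikeNormedField]
      exact WithTop.coe_le_coe.2 (le_top : (2 : ℕ∞) ≤ ⊤)) h h'
  -- Derivative of `Df h = K(f) (proj (Df h))`, which holds near `w₀` because the parametrization is
  -- tangent to the distribution.
  have hder : ∀ h h', fderiv ℝ (fderiv ℝ f) w₀ h' h
      = A.lift (f w₀) (A.proj (fderiv ℝ (fderiv ℝ f) w₀ h' h))
        + fderiv ℝ A.lift (f w₀) (fderiv ℝ f w₀ h') (A.proj (fderiv ℝ f w₀ h)) := by
    intro h h'
    have h₁ : HasFDerivAt (fun w => fderiv ℝ f w h)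
        ((ContinuousLinearMap.apply ℝ (Coord n) h) ∘L fderiv ℝ (fderiv ℝ f) w₀) w₀ :=
      (ContinuousLinearMap.apply ℝ (Coord n) h).hasFDerivAt.comp w₀ hd₂
    have h₂ := ((A.hasFDerivAt_lift hy).comp w₀ hd₁).clm_apply (A.proj.hasFDerivAt.comp w₀ h₁)
    have h₃ : (fun w => fderiv ℝ f w h) =ᶠ[𝓝 w₀]
        fun w => A.lift (f w) (A.proj (fderiv ℝ f w h)) := hev.mono fun w hw => hw.2.2.2 h
    exact congrArg (fun g => g h') (h₁.unique (h₂.congr_of_eventuallyEq h₃))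
  -- Exchanging the two directions changes neither the second derivative nor its tangential part, so
  -- the remaining `DK` terms agree.
  have h₁ := hder v u
  have h₂ := hder u v
  rw [hsym v u] at h₂
  rw [hu, hv, ← hfw, A.proj_lift _ hy] at h₁
  rw [hu, hv, ← hfw, A.proj_lift _ hy] at h₂
  exact add_left_cancel (h₁.symm.trans h₂)

end Tangent

/-! ### Plaques -/

section Plaque

open Metric Filter

variable {n k : ℕ} {M : Type*} [TopologicalSpace M]
  [ChartedSpace (EuclideanSpace ℝ (Fin (2 * n))) M] [IsManifold (𝓡 (2 * n)) ∞ M]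

/-- An adapted frame with an integral manifold through its centre, given by a solution of the total
differential equation `dF = K(F)`, where `K` is the parametrization of the distribution. -/
structure PlaqueFrame (I : RealDistribution n M k) (p : M) extends AdaptedFrame I p where
  /-- The radius of the plaque. -/
  radius : ℝ
  radius_pos : 0 < radius
  /-- The plaque in coordinates. -/
  plaque : EuclideanSpace ℝ (Fin k) → Coord n
  plaque_zero : plaque 0 = chart n p p
  plaque_spec : ∀ u ∈ ball (0 : EuclideanSpace ℝ (Fin k)) radius,
    plaque u ∈ dom ∧ HasFDerivAt plaque (lift (plaque u)) u

variable {I : RealDistribution n M k} {p : M}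

lemma AdaptedFrame.exists_plaqueFrame (A : AdaptedFrame I p)
    (h : ∀ y ∈ A.dom, ∀ a b,
      fderiv ℝ A.lift y (A.lift y a) b = fderiv ℝ A.lift y (A.lift y b) a) :
    ∃ B : PlaqueFrame I p, B.toAdaptedFrame = A := by
  obtain ⟨R, hR, F, hF₀, hF⟩ := exists_totalSolution A.isOpen_dom A.contDiffOn_lift h A.mem_dom
  exact ⟨⟨A, R, hR, F, hF₀, hF⟩, rfl⟩

namespace PlaqueFrame

variable (B : PlaqueFrame I p)

/-- The ball parametrizing the plaque. -/
def ball : Set (EuclideanSpace ℝ (Fin k)) := Metric.ball 0 B.radius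

/-- The parametrization of the plaque. -/
noncomputable def param (u : EuclideanSpace ℝ (Fin k)) : M := (chart n p).symm (B.plaque u)

/-- The coordinates of the plaque. -/
noncomputable def coord (x : M) : EuclideanSpace ℝ (Fin k) :=
  B.proj (chart n p x - B.plaque 0)

lemma isOpen_ball : IsOpen B.ball := Metric.isOpen_ball

lemma zero_mem_ball : 0 ∈ B.ball := mem_ball_self B.radius_pos

lemma contDiffOn_plaque : ContDiffOn ℝ ∞ B.plaque B.ball :=
  contDiffOn_of_hasFDerivAt_comp B.contDiffOn_lift B.isOpen_ball B.plaque_spec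

variable {B} {u : EuclideanSpace ℝ (Fin k)}

lemma plaque_mem_target (hu : u ∈ B.ball) : B.plaque u ∈ (chart n p).target :=
  B.dom_subset (B.plaque_spec u hu).1

lemma param_mem_source (hu : u ∈ B.ball) : B.param u ∈ (chart n p).source :=
  (chart n p).map_target (plaque_mem_target hu)

lemma chart_param (hu : u ∈ B.ball) : chart n p (B.param u) = B.plaque u :=
  (chart n p).right_inv (plaque_mem_target hu)

lemma coord_param (hu : u ∈ B.ball) : B.coord (B.param u) = u := by
  rw [coord, chart_param hu]
  exact proj_totalSolution B.proj_lift B.plaque_spec u hu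

lemma param_zero : B.param 0 = p := by
  rw [param, B.plaque_zero, (chart n p).left_inv (mem_extChartAt_source p)]

lemma coord_self : B.coord p = 0 := by
  rw [coord, B.plaque_zero, sub_self, map_zero]

lemma contMDiffAt_param (hu : u ∈ B.ball) : ContMDiffAt (𝓡 k) (𝓡 (2 * n)) ∞ B.param u :=
  (contMDiffAt_chart_symm (plaque_mem_target hu)).comp u
    (B.contDiffOn_plaque.contDiffAt (B.isOpen_ball.mem_nhds hu)).contMDiffAt

lemma toCoord_mfderiv_param (hu : u ∈ B.ball) (h : EuclideanSpace ℝ (Fin k)) :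
    toCoord p (B.param u) (mfderiv (𝓡 k) (𝓡 (2 * n)) B.param u h) = B.lift (B.plaque u) h := by
  have h₁ := hasFDerivAt_chart_comp (contMDiffAt_param hu) (param_mem_source hu)
  have h₂ : HasFDerivAt (chart n p ∘ B.param) (B.lift (B.plaque u)) u := by
    refine (B.plaque_spec u hu).2.congr_of_eventuallyEq ?_
    filter_upwards [B.isOpen_ball.mem_nhds hu] with w hw using chart_param hw
  exact congrArg (fun g => g h) (h₁.unique h₂)

lemma mem_space_param_iff (hu : u ∈ B.ball) (v : TangentSpace (𝓡 (2 * n)) (B.param u)) :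
    v ∈ I.space (B.param u) ↔
      ∃ h : EuclideanSpace ℝ (Fin k), (mfderiv (𝓡 k) (𝓡 (2 * n)) B.param u h : Coord n) = v := by
  rw [B.mem_space_iff (param_mem_source hu) (by rw [chart_param hu]; exact (B.plaque_spec u hu).1),
    chart_param hu]
  refine exists_congr fun h => ?_
  rw [← toCoord_mfderiv_param hu]
  exact ⟨fun e => (toCoord_injective (param_mem_source hu) e).symm,
    fun e => congrArg (toCoord p (B.param u)) e.symm⟩

lemma isTangentAt_param (hu : u ∈ B.ball) : I.IsTangentAt B.param u := by
  filter_upwards [B.isOpen_ball.mem_nhds hu] with w hw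
  exact ⟨contMDiffAt_param hw, fun h => (mem_space_param_iff hw _).2 ⟨h, rfl⟩⟩

lemma contDiffAt_coord_comp {W : Type*} [NormedAddCommGroup W] [NormedSpace ℝ W] {f : W → M}
    {w : W} (hf : ContMDiffAt 𝓘(ℝ, W) (𝓡 (2 * n)) ∞ f w) (hx : f w ∈ (chart n p).source) :
    ContDiffAt ℝ ∞ (B.coord ∘ f) w :=
  B.proj.contDiff.contDiffAt.comp w
    (((contMDiffAt_chart hx).comp w hf).contDiffAt.sub contDiffAt_const)

lemma continuousAt_coord {x : M} (hx : x ∈ (chart n p).source) : ContinuousAt B.coord x :=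
  B.proj.continuous.continuousAt.comp ((tendsto_chart hx).sub tendsto_const_nhds)

/-- A map tangent to the distribution which meets a plaque is locally contained in it. -/
lemma eventually_eq_param (B : PlaqueFrame I p) {W : Type*} [NormedAddCommGroup W]
    [NormedSpace ℝ W] {f : W → M} {w₀ : W} (hf : I.IsTangentAt f w₀) {u₀ : EuclideanSpace ℝ (Fin k)}
    (hu₀ : u₀ ∈ B.ball) (h : f w₀ = B.param u₀) :
    ∀ᶠ w in 𝓝 w₀, B.coord (f w) ∈ B.ball ∧ f w = B.param (B.coord (f w)) := by
  have hx : f w₀ ∈ (chart n p).source := h ▸ param_mem_source hu₀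
  have hc : chart n p (f w₀) = B.plaque u₀ := h ▸ chart_param hu₀
  have hev := hf.eventually_chart B.toAdaptedFrame hx (hc ▸ (B.plaque_spec u₀ hu₀).1)
  have key := eventually_eq_totalSolution B.isOpen_dom B.contDiffOn_lift B.plaque_spec
    (proj_totalSolution B.proj_lift B.plaque_spec) (f := chart n p ∘ f)
    (hev.self_of_nhds.2.2.1.of_le (by simp)) (hev.mono fun w hw => hw.2.2.2) hu₀ hc
  filter_upwards [key, hev] with w hw hw'
  refine ⟨hw.1, ?_⟩
  have h₁ : chart n p (f w) = B.plaque (B.coord (f w)) := hw.2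
  rw [param, ← h₁, (chart n p).left_inv hw'.1]

end PlaqueFrame

/-! ### The leaf topology -/

/-- The manifold with the topology whose connected components are the leaves. -/
def LeafSpace (_ : ∀ p, PlaqueFrame I p) : Type _ := M

namespace LeafSpace

variable (B : ∀ p, PlaqueFrame I p)

/-- The identity map to the leaf space. -/
def toLeaf (x : M) : LeafSpace B := x

variable {B}

/-- The identity map from the leaf space. -/
def point (x : LeafSpace B) : M := x

@[simp] lemma point_mk (x : M) : (toLeaf B x).point = x := rfl

@[simp] lemma mk_point (x : LeafSpace B) : toLeaf B x.point = x := rfl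

noncomputable instance : TopologicalSpace (LeafSpace B) :=
  TopologicalSpace.mkOfNhds fun x => map (fun u => toLeaf B ((B x.point).param u)) (𝓝 0)

/-- Maps tangent to the distribution are continuous for the leaf topology. -/
lemma tendsto_map_param {W : Type*} [NormedAddCommGroup W] [NormedSpace ℝ W] {f : W → M} {w₀ : W}
    (hf : I.IsTangentAt f w₀) {u₀ : EuclideanSpace ℝ (Fin k)} (hu₀ : u₀ ∈ (B p).ball)
    (h : f w₀ = (B p).param u₀) : Tendsto f (𝓝 w₀) (map (B p).param (𝓝 u₀)) := by
  have hc : Tendsto (fun w => (B p).coord (f w)) (𝓝 w₀) (𝓝 u₀) := by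
    have h₁ : ContinuousAt (B p).coord (f w₀) :=
      PlaqueFrame.continuousAt_coord (h ▸ PlaqueFrame.param_mem_source hu₀)
    have h₂ := ContinuousAt.tendsto (h₁.comp hf.self_of_nhds.1.continuousAt)
    rwa [Function.comp_apply, h, PlaqueFrame.coord_param hu₀] at h₂
  refine (tendsto_map.comp hc).congr' ?_
  filter_upwards [(B p).eventually_eq_param hf hu₀ h] with w hw using hw.2.symm

/-- The neighbourhood axiom asks that a neighbourhood of `y` in its plaque be a neighbourhood of all
nearby points of that plaque. It holds because the plaque centred at such a point is tangent to the
distribution and hence lies, near its centre, in the plaque of `y`. -/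
lemma nhds_mk (x : M) : 𝓝 (toLeaf B x) = map (fun u => toLeaf B ((B x).param u)) (𝓝 0) := by
  refine TopologicalSpace.nhds_mkOfNhds _ _ (fun y => ?_) fun y s hs => ?_
  · rw [Filter.pure_le_iff]
    intro s hs
    have := mem_of_mem_nhds (mem_map.1 hs)
    rwa [mem_preimage, PlaqueFrame.param_zero, mk_point] at this
  · rw [mem_map] at hs
    rw [Filter.eventually_map]
    filter_upwards [eventually_mem_nhds_iff.2 hs,
      (B y.point).isOpen_ball.mem_nhds (B y.point).zero_mem_ball] with u hu hub
    have h := tendsto_map_param (B := B) (PlaqueFrame.isTangentAt_param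
      (B ((B y.point).param u)).zero_mem_ball) hub PlaqueFrame.param_zero
    exact h hu

lemma tendsto_mk {W : Type*} [NormedAddCommGroup W] [NormedSpace ℝ W] {f : W → M} {w₀ : W}
    (hf : I.IsTangentAt f w₀) : ContinuousAt (fun w => toLeaf B (f w)) w₀ := by
  rw [ContinuousAt, nhds_mk]
  exact tendsto_map_param hf (B (f w₀)).zero_mem_ball PlaqueFrame.param_zero.symm

lemma continuous_point : Continuous (point : LeafSpace B → M) := by
  rw [continuous_iff_continuousAt]
  intro x
  change Tendsto point (𝓝 (toLeaf B x.point)) _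
  rw [nhds_mk, tendsto_map'_iff]
  have := (PlaqueFrame.contMDiffAt_param (B x.point).zero_mem_ball).continuousAt.tendsto
  rwa [PlaqueFrame.param_zero] at this

/-- The chart of the leaf space given by a plaque. -/
noncomputable def plaqueChart (x : LeafSpace B) :
    OpenPartialHomeomorph (LeafSpace B) (EuclideanSpace ℝ (Fin k)) where
  toFun y := (B x.point).coord y.point
  invFun u := toLeaf B ((B x.point).param u)
  source := (fun u => toLeaf B ((B x.point).param u)) '' (B x.point).ball
  target := (B x.point).ball
  map_source' := by
    rintro _ ⟨u, hu, rfl⟩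
    rwa [point_mk, PlaqueFrame.coord_param hu]
  map_target' u hu := ⟨u, hu, rfl⟩
  left_inv' := by
    rintro _ ⟨u, hu, rfl⟩
    rw [point_mk, PlaqueFrame.coord_param hu]
  right_inv' u hu := PlaqueFrame.coord_param hu
  open_source := by
    rw [isOpen_iff_mem_nhds]
    rintro _ ⟨u, hu, rfl⟩
    rw [nhds_mk, mem_map]
    have h := (B x.point).eventually_eq_param (PlaqueFrame.isTangentAt_param
      (B ((B x.point).param u)).zero_mem_ball) hu PlaqueFrame.param_zero
    filter_upwards [h] with w hw
    exact ⟨_, hw.1, hw.2.symm⟩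
  open_target := (B x.point).isOpen_ball
  continuousOn_toFun := by
    rintro _ ⟨u, hu, rfl⟩
    refine ContinuousAt.continuousWithinAt ?_
    exact ContinuousAt.comp (g := (B x.point).coord)
      (PlaqueFrame.continuousAt_coord (PlaqueFrame.param_mem_source hu))
      continuous_point.continuousAt
  continuousOn_invFun u hu :=
    (tendsto_mk (PlaqueFrame.isTangentAt_param hu)).continuousWithinAt

noncomputable instance : ChartedSpace (EuclideanSpace ℝ (Fin k)) (LeafSpace B) where
  atlas := range plaqueChart
  chartAt := plaqueChart
  mem_chart_source x := ⟨0, (B x.point).zero_mem_ball, by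
    simp only
    rw [PlaqueFrame.param_zero, mk_point]⟩
  chart_mem_atlas x := mem_range_self x

instance : IsManifold (𝓡 k) ∞ (LeafSpace B) := by
  refine isManifold_of_contDiffOn _ _ _ ?_
  rintro _ _ ⟨x, rfl⟩ ⟨y, rfl⟩
  rintro u ⟨⟨hu, v, hv, huv⟩, -⟩
  refine ContDiffAt.contDiffWithinAt ?_
  have hu' : u ∈ (B x.point).ball := hu
  have huv' : (B y.point).param v = (B x.point).param u := huv
  have hs : (B x.point).param u ∈ (chart n y.point).source :=
    huv' ▸ PlaqueFrame.param_mem_source hv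
  -- A change of plaque charts is a parametrization into `M` followed by the coordinate of another
  -- plaque, which is smooth on an open set of `M`.
  exact PlaqueFrame.contDiffAt_coord_comp (B := B y.point) (PlaqueFrame.contMDiffAt_param hu') hs

instance : LocallyConnectedSpace (LeafSpace B) :=
  ChartedSpace.locallyConnectedSpace (EuclideanSpace ℝ (Fin k)) (LeafSpace B)

variable (B) in
/-- The leaf through `x`, as an open subset of the leaf space. -/
def component (x : M) : TopologicalSpace.Opens (LeafSpace B) :=
  ⟨connectedComponent (toLeaf B x), isOpen_connectedComponent⟩

lemma eventually_eq_param_extChartAt {x : M} (c : component B x) :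
    (fun z : component B x => z.1.point) =ᶠ[𝓝 c]
      (B c.1.point).param ∘ extChartAt (𝓡 k) c := by
  have h := (plaqueChart c.1).open_source.mem_nhds (mem_chart_source _ c.1)
  filter_upwards [continuous_subtype_val.continuousAt.preimage_mem_nhds h] with z hz
  exact ((plaqueChart c.1).left_inv hz).symm

lemma extChartAt_self_mem_ball {x : M} (c : component B x) :
    extChartAt (𝓡 k) c c ∈ (B c.1.point).ball := by
  have h : extChartAt (𝓡 k) c c = 0 := PlaqueFrame.coord_self
  rw [h]
  exact (B c.1.point).zero_mem_ball

lemma contMDiff_component_point (x : M) :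
    ContMDiff (𝓡 k) (𝓡 (2 * n)) ∞ fun z : component B x => z.1.point := fun c =>
  ((PlaqueFrame.contMDiffAt_param (extChartAt_self_mem_ball c)).comp c
    (contMDiffAt_extChartAt (I := 𝓡 k) (n := ∞))).congr_of_eventuallyEq
      (eventually_eq_param_extChartAt c)

lemma mem_space_iff_mfderiv {x : M} (c : component B x) (v : TangentSpace (𝓡 (2 * n)) c.1.point) :
    v ∈ I.space c.1.point ↔ ∃ h : EuclideanSpace ℝ (Fin k),
      (mfderiv (𝓡 k) (𝓡 (2 * n)) (fun z : component B x => z.1.point) c h : Coord n) = v := by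
  have hu := extChartAt_self_mem_ball c
  have h₁ := (eventually_eq_param_extChartAt c).mfderiv_eq (I := 𝓡 k) (I' := 𝓡 (2 * n))
  have h₂ := mfderiv_comp c ((PlaqueFrame.contMDiffAt_param hu).mdifferentiableAt (by simp))
    ((contMDiffAt_extChartAt (I := 𝓡 k) (n := ∞) (x := c)).mdifferentiableAt (by simp))
  rw [mfderiv_extChartAt_self] at h₂
  have h₃ : ∀ h : EuclideanSpace ℝ (Fin k),
      (mfderiv (𝓡 k) (𝓡 (2 * n)) (fun z : component B x => z.1.point) c h : Coord n)
        = mfderiv (𝓡 k) (𝓡 (2 * n)) (B c.1.point).param (extChartAt (𝓡 k) c c) h := fun h =>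
    congrArg (fun g => (g h : Coord n)) (h₁.trans h₂)
  have key : ∀ q : M, q = (B c.1.point).param (extChartAt (𝓡 k) c c) → ∀ w : Coord n,
      ((w : TangentSpace (𝓡 (2 * n)) q) ∈ I.space q ↔ ∃ h : EuclideanSpace ℝ (Fin k),
        (mfderiv (𝓡 k) (𝓡 (2 * n)) (B c.1.point).param (extChartAt (𝓡 k) c c) h : Coord n)
          = w) := by
    rintro q rfl w
    exact PlaqueFrame.mem_space_param_iff hu w
  refine (key _ (eventually_eq_param_extChartAt c).self_of_nhds v).trans (exists_congr fun h => ?_)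
  rw [h₃]
  rfl

variable (B) in
/-- The leaf through `x`. -/
noncomputable def leaf (x : M) : IntegralManifold I :=
  haveI : ConnectedSpace (component B x) := Subtype.connectedSpace isConnected_connectedComponent
  { carrier := component B x
    incl := fun z => z.1.point
    contMDiff_incl := contMDiff_component_point x
    injective_incl := fun _ _ h => Subtype.ext h
    range_mfderiv := fun c => Submodule.ext fun v => (mem_space_iff_mfderiv c v).symm }

lemma range_leaf_incl (x : M) :
    range (leaf B x).incl = {y | toLeaf B y ∈ connectedComponent (toLeaf B x)} :=
  Set.ext fun y => ⟨fun ⟨z, hz⟩ => hz ▸ z.2, fun hy => ⟨⟨toLeaf B y, hy⟩, rfl⟩⟩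

end LeafSpace

/-! ### Integral manifolds in the leaf topology -/

open LeafSpace

namespace IntegralManifold

variable (B : ∀ p, PlaqueFrame I p) (L : IntegralManifold I)

/-- Near `c` the integral manifold lies in the plaque at `L.incl c`, and its expression in the
plaque coordinate has surjective derivative since its tangent space is all of `I`; a strictly
differentiable map with surjective derivative is open. -/
lemma map_param_nhds (c : L.carrier) :
    map (fun w => toLeaf B (L.param c w)) (𝓝 (extChartAt (𝓡 k) c c)) = 𝓝 (toLeaf B (L.incl c)) := by
  set w₀ := extChartAt (𝓡 k) c c
  set b := B (L.incl c)
  have hp : L.param c w₀ = L.incl c := L.param_extChartAt_self c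
  have hx : L.incl c ∈ (chart n (L.incl c)).source := mem_extChartAt_source _
  have hev := b.eventually_eq_param (L.isTangentAt_param c) b.zero_mem_ball
    (hp.trans PlaqueFrame.param_zero.symm)
  have hs : ContDiffAt ℝ ∞ (chart n (L.incl c) ∘ L.param c) w₀ :=
    ((contMDiffAt_chart (hp.symm ▸ hx)).comp w₀
      (L.contMDiffAt_param c (mem_extChartAt_target c))).contDiffAt
  have hd := hs.hasStrictFDerivAt (by simp)
  have hd' : HasStrictFDerivAt (b.coord ∘ L.param c)
      (b.proj ∘L fderiv ℝ (chart n (L.incl c) ∘ L.param c) w₀) w₀ :=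
    b.proj.hasStrictFDerivAt.comp w₀ (hd.sub_const (b.plaque 0))
  have hmap := hd'.map_nhds_eq_of_surj (by
    rw [LinearMap.range_eq_top]
    intro a
    obtain ⟨h, hh⟩ := L.exists_fderiv_chart_param_eq c b.toAdaptedFrame hx b.mem_dom a
    exact ⟨h, (congrArg b.proj hh).trans (b.proj_lift _ b.mem_dom a)⟩)
  rw [Function.comp_apply, hp, PlaqueFrame.coord_self] at hmap
  rw [nhds_mk, ← hmap, map_map]
  refine map_congr ?_
  filter_upwards [hev] with w hw using congrArg (toLeaf B) hw.2

/-- An integral manifold is open in the leaf space. -/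
lemma map_incl_nhds (c : L.carrier) :
    map (fun z => toLeaf B (L.incl z)) (𝓝 c) = 𝓝 (toLeaf B (L.incl c)) := by
  rw [← L.map_param_nhds B c]
  have h : map (extChartAt (𝓡 k) c).symm (𝓝 (extChartAt (𝓡 k) c c)) = 𝓝 c := by
    simpa using map_extChartAt_symm_nhdsWithin_range (I := 𝓡 k) c
  conv_lhs => rw [← h]
  rw [map_map]
  rfl

lemma continuous_mk_incl : Continuous fun z => toLeaf B (L.incl z) :=
  continuous_iff_continuousAt.2 fun c => (L.map_incl_nhds B c).le

lemma range_incl_subset (c : L.carrier) :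
    range L.incl ⊆ {y | toLeaf B y ∈ connectedComponent (toLeaf B (L.incl c))} := by
  rintro _ ⟨z, rfl⟩
  exact (isPreconnected_range (L.continuous_mk_incl B)).subset_connectedComponent
    (mem_range_self c) (mem_range_self z)

end IntegralManifold

/-- An integral manifold is connected and maps continuously to the leaf space, so it lies in a
single component. -/
lemma LeafSpace.isLeaf_leaf (B : ∀ p, PlaqueFrame I p) (x : M) : (leaf B x).IsLeaf := by
  rintro L' ⟨_, hy, c, rfl⟩
  rw [range_leaf_incl] at hy ⊢
  rw [connectedComponent_eq (show toLeaf B (L'.incl c) ∈ connectedComponent (toLeaf B x) from hy)]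
  exact L'.range_incl_subset B c

lemma RealDistribution.isIntegrable_of_plaqueFrame (B : ∀ p, PlaqueFrame I p) : I.IsIntegrable :=
  fun x => ⟨leaf B x, isLeaf_leaf B x, by
    rw [range_leaf_incl]
    exact mem_connectedComponent (x := toLeaf B x)⟩

lemma IntegralManifold.IsLeaf.range_incl {L : IntegralManifold I} (hL : L.IsLeaf)
    (B : ∀ p, PlaqueFrame I p) (c : L.carrier) :
    range L.incl = {y | toLeaf B y ∈ connectedComponent (toLeaf B (L.incl c))} := by
  refine (L.range_incl_subset B c).antisymm ?_
  rw [← range_leaf_incl]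
  refine hL _ ⟨L.incl c, mem_range_self c, ?_⟩
  rw [range_leaf_incl]
  exact mem_connectedComponent (x := toLeaf B (L.incl c))

/-- A continuous curve in the leaf space starting on a leaf lifts to the leaf. -/
lemma IntegralManifold.IsLeaf.exists_lift {L : IntegralManifold I} (hL : L.IsLeaf)
    (B : ∀ p, PlaqueFrame I p) {γ : ℝ → M} {J : Set ℝ} (hJ : IsPreconnected J)
    (hγ : ContinuousOn (fun t => toLeaf B (γ t)) J) {t₀ : ℝ} (ht₀ : t₀ ∈ J) {c₀ : L.carrier}
    (hc₀ : L.incl c₀ = γ t₀) :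
    ∃ c : ℝ → L.carrier, ContinuousOn c J ∧ ∀ t ∈ J, L.incl (c t) = γ t := by
  have hmem : ∀ t ∈ J, ∃ c, L.incl c = γ t := by
    intro t ht
    have h : γ t ∈ range L.incl := by
      rw [hL.range_incl B c₀, hc₀]
      exact (hJ.image _ hγ).subset_connectedComponent (mem_image_of_mem _ ht₀)
        (mem_image_of_mem _ ht)
    exact h
  classical
  let c : ℝ → L.carrier := fun t => if h : t ∈ J then (hmem t h).choose else c₀
  have hc : ∀ t ∈ J, L.incl (c t) = γ t := by
    intro t ht
    simp only [c, dif_pos ht]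
    exact (hmem t ht).choose_spec
  refine ⟨c, fun t ht => ?_, hc⟩
  intro s hs
  -- The inclusion of the leaf into the leaf space is open and injective, so continuity of the lift
  -- can be tested in the leaf space.
  have h₁ : (fun z => toLeaf B (L.incl z)) '' s ∈ 𝓝 (toLeaf B (γ t)) := by
    rw [← hc t ht, ← L.map_incl_nhds B]
    exact image_mem_map hs
  rw [mem_map]
  filter_upwards [hγ t ht h₁, self_mem_nhdsWithin] with r hr hrJ
  obtain ⟨z, hz, hzr⟩ := hr
  have : L.incl z = L.incl (c r) := Eq.trans hzr (hc r hrJ).symm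
  rwa [mem_preimage, ← L.injective_incl this]

end Plaque

/-! ### Geodesics and distributions -/

lemma eventually_eq_zero_of_norm_deriv_le {E : Type*} [NormedAddCommGroup E] [NormedSpace ℝ E]
    {b b' : ℝ → E} {C t : ℝ} (hd : ∀ᶠ s in 𝓝 t, HasDerivAt b (b' s) s)
    (hb : ∀ᶠ s in 𝓝 t, ‖b' s‖ ≤ C * ‖b s‖) (h0 : b t = 0) : ∀ᶠ s in 𝓝 t, b s = 0 := by
  obtain ⟨ε, hε, h⟩ := Metric.nhds_basis_closedBall.mem_iff.1 (hd.and hb)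
  rw [Real.closedBall_eq_Icc] at h
  have h₁ : ∀ s ∈ Icc t (t + ε), b s = 0 := by
    have hm : ∀ s ∈ Icc t (t + ε), s ∈ Icc (t - ε) (t + ε) := fun s hs =>
      ⟨by linarith [hs.1], hs.2⟩
    exact eq_zero_of_abs_deriv_le_mul_abs_self_of_eq_zero_right (K := C)
      (fun s hs => (h (hm s hs)).1.continuousAt.continuousWithinAt)
      (fun s hs => (h (hm s (Ico_subset_Icc_self hs))).1.hasDerivWithinAt) h0
      (fun s hs => (h (hm s (Ico_subset_Icc_self hs))).2)
  -- The Grönwall estimate runs forward in time; the past of `t` is covered by time reversal.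
  have h₂ : ∀ s ∈ Icc (-t) (-t + ε), b (-s) = 0 := by
    have hm : ∀ s ∈ Icc (-t) (-t + ε), -s ∈ Icc (t - ε) (t + ε) := fun s hs =>
      ⟨by linarith [hs.2], by linarith [hs.1]⟩
    have hd' : ∀ s ∈ Icc (-t) (-t + ε), HasDerivAt (fun s => b (-s)) (-b' (-s)) s := fun s hs => by
      have := (h (hm s hs)).1.scomp s (hasDerivAt_neg s)
      rwa [neg_one_smul] at this
    exact eq_zero_of_abs_deriv_le_mul_abs_self_of_eq_zero_right (K := C) (f := fun s => b (-s))
      (fun s hs => (hd' s hs).continuousAt.continuousWithinAt)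
      (fun s hs => (hd' s (Ico_subset_Icc_self hs)).hasDerivWithinAt) (by simpa using h0)
      (fun s hs => by
        rw [norm_neg]
        exact (h (hm s (Ico_subset_Icc_self hs))).2)
  filter_upwards [Metric.closedBall_mem_nhds t hε] with s hs
  rw [Real.closedBall_eq_Icc] at hs
  rcases le_total t s with hts | hts
  · exact h₁ s ⟨hts, hs.2⟩
  · simpa using h₂ (-s) ⟨by linarith, by linarith [hs.1]⟩

set_option synthInstance.maxHeartbeats 100000 in
lemma continuousAt_norm_bilinear {X E F G : Type*} [TopologicalSpace X]
    [NormedAddCommGroup E] [NormedSpace ℝ E] [NormedAddCommGroup F] [NormedSpace ℝ F]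
    [NormedAddCommGroup G] [NormedSpace ℝ G] {f : X → E →L[ℝ] F →L[ℝ] G} {x : X}
    (hf : ContinuousAt f x) : ContinuousAt (fun y => ‖f y‖) x :=
  hf.norm (E := E →L[ℝ] F →L[ℝ] G)

section Geodesic

variable {n k : ℕ} {M : Type*} [TopologicalSpace M]
  [ChartedSpace (EuclideanSpace ℝ (Fin (2 * n))) M] [IsManifold (𝓡 (2 * n)) ∞ M]
  {I : RealDistribution n M k} {p : M} {D : AffineConnection n M}

namespace AdaptedFrame

variable (A : AdaptedFrame I p)

/-- The extension of the second fundamental form to all tangent vectors. -/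
noncomputable def normalForm (D : AffineConnection n M) (y v w : Coord n) : Coord n :=
  fderiv ℝ A.lift y v (A.proj w) +
    (christoffel D p y w v - A.lift y (A.proj (christoffel D p y w v)))

lemma secondForm_eq_normalForm {y : Coord n} (hy : y ∈ A.dom) (a b : EuclideanSpace ℝ (Fin k)) :
    A.secondForm D y a b = A.normalForm D y (A.lift y a) (A.lift y b) := by
  rw [secondForm, normalForm, A.proj_lift y hy]

lemma normalForm_add_left (y v v' w : Coord n) :
    A.normalForm D y (v + v') w = A.normalForm D y v w + A.normalForm D y v' w := by
  simp only [normalForm, map_add, add_apply]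
  abel

lemma normalForm_add_right (y v w w' : Coord n) :
    A.normalForm D y v (w + w') = A.normalForm D y v w + A.normalForm D y v w' := by
  simp only [normalForm, map_add, add_apply]
  abel

/-- A bound for the norm of the bilinear map `normalForm`. -/
noncomputable def normalBound (D : AffineConnection n M) (y : Coord n) : ℝ :=
  ‖fderiv ℝ A.lift y‖ * ‖A.proj‖ + (1 + ‖A.lift y‖ * ‖A.proj‖) * ‖christoffel D p y‖

lemma norm_normalForm_le (y v w : Coord n) :
    ‖A.normalForm D y v w‖ ≤ A.normalBound D y * ‖v‖ * ‖w‖ := by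
  have h₁ : ‖christoffel D p y w v‖ ≤ ‖christoffel D p y‖ * ‖w‖ * ‖v‖ :=
    (christoffel D p y).le_opNorm₂ w v
  have h₂ : ‖fderiv ℝ A.lift y v (A.proj w)‖ ≤ ‖fderiv ℝ A.lift y‖ * ‖v‖ * (‖A.proj‖ * ‖w‖) :=
    ((fderiv ℝ A.lift y).le_opNorm₂ v (A.proj w)).trans
      (by gcongr; exact A.proj.le_opNorm w)
  have h₃ : ‖A.lift y (A.proj (christoffel D p y w v))‖
      ≤ ‖A.lift y‖ * (‖A.proj‖ * (‖christoffel D p y‖ * ‖w‖ * ‖v‖)) := by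
    refine ((A.lift y).le_opNorm _).trans ?_
    gcongr
    exact (A.proj.le_opNorm _).trans (by gcongr)
  calc ‖A.normalForm D y v w‖ ≤ ‖fderiv ℝ A.lift y v (A.proj w)‖ +
        (‖christoffel D p y w v‖ + ‖A.lift y (A.proj (christoffel D p y w v))‖) := by
        refine (norm_add_le _ _).trans ?_
        gcongr
        exact norm_sub_le _ _
    _ ≤ ‖fderiv ℝ A.lift y‖ * ‖v‖ * (‖A.proj‖ * ‖w‖) + (‖christoffel D p y‖ * ‖w‖ * ‖v‖ +
        ‖A.lift y‖ * (‖A.proj‖ * (‖christoffel D p y‖ * ‖w‖ * ‖v‖))) := by gcongr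
    _ = _ := by rw [normalBound]; ring

lemma continuousAt_normalBound [T2Space M]
    (hD : CovariantDerivative.ContMDiffCovariantDerivative D ∞) {y : Coord n} (hy : y ∈ A.dom) :
    ContinuousAt (A.normalBound D) y := by
  have h₁ := (A.contDiffAt_lift hy).continuousAt
  have h₂ : ContinuousAt (fderiv ℝ A.lift) y :=
    ((A.contDiffAt_lift hy).fderiv_right (m := ∞) (by simp)).continuousAt
  have h₃ : ContinuousAt (christoffel D p) y := by
    have := contDiffAt_christoffel hD ((chart n p).map_target (A.dom_subset hy))
    rw [(chart n p).right_inv (A.dom_subset hy)] at this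
    exact this.continuousAt
  exact ((continuousAt_norm_bilinear h₂).mul_const _).add
    ((continuousAt_const.add (h₁.norm.mul_const _)).mul (continuousAt_norm_bilinear h₃))

/-- The component of the velocity of a curve transverse to the distribution. -/
noncomputable def transverse (γ : ℝ → M) (t : ℝ) : Coord n :=
  deriv (fun s => chart n p (γ s)) t -
    A.lift (chart n p (γ t)) (A.proj (deriv (fun s => chart n p (γ s)) t))

lemma velocity_mem_iff {γ : ℝ → M} {t : ℝ} (hγ : ContMDiffAt 𝓘(ℝ, ℝ) (𝓡 (2 * n)) ∞ γ t)
    (hx : γ t ∈ (chart n p).source) (hy : chart n p (γ t) ∈ A.dom) :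
    velocity γ t ∈ I.space (γ t) ↔ A.transverse γ t = 0 := by
  rw [A.mem_iff _ hx hy, transverse, (hasDerivAt_chart_comp hγ hx).deriv, sub_eq_zero, eq_comm]

/-- The geodesic equation replaces the second derivative by the Christoffel term, and what remains
is the extended second form on the velocity. -/
lemma hasDerivAt_transverse {γ : ℝ → M} {t : ℝ} (hγ : ContMDiffAt 𝓘(ℝ, ℝ) (𝓡 (2 * n)) ∞ γ t)
    (hx : γ t ∈ (chart n p).source) (hy : chart n p (γ t) ∈ A.dom)
    (h : acceleration D γ t = 0) :
    HasDerivAt (A.transverse γ) (-A.normalForm D (chart n p (γ t))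
      (deriv (fun s => chart n p (γ s)) t) (deriv (fun s => chart n p (γ s)) t)) t := by
  set x : ℝ → Coord n := fun s => chart n p (γ s) with hxdef
  have hxs : ContDiffAt ℝ ∞ x t := contDiffAt_chart_comp hγ hx
  have hx1 : HasDerivAt x (deriv x t) t := (hxs.differentiableAt (by simp)).hasDerivAt
  have hx2 : HasDerivAt (deriv x) (deriv (deriv x) t) t := by
    refine DifferentiableAt.hasDerivAt ?_
    have h := (hxs.fderiv_right (m := ∞) (by simp)).differentiableAt (by simp)
    exact (h.clm_apply (differentiableAt_const (1 : ℝ)))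
  have hK : HasDerivAt (fun s => A.lift (x s)) (fderiv ℝ A.lift (x t) (deriv x t)) t :=
    (A.hasFDerivAt_lift hy).comp_hasDerivAt t hx1
  have hπ : HasDerivAt (fun s => A.proj (deriv x s)) (A.proj (deriv (deriv x) t)) t :=
    A.proj.hasFDerivAt.comp_hasDerivAt t hx2
  have hacc := toCoord_acceleration D hγ hx
  rw [h, map_zero] at hacc
  have hx'' : deriv (deriv x) t = -christoffel D p (x t) (deriv x t) (deriv x t) :=
    eq_neg_of_add_eq_zero_left hacc.symm
  convert! hx2.sub (hK.clm_apply hπ) using 1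
  rw [normalForm, hx'', map_neg, map_neg]
  abel

/-- The velocity of a geodesic which is once tangent to a totally geodesic distribution remains
tangent. -/
lemma eventually_transverse_eq_zero [T2Space M]
    (hD : CovariantDerivative.ContMDiffCovariantDerivative D ∞)
    (h : ∀ y ∈ A.dom, ∀ a b, A.secondForm D y a b = 0) {γ : ℝ → M} {t : ℝ}
    (hγ : ∀ᶠ s in 𝓝 t, ContMDiffAt 𝓘(ℝ, ℝ) (𝓡 (2 * n)) ∞ γ s ∧ acceleration D γ s = 0)
    (hx : γ t ∈ (chart n p).source) (hy : chart n p (γ t) ∈ A.dom) (h0 : A.transverse γ t = 0) :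
    ∀ᶠ s in 𝓝 t, A.transverse γ s = 0 := by
  set x : ℝ → Coord n := fun s => chart n p (γ s) with hxdef
  have hγt := hγ.self_of_nhds.1
  have hxs : ContDiffAt ℝ ∞ x t := contDiffAt_chart_comp hγt hx
  have hs : ∀ᶠ s in 𝓝 t, γ s ∈ (chart n p).source := hγt.continuousAt (source_mem_nhds hx)
  have hdom : ∀ᶠ s in 𝓝 t, x s ∈ A.dom := hxs.continuousAt (A.isOpen_dom.mem_nhds hy)
  have hdx : ContinuousAt (deriv x) t := by
    have := (hxs.fderiv_right (m := ∞) (by simp)).continuousAt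
    exact this.clm_apply continuousAt_const
  have hKx : ContinuousAt (fun s => A.lift (x s) (A.proj (deriv x s))) t :=
    ContinuousAt.clm_apply (ContinuousAt.comp (g := A.lift) (A.contDiffAt_lift hy).continuousAt
      hxs.continuousAt) (A.proj.continuous.continuousAt.comp hdx)
  set N : ℝ → ℝ := fun s => A.normalBound D (x s) * ‖deriv x s‖ +
    A.normalBound D (x s) * ‖A.lift (x s) (A.proj (deriv x s))‖ with hN
  have hNc : ContinuousAt N t := by
    have := ContinuousAt.comp (g := A.normalBound D) (f := x)
      (A.continuousAt_normalBound hD hy) hxs.continuousAt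
    exact (this.mul hdx.norm).add (this.mul hKx.norm)
  have hNb : ∀ᶠ s in 𝓝 t, N s < N t + 1 := hNc.eventually (gt_mem_nhds (lt_add_one _))
  refine eventually_eq_zero_of_norm_deriv_le (C := N t + 1)
    (b' := fun s => -A.normalForm D (x s) (deriv x s) (deriv x s)) ?_ ?_ h0
  · filter_upwards [hγ, hs, hdom] with s h₁ h₂ h₃
    exact A.hasDerivAt_transverse h₁.1 h₂ h₃ h₁.2
  · filter_upwards [hdom, hNb] with s h₁ h₂
    have h₄ : deriv x s = A.lift (x s) (A.proj (deriv x s)) + A.transverse γ s := by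
      rw [transverse]; abel
    -- The form vanishes on tangential pairs. Splitting the velocity into tangential and transverse
    -- parts leaves terms that each contain the transverse part, whence the linear differential
    -- inequality.
    have h₃ : A.normalForm D (x s) (deriv x s) (deriv x s)
        = A.normalForm D (x s) (deriv x s) (A.transverse γ s) +
          A.normalForm D (x s) (A.transverse γ s) (A.lift (x s) (A.proj (deriv x s))) := by
      have h₅ := h _ h₁ (A.proj (deriv x s)) (A.proj (deriv x s))
      rw [A.secondForm_eq_normalForm h₁] at h₅
      calc A.normalForm D (x s) (deriv x s) (deriv x s) = A.normalForm D (x s) (deriv x s)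
            (A.lift (x s) (A.proj (deriv x s)) + A.transverse γ s) := by rw [← h₄]
        _ = A.normalForm D (x s) (A.lift (x s) (A.proj (deriv x s)) + A.transverse γ s)
            (A.lift (x s) (A.proj (deriv x s))) +
              A.normalForm D (x s) (deriv x s) (A.transverse γ s) := by
            rw [normalForm_add_right, ← h₄]
        _ = _ := by rw [normalForm_add_left, h₅, zero_add, add_comm]
    rw [norm_neg, h₃]
    calc _ ≤ A.normalBound D (x s) * ‖deriv x s‖ * ‖A.transverse γ s‖ +
          A.normalBound D (x s) * ‖A.transverse γ s‖ * ‖A.lift (x s) (A.proj (deriv x s))‖ :=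
          (norm_add_le _ _).trans (add_le_add (A.norm_normalForm_le _ _ _)
            (A.norm_normalForm_le _ _ _))
      _ = N s * ‖A.transverse γ s‖ := by rw [hN]; ring
      _ ≤ _ := by gcongr

end AdaptedFrame

lemma IsGeodesicOn.eventually {γ : ℝ → M} {J : Set ℝ} (hγ : IsGeodesicOn D γ J) {t : ℝ}
    (ht : t ∈ J) : ∀ᶠ s in 𝓝 t, ContMDiffAt 𝓘(ℝ, ℝ) (𝓡 (2 * n)) ∞ γ s ∧
      acceleration D γ s = 0 := by
  filter_upwards [hγ.isOpen.mem_nhds ht] with s hs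
  exact ⟨hγ.contMDiffOn.contMDiffAt (hγ.isOpen.mem_nhds hs), hγ.geodesic s hs⟩

/-- The times at which the velocity is tangent form a subset of the interval `J` that is open, by
the differential inequality, and relatively closed, by continuity of the transverse part. -/
lemma IsGeodesicOn.velocity_mem [T2Space M]
    (hD : CovariantDerivative.ContMDiffCovariantDerivative D ∞) (A : ∀ p, AdaptedFrame I p)
    (h : ∀ p, ∀ y ∈ (A p).dom, ∀ a b, (A p).secondForm D y a b = 0) {γ : ℝ → M} {J : Set ℝ}
    (hγ : IsGeodesicOn D γ J) {t₀ : ℝ} (ht₀ : t₀ ∈ J) (h₀ : velocity γ t₀ ∈ I.space (γ t₀)) :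
    ∀ t ∈ J, velocity γ t ∈ I.space (γ t) := by
  have hloc : ∀ t ∈ J, ∀ᶠ s in 𝓝 t, s ∈ J ∧
      (velocity γ s ∈ I.space (γ s) ↔ (A (γ t)).transverse γ s = 0) := by
    intro t ht
    have hγt := (hγ.eventually ht).self_of_nhds.1
    have hx := mem_extChartAt_source (I := 𝓡 (2 * n)) (γ t)
    have h₁ : ∀ᶠ s in 𝓝 t, γ s ∈ (chart n (γ t)).source := hγt.continuousAt (source_mem_nhds hx)
    have h₂ : ∀ᶠ s in 𝓝 t, chart n (γ t) (γ s) ∈ (A (γ t)).dom :=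
      (contDiffAt_chart_comp hγt hx).continuousAt
        ((A (γ t)).isOpen_dom.mem_nhds (A (γ t)).mem_dom)
    filter_upwards [hγ.isOpen.mem_nhds ht, h₁, h₂, hγ.eventually ht] with s hs h₃ h₄ h₅
    exact ⟨hs, (A (γ t)).velocity_mem_iff h₅.1 h₃ h₄⟩
  set T : Set ℝ := {t | t ∈ J ∧ velocity γ t ∈ I.space (γ t)} with hT
  have hTo : IsOpen T := by
    rw [isOpen_iff_mem_nhds]
    rintro t ⟨ht, hv⟩
    have := (A (γ t)).eventually_transverse_eq_zero hD (h _) (hγ.eventually ht)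
      (mem_extChartAt_source _) (A (γ t)).mem_dom ((hloc t ht).self_of_nhds.2.1 hv)
    filter_upwards [this, hloc t ht] with s h₁ h₂ using ⟨h₂.1, h₂.2.2 h₁⟩
  have hTc : closure T ∩ J ⊆ T := by
    rintro t ⟨htc, ht⟩
    refine ⟨ht, (hloc t ht).self_of_nhds.2.2 ?_⟩
    have hγt := (hγ.eventually ht).self_of_nhds
    have hc : ContinuousAt ((A (γ t)).transverse γ) t :=
      ((A (γ t)).hasDerivAt_transverse hγt.1 (mem_extChartAt_source _) (A (γ t)).mem_dom
        hγt.2).continuousAt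
    have hfr : ∃ᶠ s in 𝓝 t, (A (γ t)).transverse γ s = 0 :=
      ((mem_closure_iff_frequently.1 htc).and_eventually (hloc t ht)).mono fun s hs =>
        hs.2.2.1 hs.1.2
    by_contra hne
    exact hfr (hc.eventually_ne hne)
  exact fun t ht => (hγ.ordConnected.isPreconnected.subset_of_closure_inter_subset hTo
    ⟨t₀, ht₀, ht₀, h₀⟩ hTc ht).2

/-- A geodesic tangent to the distribution at every time is continuous in the leaf topology, so it
remains in one component, that is, in the leaf where it starts. -/
lemma RealDistribution.hasTotallyGeodesicLeaves_of_secondForm_eq_zero [T2Space M]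
    (hD : CovariantDerivative.ContMDiffCovariantDerivative D ∞) (B : ∀ p, PlaqueFrame I p)
    (h : ∀ p, ∀ y ∈ (B p).dom, ∀ a b, (B p).secondForm D y a b = 0) :
    I.HasTotallyGeodesicLeaves D := by
  intro L hL γ J hγ t₀ ht₀ c₀ hc₀ hv
  have hvel := hγ.velocity_mem hD (fun p => (B p).toAdaptedFrame) h ht₀ hv
  refine hL.exists_lift B hγ.ordConnected.isPreconnected (fun t ht => ?_) ht₀ hc₀
  refine (LeafSpace.tendsto_mk ?_).continuousWithinAt
  filter_upwards [hγ.eventually ht, hγ.isOpen.mem_nhds ht] with s hs hsJ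
  refine ⟨hs.1, fun r => ?_⟩
  have : mfderiv 𝓘(ℝ, ℝ) (𝓡 (2 * n)) γ s r = r • velocity γ s := by
    rw [velocity]
    exact (congrArg _ (mul_one r).symm).trans (map_smul (mfderiv 𝓘(ℝ, ℝ) (𝓡 (2 * n)) γ s) r (1 : ℝ))
  rw [this]
  exact Submodule.smul_mem _ _ (hvel s hsJ)

theorem RealDistribution.IsParallelAlong.isIntegrable_and_hasTotallyGeodesicLeaves [T2Space M]
    {g : SemiRiemannianMetric n M} (hD : IsLeviCivita g D) (h : I.IsParallelAlong D) :
    I.IsIntegrable ∧ I.HasTotallyGeodesicLeaves D := by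
  have A : ∀ p, AdaptedFrame I p := fun p => (exists_adaptedFrame I p).some
  have hA : ∀ p, ∃ B : PlaqueFrame I p, B.toAdaptedFrame = A p := fun p =>
    (A p).exists_plaqueFrame fun y hy => (A p).fderiv_lift_symm_of_secondForm_eq_zero hD hy
      fun a b => (A p).secondForm_eq_zero h hy a b
  choose B _ using hA
  exact ⟨isIntegrable_of_plaqueFrame B, hasTotallyGeodesicLeaves_of_secondForm_eq_zero hD.smooth B
    fun p y hy a b => (B p).secondForm_eq_zero h hy a b⟩

/-! ### Existence of geodesics -/

/-- The geodesic equation is solved as a first-order system for position and velocity in the chart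
at `p`. Smoothness of the solution comes from the bootstrapping for total differential equations,
with one-dimensional parameter space. -/
lemma exists_isGeodesicOn [T2Space M]
    (hD : CovariantDerivative.ContMDiffCovariantDerivative D ∞) (p : M) (v : Coord n) :
    ∃ (γ : ℝ → M) (J : Set ℝ), IsGeodesicOn D γ J ∧ (0 : ℝ) ∈ J ∧ γ 0 = p ∧
      HasDerivAt (fun s => chart n p (γ s)) v 0 := by
  set f : Coord n × Coord n → Coord n × Coord n := fun z =>
    (z.2, -christoffel D p z.1 z.2 z.2) with hf
  set Ω : Set (Coord n × Coord n) := (chart n p).target ×ˢ univ with hΩ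
  have hΩo : IsOpen Ω := (isOpen_extChartAt_target p).prod isOpen_univ
  have hfs : ContDiffOn ℝ ∞ f Ω := by
    intro z hz
    have hΓ : ContDiffAt ℝ ∞ (christoffel D p) z.1 := by
      have := contDiffAt_christoffel hD ((chart n p).map_target hz.1)
      rwa [(chart n p).right_inv hz.1] at this
    have h₁ : ContDiffAt ℝ ∞ (fun z : Coord n × Coord n => christoffel D p z.1) z :=
      hΓ.comp z contDiffAt_fst
    exact (contDiffAt_snd.prodMk
      ((h₁.clm_apply contDiffAt_snd).clm_apply contDiffAt_snd).neg).contDiffWithinAt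
  have hx₀ : chart n p p ∈ (chart n p).target := mem_extChartAt_target p
  have hz₀ : (chart n p p, v) ∈ Ω := ⟨hx₀, mem_univ _⟩
  obtain ⟨α, hα₀, ε, hε, hα⟩ :=
    ((hfs.contDiffAt (hΩo.mem_nhds hz₀)).of_le
      (m := 1) (by simp)).exists_forall_mem_closedBall_exists_eq_forall_mem_Ioo_hasDerivAt₀ 0
  rw [zero_sub, zero_add] at hα
  have hαΩ : ∀ᶠ t in 𝓝 (0 : ℝ), α t ∈ Ω :=
    (hα 0 ⟨by linarith, hε⟩).continuousAt (hα₀.symm ▸ hΩo.mem_nhds hz₀)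
  obtain ⟨δ, hδ, hδ'⟩ := Metric.nhds_basis_ball.mem_iff.1
    (hαΩ.and (Ioo_mem_nhds (neg_neg_of_pos hε) hε))
  set J : Set ℝ := Metric.ball 0 δ with hJ
  have hJo : IsOpen J := Metric.isOpen_ball
  have hαs : ContDiffOn ℝ ∞ α J := by
    refine contDiffOn_of_hasFDerivAt_comp (Ω := Ω)
      (K := fun z => ContinuousLinearMap.smulRight (1 : ℝ →L[ℝ] ℝ) (f z)) ?_ hJo
      fun t ht => ⟨(hδ' ht).1, ?_⟩
    · exact (ContinuousLinearMap.smulRightL ℝ ℝ (Coord n × Coord n)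
        (1 : ℝ →L[ℝ] ℝ)).contDiff.comp_contDiffOn hfs
    · convert! (hα t (hδ' ht).2).hasFDerivAt using 1
  set γ : ℝ → M := fun t => (chart n p).symm (α t).1 with hγ
  have hγs : ∀ t ∈ J, γ t ∈ (chart n p).source := fun t ht =>
    (chart n p).map_target (hδ' ht).1.1
  have hx : ∀ t ∈ J, chart n p (γ t) = (α t).1 := fun t ht => (chart n p).right_inv (hδ' ht).1.1
  have hγm : ∀ t ∈ J, ContMDiffAt 𝓘(ℝ, ℝ) (𝓡 (2 * n)) ∞ γ t := fun t ht =>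
    (contMDiffAt_chart_symm (hδ' ht).1.1).comp t
      (contDiffAt_fst.comp t (hαs.contDiffAt (hJo.mem_nhds ht))).contMDiffAt
  have hd : ∀ t ∈ J, HasDerivAt (fun s => chart n p (γ s)) (α t).2 t := by
    intro t ht
    have h₁ : HasDerivAt (fun t => (α t).1) (α t).2 t :=
      (hasFDerivAt_fst (𝕜 := ℝ) (p := α t)).comp_hasDerivAt t (hα t (hδ' ht).2)
    refine h₁.congr_of_eventuallyEq ?_
    filter_upwards [hJo.mem_nhds ht] with s hs using hx s hs
  have h0J : (0 : ℝ) ∈ J := Metric.mem_ball_self hδ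
  refine ⟨γ, J, ⟨hJo, ?_, fun t ht => (hγm t ht).contMDiffWithinAt, fun t ht => ?_⟩, h0J, ?_, ?_⟩
  · exact (convex_ball (0 : ℝ) δ).ordConnected
  · refine toCoord_injective (hγs t ht) ?_
    have h₂ : deriv (fun s => chart n p (γ s)) =ᶠ[𝓝 t] fun s => (α s).2 := by
      filter_upwards [hJo.mem_nhds ht] with s hs using (hd s hs).deriv
    have h₃ : HasDerivAt (fun s => (α s).2) (-christoffel D p (α t).1 (α t).2 (α t).2) t :=
      (hasFDerivAt_snd (𝕜 := ℝ) (p := α t)).comp_hasDerivAt t (hα t (hδ' ht).2)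
    rw [toCoord_acceleration D (hγm t ht) (hγs t ht), h₂.deriv_eq, h₃.deriv, (hd t ht).deriv,
      hx t ht, map_zero, neg_add_cancel]
  · rw [hγ]
    simp only [hα₀]
    exact (chart n p).left_inv (mem_extChartAt_source p)
  · simpa [hα₀] using hd 0 h0J

/-- If the leaves are totally geodesic, the second fundamental form vanishes. -/
lemma PlaqueFrame.secondForm_self_eq_zero [T2Space M]
    (hD : CovariantDerivative.ContMDiffCovariantDerivative D ∞) (B : ∀ p, PlaqueFrame I p)
    (h : I.HasTotallyGeodesicLeaves D) (p : M) (a : EuclideanSpace ℝ (Fin k)) :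
    (B p).secondForm D (chart n p p) a a = 0 := by
  set y₀ := chart n p p with hy₀
  obtain ⟨γ, J, hγ, h0J, rfl, hd⟩ := exists_isGeodesicOn hD p ((B p).lift y₀ a)
  set b := B (γ 0) with hb
  set x : ℝ → Coord n := fun s => chart n (γ 0) (γ s) with hx
  have hγ₀ := (hγ.eventually h0J).self_of_nhds
  have hs₀ : γ 0 ∈ (chart n (γ 0)).source := mem_extChartAt_source _
  have hvel : toCoord (γ 0) (γ 0) (velocity γ 0) = b.lift y₀ a :=
    (hasDerivAt_chart_comp hγ₀.1 hs₀).unique hd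
  obtain ⟨L, hL, c₀, hc₀⟩ := RealDistribution.isIntegrable_of_plaqueFrame B (γ 0)
  obtain ⟨c, hc, hcγ⟩ := h L hL γ J hγ 0 h0J c₀ hc₀
    ((b.mem_space_iff hs₀ b.mem_dom _).2 ⟨a, hvel⟩)
  -- A leaf may meet a neighbourhood of `γ 0` in many plaques. Continuity of the lift to the leaf
  -- confines the geodesic, for small times, to the plaque through `γ 0`.
  have hcont : ContinuousAt (fun t => LeafSpace.toLeaf B (γ t)) 0 := by
    have h₁ : ContinuousAt c 0 := hc.continuousAt (hγ.isOpen.mem_nhds h0J)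
    refine ((L.continuous_mk_incl B).continuousAt.comp h₁).congr ?_
    filter_upwards [hγ.isOpen.mem_nhds h0J] with t ht
    exact congrArg (LeafSpace.toLeaf B) (hcγ t ht)
  have hplaque : ∀ᶠ t in 𝓝 (0 : ℝ), ∃ u ∈ b.ball, b.param u = γ t := by
    rw [ContinuousAt, LeafSpace.nhds_mk] at hcont
    exact hcont (Filter.image_mem_map (b.isOpen_ball.mem_nhds b.zero_mem_ball))
  have hxF : ∀ᶠ t in 𝓝 (0 : ℝ), b.proj (x t - b.plaque 0) ∈ b.ball ∧
      x t = b.plaque (b.proj (x t - b.plaque 0)) := by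
    filter_upwards [hplaque] with t ht
    obtain ⟨u, hu, hut⟩ := ht
    have h₁ : x t = b.plaque u := by rw [hx]; beta_reduce; rw [← hut, chart_param hu]
    have h₂ : b.proj (x t - b.plaque 0) = u := by
      rw [h₁]; exact proj_totalSolution b.proj_lift b.plaque_spec u hu
    rw [h₂]
    exact ⟨hu, h₁⟩
  -- Differentiating `x = F(proj (x - F 0))` gives `x' = K(x) (proj x')`, that is, no transverse
  -- velocity.
  have htr : b.transverse γ =ᶠ[𝓝 0] fun _ => 0 := by
    filter_upwards [hxF.eventually_nhds, hplaque, hγ.eventually h0J] with t ht hpt hγt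
    obtain ⟨u, hu, hut⟩ := hpt
    have hs : γ t ∈ (chart n (γ 0)).source := hut ▸ param_mem_source hu
    have hxt : HasDerivAt x (deriv x t) t :=
      ((contDiffAt_chart_comp hγt.1 hs).differentiableAt (by simp)).hasDerivAt
    have h₁ := ((b.plaque_spec _ ht.self_of_nhds.1).2.comp_hasDerivAt t
      (b.proj.hasFDerivAt.comp_hasDerivAt t (hxt.sub_const (b.plaque 0)))).congr_of_eventuallyEq
        (ht.mono fun s hs => hs.2)
    have h₂ := hxt.unique h₁
    rw [← ht.self_of_nhds.2] at h₂
    exact sub_eq_zero.2 h₂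
  have h₁ := b.hasDerivAt_transverse hγ₀.1 hs₀ b.mem_dom hγ₀.2
  -- At time zero the velocity is `K a`, so this derivative is minus the second form on `(a, a)`.
  have h₂ := h₁.unique ((hasDerivAt_const (0 : ℝ) (0 : Coord n)).congr_of_eventuallyEq htr)
  rw [hd.deriv, neg_eq_zero] at h₂
  rw [b.secondForm_eq_normalForm b.mem_dom]
  exact h₂

theorem RealDistribution.IsIntegrable.isParallelAlong [T2Space M] {g : SemiRiemannianMetric n M}
    (hD : IsLeviCivita g D) (hI : I.IsIntegrable) (h : I.HasTotallyGeodesicLeaves D) :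
    I.IsParallelAlong D := by
  have A : ∀ p, AdaptedFrame I p := fun p => (exists_adaptedFrame I p).some
  -- A leaf passes through every point of the chart domain, so the Frobenius condition holds on an
  -- open set and plaques can be constructed.
  have hsymm : ∀ p, ∀ A : AdaptedFrame I p, ∀ y ∈ A.dom, ∀ a b,
      fderiv ℝ A.lift y (A.lift y a) b = fderiv ℝ A.lift y (A.lift y b) a := by
    intro p A y hy a b
    have hyt := A.dom_subset hy
    obtain ⟨L, -, c, hc⟩ := hI ((chart n p).symm y)
    have hcy : chart n p (L.incl c) = y := by rw [hc, (chart n p).right_inv hyt]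
    have := L.fderiv_lift_symm c A (hc ▸ (chart n p).map_target hyt) (hcy.symm ▸ hy) a b
    rwa [hcy] at this
  choose B _ using fun p => (A p).exists_plaqueFrame (hsymm p (A p))
  refine isParallelAlong_of_secondForm_eq_zero (fun p => (B p).toAdaptedFrame) fun p a b => ?_
  have hy := (B p).mem_dom
  -- Preparation for polarization: a biadditive symmetric form that vanishes on the diagonal is
  -- zero.
  have hadd : ∀ a b c d : EuclideanSpace ℝ (Fin k), (B p).secondForm D (chart n p p) (a + b) (c + d)
      = ((B p).secondForm D (chart n p p) a c + (B p).secondForm D (chart n p p) b c) +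
        ((B p).secondForm D (chart n p p) a d + (B p).secondForm D (chart n p p) b d) := by
    intro a b c d
    simp only [(B p).secondForm_eq_normalForm hy, map_add, AdaptedFrame.normalForm_add_left,
      AdaptedFrame.normalForm_add_right]
  have hs : (B p).secondForm D (chart n p p) a b = (B p).secondForm D (chart n p p) b a := by
    rw [AdaptedFrame.secondForm, AdaptedFrame.secondForm,
      hsymm p (B p).toAdaptedFrame _ hy a b,
      christoffel_symm hD (mem_extChartAt_source p) ((B p).lift (chart n p p) b)
        ((B p).lift (chart n p p) a)]
  have h₀ := PlaqueFrame.secondForm_self_eq_zero hD.smooth B h p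
  have h₁ := hadd a b a b
  rw [h₀, h₀, h₀, hs, zero_add, add_zero, ← two_smul ℝ] at h₁
  rw [hs]
  exact (smul_eq_zero.1 h₁.symm).resolve_left two_ne_zero

end Geodesic

end PureSpinor

theorem theorem3 {n k : ℕ} {M : Type*} [TopologicalSpace M]
    [T2Space M] [SecondCountableTopology M]
    [ChartedSpace (EuclideanSpace ℝ (Fin (2 * n))) M] [IsManifold (𝓡 (2 * n)) ∞ M]
    (g : SemiRiemannianMetric n M) (D : AffineConnection n M) (hD : IsLeviCivita g D)
    {F : Type*} [NormedAddCommGroup F] [NormedSpace ℝ F]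
    {S : M → Type*} [TopologicalSpace (TotalSpace F S)]
    [∀ x, AddCommGroup (S x)] [∀ x, Module ℂ (S x)] [∀ x, TopologicalSpace (S x)]
    [∀ x, IsTopologicalAddGroup (S x)] [∀ x, ContinuousSMul ℝ (S x)]
    [FiberBundle F S] [VectorBundle ℝ F S] [ContMDiffVectorBundle ∞ F S (𝓡 (2 * n))]
    (σ : SpinorBundle g F S) (N : CovariantDerivative (𝓡 (2 * n)) F S)
    (hN : IsSpinorialConnection σ D N)
    (I : ComplexDistribution n M k) (hI : I.IsIsotropic g) :
    ((I.IsInvolutive ∧ I.IsTotallyGeodesic D) ↔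
      ∀ X : ComplexField n M, I.IsSection X →
        ∀ φ : (x : M) → S x, σ.IsAnnihilatedSection I φ →
          ∀ x, spinCovC N φ (X x) ∈ σ.annihilated I x) ∧
    ∀ I' : RealDistribution n M k, I.IsComplexificationOf I' →
      ((I'.IsIntegrable ∧ I'.HasTotallyGeodesicLeaves D) ↔
        ∀ X : ComplexField n M, I.IsSection X →
          ∀ φ : (x : M) → S x, σ.IsAnnihilatedSection I φ →
            ∀ x, spinCovC N φ (X x) ∈ σ.annihilated I x) := by
  -- The common core of both parts: (∗) is equivalent to `∇` preserving `I` along itself.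
  have hA : (I.IsTotallyGeodesic D ↔ ∀ X : ComplexField n M, I.IsSection X →
      ∀ φ : (x : M) → S x, σ.IsAnnihilatedSection I φ →
        ∀ x, spinCovC N φ (X x) ∈ σ.annihilated I x) :=
    ⟨fun h _ hX _ hφ x => h.spinCovC_mem hN hX hφ x, fun h => hI.isTotallyGeodesic hN h⟩
  refine ⟨?_, fun I' hI' => ?_⟩
  · rw [← hA]
    exact ⟨fun h => h.2, fun h => ⟨h.isInvolutive hD, h⟩⟩
  · rw [← hA, hI'.isTotallyGeodesic_iff]
    exact ⟨fun h => h.1.isParallelAlong hD h.2,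
      fun h => h.isIntegrable_and_hasTotallyGeodesicLeaves hD⟩
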